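/- Let $d\ge 2$. For an open set $O\subset\mathbb R^d$ and a real $m>0$, let $\mathcal C_b^m(O,\mathbb C)$ be the space of functions $g:O\to\mathbb C$ that are $\lfloor m\rfloor$ times continuously differentiable with all partial derivatives of order $0,\dots,\lfloor m\rfloor$ bounded on $O$ and, if $m\notin\mathbb N$, with all partial derivatives of order $\lfloor m\rfloor$ Hölder continuous on $O$ with exponent $m-\lfloor m\rfloor$. Write $B_R=\{t\in\mathbb R^d:\|t\|<R\}$ and $K_{r,b}=\{t\in\mathbb R^d: r<\|t\|<b\}$. Let $(X_n,S_n)_{n\ge 0}$ be random variables on a probability space with values in $E\times\mathbb R^d$, where $E$ is a measurable space, and let $f:E\to[0,+\infty)$ be measurable. For $m\ge 2$, Hypothesis $\mathcal R(m)$ (with functions $\lambda$, $L$) says that $\mathbb E[f(X_n)]<\infty$ for all $n\ge 1$ and: (i) there is $R>0$ such that for all $t\in B_R$ and all $n\ge 1$, $$\mathbb E\big[f(X_n)\,e^{i\langle t,S_n\rangle}\big]=\lambda(t)^n L(t)+R_n(t),$$ where $\lambda(0)=1$, $\lambda,L\in\mathcal C_b^m(B_R,\mathbb C)$, and the series $\sum_{n\ge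 1}R_n$ converges uniformly on $B_R$ to a function in $\mathcal C_b^m(B_R,\mathbb C)$; (ii) for all $0<r<b$, the series $\sum_{n\ge 1}\mathbb E\big[f(X_n)\,e^{i\langle\cdot,S_n\rangle}\big]$ converges uniformly on $K_{r,b}$ to a function in $\mathcal C_b^m(K_{r,b},\mathbb C)$. Assume Hypothesis (H): $\mathcal R(m)$ holds for some real $m>m_d:=\max\big(\tfrac{d-1}{2},2\big)$, $L(0)\ne 0$, the vector $\vec m:=-i\nabla\lambda(0)\in\mathbb R^d$ is nonzero, and $\Sigma:=-\mathrm{Hess}\,\lambda(0)$ is a (real symmetric) positive-definite matrix. Then, for each function $\mathfrak a:[0,+\infty)\to\mathbb R^d$ such that $\mathfrak A:=\lim_{\tau\to+\infty}\frac{\mathfrak a(\tau)-\tau\vec m}{\sqrt\tau}$ exists in $\mathbb R^d$, the family of positive measures $V_\tau$, $\tau>0$, on $\mathbb R^d$ defined by $$V_\tau(A):=(2\pi\tau)^{\frac{d-1}{2}}\sum_{n=1}^{+\infty}\mathbb E\big[f(X_n)\,1_A(S_n-\mathfrak a(\tau))\big]\qquad(A\subset\mathbb R^d\text{ Borel})$$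 converges weakly to $C\,L_d$ as $\tau\to+\infty$, where $L_d$ is Lebesgue measure on $\mathbb R^d$; that is, each $V_\tau$ is finite on compact sets and $\int g\,dV_\tau\to C\int_{\mathbb R^d}g(x)\,dx$ for every continuous compactly supported $g:\mathbb R^d\to\mathbb R$. Here $C\in(0,+\infty)$ is given by $$C=L(0)\,\frac{\det S}{\|S\vec m\|}\,\exp\bigg(\frac{\langle S\vec m,S\mathfrak A\rangle^2-\|S\vec m\|^2\|S\mathfrak A\|^2}{2\|S\vec m\|^2}\bigg),\qquad S:=\Sigma^{-1/2}.$$ -/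

import Mathlib

open MeasureTheory Filter Topology Metric
open scoped NNReal ENNReal RealInnerProductSpace MatrixOrder

noncomputable section

namespace Renewal

/-- `ℝᵈ` with its canonical scalar product and Euclidean norm. -/
abbrev Rd (d : ℕ) : Type := EuclideanSpace ℝ (Fin d)

/-- The annulus `K_{r,b} = {t : r < ‖t‖ < b}`. -/
def annulus (d : ℕ) (r b : ℝ) : Set (Rd d) := {t | r < ‖t‖ ∧ ‖t‖ < b}

/-- `g ∈ C_b^m(O, ℂ)` for an open set `O` and a real `m > 0`: `g` is `⌊m⌋` times continuously
differentiable on `O`, all its derivatives of order `0, …, ⌊m⌋` are bounded on `O`, and those of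
order `⌊m⌋` are Hölder on `O` with exponent `m - ⌊m⌋`. When `m` is an integer the exponent is `0`
and the last condition follows from boundedness, so nothing is added. Only the values of `g` on
the open set `O` matter, and all partial derivatives of order `j` are bounded (Hölder) if and only
if the `j`-th total derivative is. -/
structure IsCbm {d : ℕ} (m : ℝ) (O : Set (Rd d)) (g : Rd d → ℂ) : Prop where
  contDiffOn : ContDiffOn ℝ (⌊m⌋₊ : ℕ) g O
  bounded : ∀ j : ℕ, j ≤ ⌊m⌋₊ → ∃ K : ℝ, ∀ x ∈ O, ‖iteratedFDeriv ℝ j g x‖ ≤ K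
  hoelder : ∃ K : ℝ, ∀ x ∈ O, ∀ y ∈ O,
    ‖iteratedFDeriv ℝ ⌊m⌋₊ g x - iteratedFDeriv ℝ ⌊m⌋₊ g y‖ ≤ K * ‖x - y‖ ^ (m - (⌊m⌋₊ : ℝ))

section RandomWalk

variable {Ω E : Type*} [MeasurableSpace Ω] [MeasurableSpace E] {d : ℕ}

/-- `E_n(t) = 𝔼[f(X_n) exp(i⟨t, S_n⟩)]`. -/
def fourierTerm (P : Measure Ω) (X : ℕ → Ω → E) (S : ℕ → Ω → Rd d) (f : E → ℝ≥0)
    (n : ℕ) (t : Rd d) : ℂ :=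
  ∫ ω, ((f (X n ω) : ℝ) : ℂ) * Complex.exp (Complex.I * ((⟪t, S n ω⟫ : ℝ) : ℂ)) ∂P

/-- Hypothesis `R(m)`, with the functions `λ` (here `lam`) and `L`. Convergence of a series of
functions is convergence of its partial sums. -/
structure HypothesisR (P : Measure Ω) (X : ℕ → Ω → E) (S : ℕ → Ω → Rd d) (f : E → ℝ≥0)
    (m : ℝ) (lam L : Rd d → ℂ) : Prop where
  integrable : ∀ n : ℕ, 1 ≤ n → Integrable (fun ω => (f (X n ω) : ℝ)) P
  near_zero : ∃ R : ℝ, 0 < R ∧ ∃ Rem : ℕ → Rd d → ℂ,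
    (∀ t ∈ ball (0 : Rd d) R, ∀ n : ℕ, 1 ≤ n →
      fourierTerm P X S f n t = lam t ^ n * L t + Rem n t) ∧
    lam 0 = 1 ∧
    IsCbm m (ball (0 : Rd d) R) lam ∧
    IsCbm m (ball (0 : Rd d) R) L ∧
    ∃ G : Rd d → ℂ,
      TendstoUniformlyOn (fun (N : ℕ) (t : Rd d) => ∑ n ∈ Finset.Icc 1 N, Rem n t) G atTop
        (ball (0 : Rd d) R) ∧
      IsCbm m (ball (0 : Rd d) R) G
  away_from_zero : ∀ r b : ℝ, 0 < r → r < b →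
    ∃ G : Rd d → ℂ,
      TendstoUniformlyOn
        (fun (N : ℕ) (t : Rd d) => ∑ n ∈ Finset.Icc 1 N, fourierTerm P X S f n t) G atTop
        (annulus d r b) ∧
      IsCbm m (annulus d r b) G

/-- Hypothesis (H): `R(m)` holds for some `m > max((d-1)/2, 2)`, `L(0) ≠ 0`, the mean vector
`mvec = -i∇λ(0)` is a nonzero vector of `ℝᵈ`, and `Sig = -Hess λ(0)` is a positive definite
(real symmetric) matrix. -/
structure HypothesisH (P : Measure Ω) (X : ℕ → Ω → E) (S : ℕ → Ω → Rd d) (f : E → ℝ≥0)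
    (lam L : Rd d → ℂ) (mvec : Rd d) (Sig : Matrix (Fin d) (Fin d) ℝ) : Prop where
  hypR : ∃ m : ℝ, max (((d : ℝ) - 1) / 2) 2 < m ∧ HypothesisR P X S f m lam L
  L_zero_ne : L 0 ≠ 0
  mean_eq : ∀ j : Fin d,
    ((mvec j : ℝ) : ℂ) = -Complex.I * fderiv ℝ lam 0 (EuclideanSpace.single j (1 : ℝ))
  mean_ne : mvec ≠ 0
  sigma_eq : ∀ j k : Fin d,
    ((Sig j k : ℝ) : ℂ) = -iteratedFDeriv ℝ 2 lam 0
      ![EuclideanSpace.single j (1 : ℝ), EuclideanSpace.single k (1 : ℝ)]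
  sigma_posDef : Sig.PosDef

/-- The measure `V_τ(A) = (2πτ)^{(d-1)/2} ∑_{n ≥ 1} 𝔼[f(X_n) 1_A(S_n - a(τ))]`; the index `n` of
the sum below stands for `n + 1`. -/
def renewalMeasure (P : Measure Ω) (X : ℕ → Ω → E) (S : ℕ → Ω → Rd d) (f : E → ℝ≥0)
    (a : ℝ → Rd d) (τ : ℝ) : Measure (Rd d) :=
  ENNReal.ofReal ((2 * Real.pi * τ) ^ (((d : ℝ) - 1) / 2)) •
    Measure.sum fun n : ℕ =>
      (P.withDensity fun ω => (f (X (n + 1) ω) : ℝ≥0∞)).map fun ω => S (n + 1) ω - a τ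

theorem renewalMeasure_apply (P : Measure Ω) (X : ℕ → Ω → E) (S : ℕ → Ω → Rd d) (f : E → ℝ≥0)
    (a : ℝ → Rd d) (τ : ℝ) (hS : ∀ n, Measurable (S n))
    {A : Set (Rd d)} (hA : MeasurableSet A) :
    renewalMeasure P X S f a τ A =
      ENNReal.ofReal ((2 * Real.pi * τ) ^ (((d : ℝ) - 1) / 2)) *
        ∑' n : ℕ, ∫⁻ ω, (f (X (n + 1) ω) : ℝ≥0∞) * A.indicator 1 (S (n + 1) ω - a τ) ∂P := by
  rw [renewalMeasure, Measure.smul_apply, Measure.sum_apply _ hA, smul_eq_mul]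
  congr 1
  refine tsum_congr fun n => ?_
  have h1 : Measurable fun ω => S (n + 1) ω - a τ := (hS _).sub_const _
  rw [Measure.map_apply h1 hA, withDensity_apply _ (h1 hA), ← lintegral_indicator (h1 hA)]
  refine lintegral_congr fun ω => ?_
  by_cases h : S (n + 1) ω - a τ ∈ A <;> simp [Set.indicator, h]

end RandomWalk

/-- `Σ^{-1/2}`: the nonnegative square root of `Σ⁻¹`. -/
def invSqrt {d : ℕ} (Sig : Matrix (Fin d) (Fin d) ℝ) : Matrix (Fin d) (Fin d) ℝ :=
  CFC.sqrt Sig⁻¹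

theorem invSqrt_posSemidef {d : ℕ} (Sig : Matrix (Fin d) (Fin d) ℝ) :
    (invSqrt Sig).PosSemidef :=
  Matrix.nonneg_iff_posSemidef.mp (CFC.sqrt_nonneg _)

theorem invSqrt_mul_self {d : ℕ} {Sig : Matrix (Fin d) (Fin d) ℝ} (h : Sig.PosDef) :
    invSqrt Sig * invSqrt Sig = Sig⁻¹ :=
  CFC.sqrt_mul_sqrt_self _ h.inv.posSemidef.nonneg

/-- The constant
`L(0) (det S / ‖S m‖) exp((⟨S m, S A⟩² - ‖S m‖² ‖S A‖²) / (2 ‖S m‖²))` with `S = Σ^{-1/2}`. -/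
def renewalConst {d : ℕ} (L : Rd d → ℂ) (mvec : Rd d) (Sig : Matrix (Fin d) (Fin d) ℝ)
    (A : Rd d) : ℂ :=
  let S := invSqrt Sig
  let Sm : Rd d := Matrix.toEuclideanCLM (𝕜 := ℝ) S mvec
  let SA : Rd d := Matrix.toEuclideanCLM (𝕜 := ℝ) S A
  L 0 * ((S.det / ‖Sm‖ *
    Real.exp ((⟪Sm, SA⟫ ^ 2 - ‖Sm‖ ^ 2 * ‖SA‖ ^ 2) / (2 * ‖Sm‖ ^ 2)) : ℝ) : ℂ)

/-- Weak convergence, as `τ → +∞`, of the family `V_τ`, `τ > 0`, of positive measures on `ℝᵈ` to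
the (possibly infinite) measure `ν`: every `V_τ` is finite on compact sets, and
`V_τ(g) → ν(g)` for all continuous compactly supported `g`. -/
def WeaklyConverges {d : ℕ} (V : ℝ → Measure (Rd d)) (ν : Measure (Rd d)) : Prop :=
  (∀ τ : ℝ, 0 < τ → IsFiniteMeasureOnCompacts (V τ)) ∧
  ∀ g : Rd d → ℝ, Continuous g → HasCompactSupport g →
    Tendsto (fun τ : ℝ => ∫ x, g x ∂(V τ)) atTop (𝓝 (∫ x, g x ∂ν))

end Renewal

end

/-!
The proof is a Fourier inversion. For a smooth compactly supported `k` with Fourier transform `h`,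
`∑ 𝔼[f(X_n) h(S_n - a)] = ∫ k(t) exp(-i⟨t, a⟩) (∑ 𝔼[f(X_n) exp(i⟨t, S_n⟩)]) dt`, and by hypothesis
the inner series is of class `C_b^m` away from `0`, while near `0` it equals `L λ / (1 - λ)` up to
such a function (`exists_limit_asymptotics`). Three facts then give the theorem.

* A contribution of class `C^m` is `O(|a| ^ (-m))`, hence negligible after multiplication by
  `τ ^ ((d - 1) / 2)`, because `m > (d - 1) / 2` (`tendsto_fourierInt_smooth`).

* The singular contribution has a limit (`tendsto_fourierInt_div_drifted`). With `b = -i∇λ(0)`,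
  write `1 - λ(t) = F(t) - i⟨t, b⟩`, where `Re F ≥ c ‖t‖ ^ 2`, and insert
  `1 / (1 - λ) = ∫₀^∞ exp(-u (1 - λ)) du`: the singular integral becomes the integral over
  `u > 0` of `∫ ψ(t) exp(-u F(t)) exp(-i⟨t, a - u b⟩) dt`, which behaves like the density
  at `a` of a random walk at time `u`. For `u = τ + √τ x` a local limit theorem holds, and integrating the
  Gaussian limit over `x` gives the constant (`integral_fourierInt_gaussian`). Dominated convergence
  on the range `u > τ / 2`, and the negligibility of `u ≤ τ / 2`, both come from one estimate
  (`exists_norm_fourierInt_damped_le`): the inner integral has size `(1 + u) ^ (-d/2)`, with an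
  additional factor `(√(1 + u) / |⟨a - u b, e⟩|) ^ m` for `e = b / ‖b‖`. It is proved with finite
  differences of order `⌊m⌋ + 1` in the direction `e`. All that a finite difference sees of a
  function is a Taylor expansion at each point, so regularity is handled through the notion of jet,
  `HasJet`, for which products and exponentials are easy.

* Test functions `h` obtained in this way can be nonnegative and bounded below on any given ball
  (`exists_test_kernel`); multiplying `h` by a character amounts to translating `k`. So the
  finite measures `h V_τ` have convergent characteristic functions, and Lévy's theorem gives the
  weak convergence (`weaklyConverges_of_tendsto_fourier`).
-/

noncomputable section

namespace Renewal

section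

/-! ### Jets of functions of one real variable -/

/-- `g` has a jet of degree `k` at `0` with a remainder of order `m`: on `[-1, 1]` it is a
polynomial of degree at most `k` with coefficients bounded by `M`, up to an error `M |σ| ^ m`.
With `k = ⌊m⌋` this is the pointwise content of `C^m` regularity; unlike bounds on derivatives,
it is stable under products and exponentials without any combinatorics. -/
def HasJet (k : ℕ) (m M : ℝ) (g : ℝ → ℂ) : Prop :=
  ∃ p : ℕ → ℂ, (∀ j, j ≤ k → ‖p j‖ ≤ M) ∧
    ∀ σ : ℝ, |σ| ≤ 1 → ‖g σ - ∑ j ∈ Finset.range (k + 1), p j * (σ : ℂ) ^ j‖ ≤ M * |σ| ^ m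

variable {k : ℕ} {m M M' : ℝ} {g g' : ℝ → ℂ}

theorem HasJet.nonneg (h : HasJet k m M g) : 0 ≤ M := by
  obtain ⟨p, hp, -⟩ := h
  exact (norm_nonneg _).trans (hp 0 (Nat.zero_le _))

theorem HasJet.mono (h : HasJet k m M g) (hM : M ≤ M') : HasJet k m M' g := by
  obtain ⟨p, hp, hr⟩ := h
  exact ⟨p, fun j hj => (hp j hj).trans hM, fun σ hσ => (hr σ hσ).trans (by gcongr)⟩

theorem HasJet.congr (h : HasJet k m M g) (hg : ∀ σ : ℝ, |σ| ≤ 1 → g' σ = g σ) :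
    HasJet k m M g' := by
  obtain ⟨p, hp, hr⟩ := h
  exact ⟨p, hp, fun σ hσ => by rw [hg σ hσ]; exact hr σ hσ⟩

theorem hasJet_const (c : ℂ) : HasJet k m ‖c‖ (fun _ => c) := by
  refine ⟨fun j => if j = 0 then c else 0, fun j _ => ?_, fun σ _ => ?_⟩
  · dsimp only
    split_ifs <;> simp
  · rw [Finset.sum_eq_single 0 (by simp +contextual) (by simp)]
    simpa using mul_nonneg (norm_nonneg c) (Real.rpow_nonneg (abs_nonneg σ) m)

theorem HasJet.add (h : HasJet k m M g) (h' : HasJet k m M' g') :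
    HasJet k m (M + M') (fun σ => g σ + g' σ) := by
  obtain ⟨p, hp, hr⟩ := h
  obtain ⟨q, hq, hs⟩ := h'
  refine ⟨fun j => p j + q j, fun j hj => (norm_add_le _ _).trans (add_le_add (hp j hj) (hq j hj)),
    fun σ hσ => ?_⟩
  have : g σ + g' σ - ∑ j ∈ Finset.range (k + 1), (p j + q j) * (σ : ℂ) ^ j =
      (g σ - ∑ j ∈ Finset.range (k + 1), p j * (σ : ℂ) ^ j) +
      (g' σ - ∑ j ∈ Finset.range (k + 1), q j * (σ : ℂ) ^ j) := by
    simp only [add_mul, Finset.sum_add_distrib]; ring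
  rw [this, add_mul]
  exact (norm_add_le _ _).trans (add_le_add (hr σ hσ) (hs σ hσ))

/-- A function of size `O(|σ| ^ (k + 1))` has the zero jet. -/
theorem hasJet_of_norm_le (hm : m ≤ k + 1) (hM : 0 ≤ M)
    (h : ∀ σ : ℝ, |σ| ≤ 1 → ‖g σ‖ ≤ M * |σ| ^ (k + 1)) (hm0 : 0 < m) : HasJet k m M g := by
  refine ⟨0, by simpa using fun _ _ => hM, fun σ hσ => ?_⟩
  have h1 : |σ| ^ (k + 1) ≤ |σ| ^ m := by
    rcases (abs_nonneg σ).eq_or_lt with h0 | h0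
    · rw [← h0, Real.zero_rpow hm0.ne']; simp
    · rw [← Real.rpow_natCast]
      exact Real.rpow_le_rpow_of_exponent_ge h0 hσ (by push_cast; linarith)
  simpa using (h σ hσ).trans (by gcongr)

theorem norm_polySum_le {p : ℕ → ℂ} (hp : ∀ j, j ≤ k → ‖p j‖ ≤ M) {σ : ℝ} (hσ : |σ| ≤ 1) :
    ‖∑ j ∈ Finset.range (k + 1), p j * (σ : ℂ) ^ j‖ ≤ (k + 1) * M := by
  refine (norm_sum_le _ _).trans ?_
  have : ∀ j ∈ Finset.range (k + 1), ‖p j * (σ : ℂ) ^ j‖ ≤ M := fun j hj => by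
    have hj' := hp j (Nat.lt_succ_iff.mp (Finset.mem_range.mp hj))
    rw [norm_mul, norm_pow, Complex.norm_real, Real.norm_eq_abs]
    exact (mul_le_of_le_one_right (norm_nonneg _) (pow_le_one₀ (abs_nonneg _) hσ)).trans hj'
  simpa using Finset.sum_le_card_nsmul _ _ _ this

theorem HasJet.norm_le (hm : 0 < m) (h : HasJet k m M g) {σ : ℝ} (hσ : |σ| ≤ 1) :
    ‖g σ‖ ≤ (k + 2) * M := by
  have hM := h.nonneg
  obtain ⟨p, hp, hr⟩ := h
  have h1 := hr σ hσ
  have h2 := norm_polySum_le hp hσ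
  have h3 : M * |σ| ^ m ≤ M :=
    mul_le_of_le_one_right hM (Real.rpow_le_one (abs_nonneg _) hσ hm.le)
  have := norm_sub_norm_le (g σ) (∑ j ∈ Finset.range (k + 1), p j * (σ : ℂ) ^ j)
  linarith

/-- Jets multiply, the terms of degree larger than `k` going into the remainder. -/
theorem HasJet.mul (hm0 : 0 < m) (hm : m ≤ k + 1) (h : HasJet k m M g) (h' : HasJet k m M' g') :
    HasJet k m (4 * (k + 2) ^ 2 * M * M') (fun σ => g σ * g' σ) := by
  have hM := h.nonneg
  have hM' := h'.nonneg
  have hgb := fun σ hσ => h.norm_le hm0 (σ := σ) hσ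
  obtain ⟨p, hp, hr⟩ := h
  obtain ⟨q, hq, hs⟩ := h'
  have hpq : ∀ x ∈ (Finset.range (k + 1) ×ˢ Finset.range (k + 1)), ‖p x.1 * q x.2‖ ≤ M * M' := by
    intro x hx
    simp only [Finset.mem_product, Finset.mem_range, Nat.lt_succ_iff] at hx
    rw [norm_mul]
    exact mul_le_mul (hp _ hx.1) (hq _ hx.2) (norm_nonneg _) hM
  have hcard : ∀ (s : Finset (ℕ × ℕ)), s ⊆ Finset.range (k + 1) ×ˢ Finset.range (k + 1) →
      (s.card : ℝ) ≤ (k + 1) ^ 2 := by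
    intro s hs
    have := Finset.card_le_card hs
    rw [Finset.card_product, Finset.card_range] at this
    have h2 : (s.card : ℝ) ≤ ((k + 1) * (k + 1) : ℕ) := by exact_mod_cast this
    push_cast at h2
    linarith
  have hMM : 0 ≤ M * M' := mul_nonneg hM hM'
  have hk : (0 : ℝ) ≤ k := Nat.cast_nonneg k
  refine ⟨fun j => ∑ x ∈ (Finset.range (k + 1) ×ˢ Finset.range (k + 1)).filter
    (fun x => x.1 + x.2 = j), p x.1 * q x.2, fun j hj => ?_, fun σ hσ => ?_⟩
  · refine (norm_sum_le _ _).trans ?_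
    have h1 := Finset.sum_le_card_nsmul
      ((Finset.range (k + 1) ×ˢ Finset.range (k + 1)).filter (fun x => x.1 + x.2 = j))
      (fun x => ‖p x.1 * q x.2‖) (M * M') (fun x hx => hpq x (Finset.filter_subset _ _ hx))
    rw [nsmul_eq_mul] at h1
    have h2 := mul_le_mul_of_nonneg_right (hcard _ (Finset.filter_subset (fun x => x.1 + x.2 = j)
      (Finset.range (k + 1) ×ˢ Finset.range (k + 1)))) hMM
    nlinarith
  · set U := Finset.range (k + 1) ×ˢ Finset.range (k + 1)
    have hσm : 0 ≤ |σ| ^ m := Real.rpow_nonneg (abs_nonneg σ) m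
    have hP := norm_polySum_le hp hσ
    set PP := ∑ j ∈ Finset.range (k + 1), p j * (σ : ℂ) ^ j with hPP
    set QQ := ∑ j ∈ Finset.range (k + 1), q j * (σ : ℂ) ^ j with hQQ
    -- the product of the two polynomials, split according to the degree
    have hprod : PP * QQ = (∑ x ∈ U.filter (fun x => x.1 + x.2 ≤ k),
        p x.1 * q x.2 * (σ : ℂ) ^ (x.1 + x.2)) +
        ∑ x ∈ U.filter (fun x => ¬ x.1 + x.2 ≤ k), p x.1 * q x.2 * (σ : ℂ) ^ (x.1 + x.2) := by
      rw [Finset.sum_filter_add_sum_filter_not, hPP, hQQ, Finset.sum_mul_sum,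
        ← Finset.sum_product']
      exact Finset.sum_congr rfl fun x _ => by ring
    have hlow : ∑ j ∈ Finset.range (k + 1), (∑ x ∈ U.filter
        (fun x => x.1 + x.2 = j), p x.1 * q x.2) * (σ : ℂ) ^ j =
        ∑ x ∈ U.filter (fun x => x.1 + x.2 ≤ k), p x.1 * q x.2 * (σ : ℂ) ^ (x.1 + x.2) := by
      rw [← Finset.sum_fiberwise_of_maps_to (s := U.filter (fun x => x.1 + x.2 ≤ k))
        (t := Finset.range (k + 1)) (g := fun x => x.1 + x.2)
        (fun x hx => Finset.mem_range.mpr (Nat.lt_succ_iff.mpr (Finset.mem_filter.mp hx).2))]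
      refine Finset.sum_congr rfl fun j hj => ?_
      rw [Finset.filter_filter, Finset.sum_mul]
      have hj' := Nat.lt_succ_iff.mp (Finset.mem_range.mp hj)
      refine Finset.sum_congr ?_ fun x hx => ?_
      · ext x; simp only [Finset.mem_filter]; constructor
        · rintro ⟨h1, h2⟩; exact ⟨h1, by omega, h2⟩
        · rintro ⟨h1, _, h2⟩; exact ⟨h1, h2⟩
      · rw [(Finset.mem_filter.mp hx).2.2]
    have hhigh : ‖∑ x ∈ U.filter (fun x => ¬ x.1 + x.2 ≤ k),
        p x.1 * q x.2 * (σ : ℂ) ^ (x.1 + x.2)‖ ≤ (k + 1) ^ 2 * (M * M') * |σ| ^ m := by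
      refine (norm_sum_le _ _).trans ?_
      have h1 := Finset.sum_le_card_nsmul (U.filter (fun x => ¬ x.1 + x.2 ≤ k))
        (fun x => ‖p x.1 * q x.2 * (σ : ℂ) ^ (x.1 + x.2)‖) (M * M' * |σ| ^ m) (fun x hx => ?_)
      · rw [nsmul_eq_mul] at h1
        refine h1.trans ?_
        rw [mul_assoc ((k + 1 : ℝ) ^ 2)]
        exact mul_le_mul_of_nonneg_right (hcard _ (Finset.filter_subset _ _))
          (mul_nonneg hMM hσm)
      · rw [norm_mul, norm_pow, Complex.norm_real, Real.norm_eq_abs]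
        refine mul_le_mul (hpq x (Finset.filter_subset _ _ hx)) ?_ (by positivity) hMM
        have hx2 : k + 1 ≤ x.1 + x.2 := by have := (Finset.mem_filter.mp hx).2; omega
        rcases (abs_nonneg σ).eq_or_lt with h0 | h0
        · rw [← h0, Real.zero_rpow hm0.ne', zero_pow (by omega)]
        · rw [← Real.rpow_natCast]
          refine Real.rpow_le_rpow_of_exponent_ge h0 hσ (hm.trans ?_)
          exact_mod_cast hx2
    have hkey : g σ * g' σ - ∑ j ∈ Finset.range (k + 1), (∑ x ∈ U.filter
        (fun x => x.1 + x.2 = j), p x.1 * q x.2) * (σ : ℂ) ^ j =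
        g σ * (g' σ - QQ) + (g σ - PP) * QQ + ∑ x ∈ U.filter (fun x => ¬ x.1 + x.2 ≤ k),
          p x.1 * q x.2 * (σ : ℂ) ^ (x.1 + x.2) := by
      rw [hlow]
      linear_combination hprod
    rw [hkey]
    have hQ := norm_polySum_le hq hσ
    have e1 : ‖g σ * (g' σ - QQ)‖ ≤ ((k + 2) * M) * (M' * |σ| ^ m) := by
      rw [norm_mul]
      exact mul_le_mul (hgb σ hσ) (hs σ hσ) (norm_nonneg _) (by positivity)
    have e2 : ‖(g σ - PP) * QQ‖ ≤ (M * |σ| ^ m) * ((k + 1) * M') := by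
      rw [norm_mul]
      exact mul_le_mul (hr σ hσ) hQ (norm_nonneg _) (by positivity)
    have e3 := norm_add₃_le (a := g σ * (g' σ - QQ)) (b := (g σ - PP) * QQ)
      (c := ∑ x ∈ U.filter (fun x => ¬ x.1 + x.2 ≤ k), p x.1 * q x.2 * (σ : ℂ) ^ (x.1 + x.2))
    have hz : 0 ≤ M * M' * |σ| ^ m := mul_nonneg hMM hσm
    have e4 : (k + 2 : ℝ) + (k + 1) + (k + 1) ^ 2 ≤ 4 * (k + 2) ^ 2 := by nlinarith
    have e5 := mul_le_mul_of_nonneg_right e4 hz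
    calc _ ≤ _ := e3
      _ ≤ ((k + 2) * M) * (M' * |σ| ^ m) + (M * |σ| ^ m) * ((k + 1) * M') +
          (k + 1) ^ 2 * (M * M') * |σ| ^ m := by linarith
      _ = ((k + 2 : ℝ) + (k + 1) + (k + 1) ^ 2) * (M * M' * |σ| ^ m) := by ring
      _ ≤ _ := e5
      _ = _ := by ring

theorem HasJet.pow (hm0 : 0 < m) (hm : m ≤ k + 1) (h : HasJet k m M g) (n : ℕ) :
    HasJet k m ((4 * (k + 2) ^ 2 * M) ^ n) (fun σ => g σ ^ n) := by
  have hM := h.nonneg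
  induction n with
  | zero => simpa using hasJet_const (k := k) (m := m) 1
  | succ n ih =>
    refine ((HasJet.mul hm0 hm ih h).congr (fun σ _ => pow_succ _ _)).mono (le_of_eq ?_)
    rw [pow_succ]; ring

theorem HasJet.sum {ι : Type*} (s : Finset ι) {G : ι → ℝ → ℂ} {B : ι → ℝ}
    (h : ∀ i ∈ s, HasJet k m (B i) (G i)) :
    HasJet k m (∑ i ∈ s, B i) (fun σ => ∑ i ∈ s, G i σ) := by
  classical
  induction s using Finset.induction_on with
  | empty => simpa using hasJet_const (k := k) (m := m) 0
  | insert a s ha ih =>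
    simp only [Finset.sum_insert ha]
    exact (h a (Finset.mem_insert_self a s)).add
      (ih fun i hi => h i (Finset.mem_insert_of_mem hi))

theorem HasJet.norm_le_of_zero (hm : 1 ≤ m) (h : HasJet k m M g) (h0 : g 0 = 0) {σ : ℝ}
    (hσ : |σ| ≤ 1) : ‖g σ‖ ≤ (k + 2) * M * |σ| := by
  have hM := h.nonneg
  obtain ⟨p, hp, hr⟩ := h
  have hp0 : p 0 = 0 := by
    have := hr 0 (by simp)
    rw [Finset.sum_range_succ'] at this
    simpa [h0, Real.zero_rpow (by linarith : m ≠ 0)] using this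
  have hm1 : |σ| ^ m ≤ |σ| := by
    rcases (abs_nonneg σ).eq_or_lt with h0 | h0
    · rw [← h0, Real.zero_rpow (by linarith : m ≠ 0)]
    · simpa using Real.rpow_le_rpow_of_exponent_ge h0 hσ hm
  have h2 : ‖∑ j ∈ Finset.range (k + 1), p j * (σ : ℂ) ^ j‖ ≤ (k + 1) * (M * |σ|) := by
    refine (norm_sum_le _ _).trans ?_
    have : ∀ j ∈ Finset.range (k + 1), ‖p j * (σ : ℂ) ^ j‖ ≤ M * |σ| := fun j hj => by
      have hj' := hp j (Nat.lt_succ_iff.mp (Finset.mem_range.mp hj))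
      rw [norm_mul, norm_pow, Complex.norm_real, Real.norm_eq_abs]
      rcases Nat.eq_zero_or_pos j with rfl | hj0
      · simp only [hp0, norm_zero, zero_mul]; positivity
      · exact mul_le_mul hj' (pow_le_of_le_one (abs_nonneg _) hσ hj0.ne') (by positivity) hM
    simpa using Finset.sum_le_card_nsmul _ _ _ this
  have h3 := norm_sub_norm_le (g σ) (∑ j ∈ Finset.range (k + 1), p j * (σ : ℂ) ^ j)
  have h4 := hr σ hσ
  have h5 : M * |σ| ^ m ≤ M * |σ| := by gcongr
  nlinarith

/-- The exponential of a jet vanishing at `0`: expand the exponential to degree `k`. -/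
theorem HasJet.exp (k : ℕ) :
    ∃ C : ℝ, 1 ≤ C ∧ ∀ (m M : ℝ) (g : ℝ → ℂ), 1 ≤ m → m ≤ k + 1 → HasJet k m M g → g 0 = 0 →
      HasJet k m (C * Real.exp (C * M)) (fun σ => Complex.exp (g σ)) := by
  refine ⟨4 * (k + 2) ^ 2 + 2 * (k + 2) + (1 + (k + 1).factorial), ?_,
    fun m M g hm1 hm h h0 => ?_⟩
  · have : (0 : ℝ) ≤ k := Nat.cast_nonneg k
    have : (0 : ℝ) ≤ (k + 1).factorial := Nat.cast_nonneg _
    nlinarith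
  have hM := h.nonneg
  have hm0 : 0 < m := by linarith
  have hk : (0 : ℝ) ≤ k := Nat.cast_nonneg k
  set a : ℝ := 4 * (k + 2) ^ 2 * M with ha
  have ha0 : 0 ≤ a := by positivity
  have hpoly : HasJet k m (∑ i ∈ Finset.range (k + 1), a ^ i / i.factorial)
      (fun σ => ∑ i ∈ Finset.range (k + 1), g σ ^ i / (i.factorial : ℂ)) := by
    refine HasJet.sum _ fun i _ => ?_
    obtain ⟨p, hp, hr⟩ := h.pow hm0 hm i
    have hf : (0 : ℝ) < i.factorial := by exact_mod_cast i.factorial_pos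
    refine ⟨fun j => p j / i.factorial, fun j hj => ?_, fun σ hσ => ?_⟩
    · rw [norm_div, Complex.norm_natCast]
      exact div_le_div_of_nonneg_right (hp j hj) hf.le
    · have : g σ ^ i / (i.factorial : ℂ) -
          ∑ j ∈ Finset.range (k + 1), p j / (i.factorial : ℂ) * (σ : ℂ) ^ j =
          (g σ ^ i - ∑ j ∈ Finset.range (k + 1), p j * (σ : ℂ) ^ j) / i.factorial := by
        rw [sub_div, Finset.sum_div]
        congr 1
        exact Finset.sum_congr rfl fun j _ => by ring
      rw [this, norm_div, Complex.norm_natCast, div_mul_eq_mul_div]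
      exact div_le_div_of_nonneg_right (hr σ hσ) hf.le
  have hrem : HasJet k m (((k + 2) * M) ^ (k + 1) * Real.exp ((k + 2) * M))
      (fun σ => Complex.exp (g σ) - ∑ i ∈ Finset.range (k + 1), g σ ^ i / (i.factorial : ℂ)) := by
    refine hasJet_of_norm_le hm (by positivity) (fun σ hσ => ?_) hm0
    have h1 := h.norm_le_of_zero hm1 h0 hσ
    have h2 : ‖g σ‖ ≤ (k + 2) * M :=
      h1.trans (mul_le_of_le_one_right (by positivity) hσ)
    refine (Complex.norm_exp_sub_sum_le_norm_mul_exp (g σ) (k + 1)).trans ?_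
    calc ‖g σ‖ ^ (k + 1) * Real.exp ‖g σ‖
        ≤ ((k + 2) * M * |σ|) ^ (k + 1) * Real.exp ((k + 2) * M) := by gcongr
      _ = _ := by rw [mul_pow]; ring
  refine ((hpoly.add hrem).congr (fun σ _ => by ring)).mono ?_
  have e1 : ∑ i ∈ Finset.range (k + 1), a ^ i / (i.factorial : ℝ) ≤ Real.exp a :=
    Real.sum_le_exp_of_nonneg ha0 _
  have e2 : ((k + 2) * M) ^ (k + 1) ≤ (k + 1).factorial * Real.exp ((k + 2) * M) := by
    have := Real.pow_div_factorial_le_exp ((k + 2) * M) (by positivity) (k + 1)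
    rwa [div_le_iff₀ (by positivity), mul_comm (Real.exp _)] at this
  have hf : (0 : ℝ) ≤ (k + 1).factorial := Nat.cast_nonneg _
  set C : ℝ := 4 * (k + 2) ^ 2 + 2 * (k + 2) + (1 + (k + 1).factorial) with hC
  have e3 : Real.exp a ≤ Real.exp (C * M) := by
    rw [ha]; gcongr; nlinarith
  have e4 : Real.exp ((k + 2) * M) * Real.exp ((k + 2) * M) ≤ Real.exp (C * M) := by
    rw [← Real.exp_add, ← add_mul]; gcongr; nlinarith
  calc (∑ i ∈ Finset.range (k + 1), a ^ i / (i.factorial : ℝ)) +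
        ((k + 2) * M) ^ (k + 1) * Real.exp ((k + 2) * M)
      ≤ Real.exp (C * M) + (k + 1).factorial * Real.exp (C * M) := by
        refine add_le_add (e1.trans e3) ?_
        refine (mul_le_mul_of_nonneg_right e2 (Real.exp_nonneg _)).trans ?_
        rw [mul_assoc]
        exact mul_le_mul_of_nonneg_left e4 hf
    _ = (1 + (k + 1).factorial) * Real.exp (C * M) := by ring
    _ ≤ C * Real.exp (C * M) := by
        refine mul_le_mul_of_nonneg_right ?_ (Real.exp_nonneg _)
        rw [hC]; nlinarith

/-- Rescaling the variable by `θ ∈ [0, 1]` does not increase a jet. -/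
theorem HasJet.comp_mul (hm0 : 0 < m) (h : HasJet k m M g) {θ : ℝ} (h0 : 0 ≤ θ) (h1 : θ ≤ 1) :
    HasJet k m M (fun σ => g (θ * σ)) := by
  have hM := h.nonneg
  obtain ⟨p, hp, hr⟩ := h
  have habs : ∀ σ : ℝ, |θ * σ| ≤ |σ| := fun σ => by
    rw [abs_mul, abs_of_nonneg h0]; exact mul_le_of_le_one_left (abs_nonneg _) h1
  refine ⟨fun j => p j * (θ : ℂ) ^ j, fun j hj => ?_, fun σ hσ => ?_⟩
  · rw [norm_mul, norm_pow, Complex.norm_real, Real.norm_eq_abs, abs_of_nonneg h0]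
    exact (mul_le_of_le_one_right (norm_nonneg _) (pow_le_one₀ h0 h1)).trans (hp j hj)
  · have := hr (θ * σ) ((habs σ).trans hσ)
    have e : ∑ j ∈ Finset.range (k + 1), p j * (θ : ℂ) ^ j * (σ : ℂ) ^ j =
        ∑ j ∈ Finset.range (k + 1), p j * ((θ * σ : ℝ) : ℂ) ^ j :=
      Finset.sum_congr rfl fun j _ => by push_cast; rw [mul_pow]; ring
    rw [e]
    exact this.trans (mul_le_mul_of_nonneg_left
      (Real.rpow_le_rpow (abs_nonneg _) (habs σ) hm0.le) hM)

/-- A finite difference of order `k + 1` annihilates the polynomial part of a jet of degree `k`. -/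
theorem HasJet.norm_finiteDiff_le (h : HasJet k m M g) (hm0 : 0 < m) {s : ℝ}
    (hs : (k + 1) * |s| ≤ 1) :
    ‖∑ i ∈ Finset.range (k + 2), ((-1 : ℂ) ^ (k + 1 - i) * (k + 1).choose i) * g (i * s)‖ ≤
      2 ^ (k + 1) * M * ((k + 1) * |s|) ^ m := by
  have hM := h.nonneg
  obtain ⟨p, hp, hr⟩ := h
  have hzero : ∑ i ∈ Finset.range (k + 2), ((-1 : ℂ) ^ (k + 1 - i) * (k + 1).choose i) *
      ∑ j ∈ Finset.range (k + 1), p j * ((i * s : ℝ) : ℂ) ^ j = 0 := by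
    have h1 := congrFun (fwdDiff_iter_sum_mul_pow_eq_zero (R := ℂ) (n := k + 1)
      (fun j => p j * (s : ℂ) ^ j)) 0
    rw [fwdDiff_iter_eq_sum_shift] at h1
    simp only [Pi.zero_apply] at h1
    rw [← h1]
    refine Finset.sum_congr rfl fun i _ => ?_
    rw [zsmul_eq_mul]
    push_cast
    congr 1
    refine Finset.sum_congr rfl fun j _ => ?_
    simp only [nsmul_eq_mul, mul_one, zero_add]
    rw [mul_pow]; ring
  have hbin : ∑ i ∈ Finset.range (k + 2), ((k + 1).choose i : ℝ) = 2 ^ (k + 1) := by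
    exact_mod_cast Nat.sum_range_choose (k + 1)
  rw [← sub_zero (∑ i ∈ Finset.range (k + 2), _ * g (i * s)), ← hzero, ← Finset.sum_sub_distrib]
  simp only [← mul_sub]
  refine (norm_sum_le _ _).trans ?_
  rw [← hbin, Finset.sum_mul, Finset.sum_mul]
  refine Finset.sum_le_sum fun i hi => ?_
  rw [norm_mul, norm_mul, norm_pow, norm_neg, norm_one, one_pow, one_mul, Complex.norm_natCast,
    mul_assoc]
  have hi' : (i : ℝ) ≤ k + 1 := by
    have : i ≤ k + 1 := by have := Finset.mem_range.mp hi; omega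
    exact_mod_cast this
  have habs : |(i : ℝ) * s| ≤ (k + 1) * |s| := by
    rw [abs_mul, Nat.abs_cast]; gcongr
  refine mul_le_mul_of_nonneg_left ((hr _ (habs.trans hs)).trans ?_) (Nat.cast_nonneg _)
  exact mul_le_mul_of_nonneg_left (Real.rpow_le_rpow (abs_nonneg _) habs hm0.le) hM

end

section

/-! ### Taylor expansions along a line -/

/-- Taylor's formula with a Hölder remainder, for a chain `g 0, g 1, …, g k` of successive
derivatives. -/
theorem norm_sub_taylor_le {ρ α K : ℝ} (hα : 0 ≤ α) (hK : 0 ≤ K) (k : ℕ) (g : ℕ → ℝ → ℂ)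
    (hd : ∀ j, j < k → ∀ s, |s| ≤ ρ → HasDerivAt (g j) (g (j + 1) s) s)
    (hh : ∀ s, |s| ≤ ρ → ‖g k s - g k 0‖ ≤ K * |s| ^ α) {s : ℝ} (hs : |s| ≤ ρ) :
    ‖g 0 s - ∑ j ∈ Finset.range (k + 1), g j 0 / (j.factorial : ℂ) * (s : ℂ) ^ j‖ ≤
      K * |s| ^ ((k : ℝ) + α) := by
  induction k generalizing g s with
  | zero => simpa using hh s hs
  | succ k ih =>
    set r : ℝ → ℂ := fun x => g 0 x -
      ∑ j ∈ Finset.range (k + 2), g j 0 / (j.factorial : ℂ) * (x : ℂ) ^ j with hr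
    set r' : ℝ → ℂ := fun x => g 1 x -
      ∑ j ∈ Finset.range (k + 1), g (j + 1) 0 / (j.factorial : ℂ) * (x : ℂ) ^ j with hr'
    have hr0 : r 0 = 0 := by
      simp only [hr]
      rw [Finset.sum_range_succ']
      simp
    have hderiv : ∀ x, |x| ≤ ρ → HasDerivAt r (r' x) x := by
      intro x hx
      refine (hd 0 (Nat.succ_pos k) x hx).sub ?_
      have hpow : ∀ j ∈ Finset.range (k + 2), HasDerivAt
          (fun y : ℝ => g j 0 / (j.factorial : ℂ) * (y : ℂ) ^ j)
          (g j 0 / (j.factorial : ℂ) * (j * (x : ℂ) ^ (j - 1))) x := fun j _ => by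
        have := ((hasDerivAt_pow j (x : ℂ)).comp_ofReal).const_mul (g j 0 / (j.factorial : ℂ))
        simpa using this
      have hsum := HasDerivAt.fun_sum hpow
      refine hsum.congr_deriv ?_
      rw [Finset.sum_range_succ']
      simp only [Nat.cast_zero, zero_mul, mul_zero, add_zero, Nat.add_sub_cancel]
      refine Finset.sum_congr rfl fun j _ => ?_
      have h1 : ((j + 1 : ℕ) : ℂ) ≠ 0 := by exact_mod_cast Nat.succ_ne_zero j
      have h2 : (j.factorial : ℂ) ≠ 0 := by exact_mod_cast j.factorial_ne_zero
      rw [Nat.factorial_succ, Nat.cast_mul]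
      field_simp
    have hbound : ∀ x, |x| ≤ ρ → ‖r' x‖ ≤ K * |x| ^ ((k : ℝ) + α) := fun x hx =>
      ih (fun j => g (j + 1)) (fun j hj y hy => hd (j + 1) (Nat.succ_lt_succ hj) y hy)
        hh hx
    have hconv := (convex_Icc (-|s|) |s|).norm_image_sub_le_of_norm_hasDerivWithin_le
      (f := r) (f' := r') (C := K * |s| ^ ((k : ℝ) + α)) (x := 0) (y := s)
      (fun x hx => (hderiv x ((abs_le.mpr hx).trans hs)).hasDerivWithinAt)
      (fun x hx => (hbound x ((abs_le.mpr hx).trans hs)).trans (mul_le_mul_of_nonneg_left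
        (Real.rpow_le_rpow (abs_nonneg _) (abs_le.mpr hx) (by positivity)) hK))
      (Set.mem_Icc.mpr ⟨neg_nonpos.mpr (abs_nonneg s), abs_nonneg s⟩)
      (Set.mem_Icc.mpr (abs_le.mp le_rfl))
    rw [hr0, sub_zero, sub_zero, Real.norm_eq_abs] at hconv
    refine hconv.trans (le_of_eq ?_)
    rw [mul_assoc, ← Real.rpow_add_one' (abs_nonneg s) (by positivity)]
    push_cast
    ring_nf

section Line

variable {V : Type*} [NormedAddCommGroup V] [NormedSpace ℝ V]

/-- The `j`-th Taylor coefficient of `f` at `t` in the direction `e`. -/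
def lineCoeff (f : V → ℂ) (t e : V) (j : ℕ) : ℂ :=
  iteratedFDeriv ℝ j f t (fun _ => e) / (j.factorial : ℂ)

theorem lineCoeff_zero (f : V → ℂ) (t e : V) : lineCoeff f t e 0 = f t := by
  simp [lineCoeff]

theorem lineCoeff_one (f : V → ℂ) (t e : V) : lineCoeff f t e 1 = fderiv ℝ f t e := by
  simp [lineCoeff]

theorem norm_lineCoeff_le {f : V → ℂ} {t e : V} {j : ℕ} {K : ℝ} (he : ‖e‖ ≤ 1)
    (hK : ‖iteratedFDeriv ℝ j f t‖ ≤ K) : ‖lineCoeff f t e j‖ ≤ K := by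
  rw [lineCoeff, norm_div, Complex.norm_natCast]
  refine (div_le_self (norm_nonneg _) (by exact_mod_cast j.factorial_pos)).trans ?_
  refine ((iteratedFDeriv ℝ j f t).le_opNorm _).trans ?_
  refine (mul_le_of_le_one_right (norm_nonneg _) ?_).trans hK
  exact Finset.prod_le_one (fun _ _ => norm_nonneg _) (fun _ _ => he)

theorem hasDerivAt_iteratedFDeriv_line {k j : ℕ} {f : V → ℂ} {O : Set V} (hO : IsOpen O)
    (hf : ContDiffOn ℝ k f O) (hj : j < k) (t e : V) {s : ℝ} (hs : t + s • e ∈ O) :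
    HasDerivAt (fun x : ℝ => iteratedFDeriv ℝ j f (t + x • e) (fun _ => e))
      (iteratedFDeriv ℝ (j + 1) f (t + s • e) (fun _ => e)) s := by
  have h1 := ((hf.contDiffAt (hO.mem_nhds hs)).differentiableAt_iteratedFDeriv
    (m := j) (by exact_mod_cast hj)).hasFDerivAt
  have h2 : HasDerivAt (fun x : ℝ => t + x • e) e s := by
    simpa using ((hasDerivAt_id s).smul_const e).const_add t
  have h3 := h1.comp_hasDerivAt s h2
  have h4 := ((ContinuousMultilinearMap.apply ℝ (fun _ : Fin j => V) ℂ
    (fun _ => e)).hasFDerivAt).comp_hasDerivAt s h3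
  exact h4

theorem norm_sub_lineCoeff_le {k : ℕ} {f : V → ℂ} {O : Set V} (hO : IsOpen O)
    (hf : ContDiffOn ℝ k f O) {α K ρ : ℝ} (hα : 0 ≤ α) (hK : 0 ≤ K) {t e : V}
    (hline : ∀ s : ℝ, |s| ≤ ρ → t + s • e ∈ O)
    (hh : ∀ s : ℝ, |s| ≤ ρ → ‖iteratedFDeriv ℝ k f (t + s • e) (fun _ => e) -
      iteratedFDeriv ℝ k f t (fun _ => e)‖ ≤ K * |s| ^ α) {s : ℝ} (hs : |s| ≤ ρ) :
    ‖f (t + s • e) - ∑ j ∈ Finset.range (k + 1), lineCoeff f t e j * (s : ℂ) ^ j‖ ≤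
      K * |s| ^ ((k : ℝ) + α) := by
  have := norm_sub_taylor_le hα hK k
    (fun j x => iteratedFDeriv ℝ j f (t + x • e) (fun _ => e))
    (fun j hj x hx => hasDerivAt_iteratedFDeriv_line hO hf hj t e (hline x hx))
    (by simpa using hh) hs
  simpa [lineCoeff] using this

end Line

variable {d : ℕ}

theorem norm_iteratedFDeriv_apply_sub_le {f : Rd d → ℂ} {k : ℕ} {x y e : Rd d} {B : ℝ}
    (he : ‖e‖ ≤ 1) (h : ‖iteratedFDeriv ℝ k f x - iteratedFDeriv ℝ k f y‖ ≤ B) :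
    ‖iteratedFDeriv ℝ k f x (fun _ => e) - iteratedFDeriv ℝ k f y (fun _ => e)‖ ≤ B := by
  rw [← sub_apply]
  refine (ContinuousMultilinearMap.le_opNorm _ _).trans ?_
  exact (mul_le_of_le_one_right (norm_nonneg _)
    (Finset.prod_le_one (fun _ _ => norm_nonneg _) (fun _ _ => he))).trans h

/-- A function of class `C_b^m` has Taylor expansions of order `m` along unit segments, uniformly
in the base point. -/
theorem IsCbm.exists_taylor {m : ℝ} (hm : 0 ≤ m) {O : Set (Rd d)} (hO : IsOpen O) {f : Rd d → ℂ}
    (hf : IsCbm m O f) :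
    ∃ K : ℝ, 0 ≤ K ∧ ∀ t e : Rd d, ‖e‖ = 1 → ∀ ρ : ℝ, 0 ≤ ρ →
      (∀ s : ℝ, |s| ≤ ρ → t + s • e ∈ O) →
      (∀ j, j ≤ ⌊m⌋₊ → ‖lineCoeff f t e j‖ ≤ K) ∧ ∀ s : ℝ, |s| ≤ ρ →
        ‖f (t + s • e) - ∑ j ∈ Finset.range (⌊m⌋₊ + 1), lineCoeff f t e j * (s : ℂ) ^ j‖ ≤
          K * |s| ^ m := by
  choose B hB using fun j : Fin (⌊m⌋₊ + 1) => hf.bounded j (Nat.lt_succ_iff.mp j.2)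
  obtain ⟨H, hH⟩ := hf.hoelder
  set K : ℝ := |H| + ∑ j, |B j| with hK
  have hK0 : 0 ≤ K := by positivity
  have hBK : ∀ j, B j ≤ K := fun j => by
    have := Finset.single_le_sum (f := fun j => |B j|) (fun i _ => abs_nonneg _)
      (Finset.mem_univ j)
    have h1 := le_abs_self (B j)
    have h2 := abs_nonneg H

    linarith
  have hHK : H ≤ K := (le_abs_self H).trans (le_add_of_nonneg_right (by positivity))
  have hα : 0 ≤ m - (⌊m⌋₊ : ℝ) := sub_nonneg.mpr (Nat.floor_le hm)
  refine ⟨K, hK0, fun t e he ρ hρ hline => ⟨fun j hj => ?_, fun s hs => ?_⟩⟩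
  · have ht : t ∈ O := by simpa using hline 0 (by simpa using hρ)
    exact norm_lineCoeff_le he.le
      ((hB ⟨j, Nat.lt_succ_iff.mpr hj⟩ t ht).trans (hBK _))
  · have := norm_sub_lineCoeff_le hO hf.contDiffOn hα hK0 (t := t) (e := e) hline
      (fun s hs => ?_) hs
    · rwa [add_sub_cancel] at this
    · have ht : t ∈ O := by simpa using hline 0 (by simpa using hρ)
      refine norm_iteratedFDeriv_apply_sub_le he.le ((hH _ (hline s hs) t ht).trans ?_)
      rw [add_sub_cancel_left, norm_smul, he, mul_one, Real.norm_eq_abs]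
      gcongr

theorem HasJet.of_line {k : ℕ} {m K ρ : ℝ} {f : Rd d → ℂ} {t e : Rd d} {p : ℕ → ℂ}
    (hm : 0 < m) (hK : 0 ≤ K) (hρ : 0 ≤ ρ) (hρ1 : ρ ≤ 1) (hp : ∀ j, j ≤ k → ‖p j‖ ≤ K)
    (hr : ∀ s : ℝ, |s| ≤ ρ →
      ‖f (t + s • e) - ∑ j ∈ Finset.range (k + 1), p j * (s : ℂ) ^ j‖ ≤ K * |s| ^ m) :
    HasJet k m K (fun σ => f (t + (ρ * σ) • e)) := by
  refine ⟨fun j => p j * (ρ : ℂ) ^ j, fun j hj => ?_, fun σ hσ => ?_⟩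
  · rw [norm_mul, norm_pow, Complex.norm_real, Real.norm_eq_abs, abs_of_nonneg hρ]
    exact (mul_le_of_le_one_right (norm_nonneg _) (pow_le_one₀ hρ hρ1)).trans (hp j hj)
  · have habs : |ρ * σ| ≤ |σ| := by
      rw [abs_mul, abs_of_nonneg hρ]; exact mul_le_of_le_one_left (abs_nonneg _) hρ1
    have habs' : |ρ * σ| ≤ ρ := by
      rw [abs_mul, abs_of_nonneg hρ]; exact mul_le_of_le_one_right hρ hσ
    have e : ∑ j ∈ Finset.range (k + 1), p j * (ρ : ℂ) ^ j * (σ : ℂ) ^ j =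
        ∑ j ∈ Finset.range (k + 1), p j * ((ρ * σ : ℝ) : ℂ) ^ j :=
      Finset.sum_congr rfl fun j _ => by push_cast; rw [mul_pow]; ring
    rw [e]
    exact (hr _ habs').trans (mul_le_mul_of_nonneg_left
      (Real.rpow_le_rpow (abs_nonneg _) habs hm.le) hK)

theorem IsCbm.exists_hasJet {m : ℝ} (hm : 0 < m) {O : Set (Rd d)} (hO : IsOpen O) {f : Rd d → ℂ}
    (hf : IsCbm m O f) :
    ∃ K : ℝ, ∀ t e : Rd d, ‖e‖ = 1 → ∀ ρ : ℝ, 0 ≤ ρ → ρ ≤ 1 →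
      (∀ s : ℝ, |s| ≤ ρ → t + s • e ∈ O) →
      HasJet ⌊m⌋₊ m K (fun σ => f (t + (ρ * σ) • e)) := by
  obtain ⟨K, hK, h⟩ := hf.exists_taylor hm.le hO
  refine ⟨K, fun t e he ρ hρ hρ1 hline => ?_⟩
  obtain ⟨h1, h2⟩ := h t e he ρ hρ hline
  exact HasJet.of_line hm hK hρ hρ1 h1 h2

theorem exists_hasJet_of_hasCompactSupport {m : ℝ} (hm : 0 < m) {f : Rd d → ℂ}
    (hf : ContDiff ℝ (⊤ : ℕ∞) f) (hc : HasCompactSupport f) :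
    ∃ K : ℝ, ∀ t e : Rd d, ‖e‖ = 1 → ∀ ρ : ℝ, 0 ≤ ρ → ρ ≤ 1 →
      HasJet ⌊m⌋₊ m K (fun σ => f (t + (ρ * σ) • e)) := by
  set k := ⌊m⌋₊ with hk
  choose B hB using fun j : ℕ => (hc.iteratedFDeriv (𝕜 := ℝ) j).exists_bound_of_continuous
    (hf.continuous_iteratedFDeriv (m := j) (by exact_mod_cast le_top))
  obtain ⟨H, hH⟩ := ContDiff.lipschitzWith_of_hasCompactSupport (𝕂 := ℝ) (n := 1)
    (hc.iteratedFDeriv (𝕜 := ℝ) k)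
    (hf.iteratedFDeriv_right (m := 1) (i := k) (by exact_mod_cast le_top)) one_ne_zero
  set K : ℝ := H + ∑ j ∈ Finset.range (k + 1), |B j| with hK
  have hK0 : 0 ≤ K := by positivity
  have hBK : ∀ j, j ≤ k → B j ≤ K := fun j hj => by
    have := Finset.single_le_sum (f := fun j => |B j|) (fun i _ => abs_nonneg _)
      (Finset.mem_range.mpr (Nat.lt_succ_iff.mpr hj))
    have h1 := le_abs_self (B j)
    have h2 : (0 : ℝ) ≤ H := H.2

    linarith
  have hHK : (H : ℝ) ≤ K := le_add_of_nonneg_right (by positivity)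
  have hα : 0 ≤ m - (k : ℝ) := sub_nonneg.mpr (Nat.floor_le hm.le)
  have hα1 : m - (k : ℝ) ≤ 1 := by have := Nat.lt_floor_add_one m; linarith
  refine ⟨K, fun t e he ρ hρ hρ1 => HasJet.of_line (p := lineCoeff f t e) hm hK0 hρ hρ1
    (fun j hj => norm_lineCoeff_le he.le ((hB j t).trans (hBK j hj))) (fun s hs => ?_)⟩
  have := norm_sub_lineCoeff_le (k := k) (f := f) isOpen_univ
    (hf.of_le (by exact_mod_cast le_top)).contDiffOn hα hK0
    (t := t) (e := e) (fun _ _ => Set.mem_univ _) (fun s hs => ?_) hs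
  · rwa [add_sub_cancel] at this
  · refine norm_iteratedFDeriv_apply_sub_le he.le ?_
    have h1 := hH.dist_le_mul (t + s • e) t
    rw [dist_eq_norm, dist_eq_norm, add_sub_cancel_left, norm_smul, he, mul_one,
      Real.norm_eq_abs] at h1
    refine h1.trans (mul_le_mul hHK ?_ (abs_nonneg _) hK0)
    rcases (abs_nonneg s).eq_or_lt with h0 | h0
    · rw [← h0]; exact Real.rpow_nonneg le_rfl _
    · simpa using Real.rpow_le_rpow_of_exponent_ge h0 (hs.trans hρ1) hα1

end

section

/-! ### Oscillatory integrals and finite differences -/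

/-- The Fourier integral `∫ G(t) exp(-i⟨t, w⟩) dt`. -/
def fourierInt {d : ℕ} (G : Rd d → ℂ) (w : Rd d) : ℂ :=
  ∫ t, G t * Complex.exp (-Complex.I * ((⟪t, w⟫ : ℝ) : ℂ))

variable {d : ℕ}

theorem norm_cexp_neg_I_mul (x : ℝ) : ‖Complex.exp (-Complex.I * (x : ℂ))‖ = 1 := by
  rw [Complex.norm_exp]; simp

theorem continuous_cexp_inner (w : Rd d) :
    Continuous fun t : Rd d => Complex.exp (-Complex.I * ((⟪t, w⟫ : ℝ) : ℂ)) := by fun_prop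

theorem norm_fourierInt_le (G : Rd d → ℂ) (w : Rd d) : ‖fourierInt G w‖ ≤ ∫ t, ‖G t‖ := by
  refine (norm_integral_le_integral_norm _).trans (le_of_eq ?_)
  simp only [norm_mul, norm_cexp_neg_I_mul, mul_one]

theorem integrable_mul_cexp {G : Rd d → ℂ} (hG : Integrable G) (w : Rd d) :
    Integrable fun t => G t * Complex.exp (-Complex.I * ((⟪t, w⟫ : ℝ) : ℂ)) :=
  hG.mul_bdd (c := 1) (continuous_cexp_inner w).aestronglyMeasurable
    (Eventually.of_forall fun _ => (norm_cexp_neg_I_mul _).le)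

theorem fourierInt_translate (G : Rd d → ℂ) (v w : Rd d) :
    fourierInt (fun t => G (t + v)) w =
      Complex.exp (Complex.I * ((⟪v, w⟫ : ℝ) : ℂ)) * fourierInt G w := by
  rw [fourierInt, fourierInt, ← integral_const_mul,
    ← integral_add_right_eq_self (fun t => Complex.exp (Complex.I * ((⟪v, w⟫ : ℝ) : ℂ)) *
      (G t * Complex.exp (-Complex.I * ((⟪t, w⟫ : ℝ) : ℂ)))) v]
  congr 1
  ext t
  rw [inner_add_left, mul_left_comm, ← Complex.exp_add]
  congr 2
  push_cast
  ring

/-- A step of half a period turns every difference into a multiplication by `-2`. -/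
theorem norm_fourierInt_le_finiteDiff {G : Rd d → ℂ} (hG : Integrable G) (n : ℕ) {e w : Rd d}
    (hw : ⟪w, e⟫ ≠ 0) :
    ‖fourierInt G w‖ ≤ ∫ t, ‖∑ i ∈ Finset.range (n + 1), ((-1 : ℂ) ^ (n - i) * n.choose i) *
      G (t + (i * (Real.pi / ⟪w, e⟫)) • e)‖ := by
  set s := Real.pi / ⟪w, e⟫ with hs
  have hI : ∀ i : ℕ, Integrable fun t => G (t + (i * s) • e) := fun i => hG.comp_add_right _
  have h1 : fourierInt (fun t => ∑ i ∈ Finset.range (n + 1),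
      ((-1 : ℂ) ^ (n - i) * n.choose i) * G (t + (i * s) • e)) w = (-2) ^ n * fourierInt G w := by
    have h2 : ∀ i : ℕ, fourierInt (fun t => G (t + (i * s) • e)) w =
        (-1) ^ i * fourierInt G w := fun i => by
      rw [fourierInt_translate]
      congr 1
      rw [inner_smul_left, real_inner_comm]
      have : Complex.I * (((starRingEnd ℝ) (i * s) * ⟪w, e⟫ : ℝ) : ℂ) =
          i * (Real.pi * Complex.I) := by
        have : (starRingEnd ℝ) (i * s) * ⟪w, e⟫ = i * Real.pi := by
          simp only [conj_trivial, hs]; field_simp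
        rw [this]; push_cast; ring
      rw [this, Complex.exp_nat_mul, Complex.exp_pi_mul_I]
    calc _ = ∑ i ∈ Finset.range (n + 1), ((-1 : ℂ) ^ (n - i) * n.choose i) *
          fourierInt (fun t => G (t + (i * s) • e)) w := by
          simp only [fourierInt, Finset.sum_mul, mul_assoc]
          rw [integral_finsetSum]
          · simp only [integral_const_mul]
          · intro i _
            exact ((integrable_mul_cexp (hI i) w).const_mul _).const_mul _
      _ = (∑ i ∈ Finset.range (n + 1), (-1 : ℂ) ^ i * (-1) ^ (n - i) * n.choose i) *
          fourierInt G w := by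
          rw [Finset.sum_mul]
          exact Finset.sum_congr rfl fun i _ => by rw [h2]; ring
      _ = _ := by rw [← add_pow]; norm_num
  have h3 := norm_fourierInt_le (fun t => ∑ i ∈ Finset.range (n + 1),
      ((-1 : ℂ) ^ (n - i) * n.choose i) * G (t + (i * s) • e)) w
  rw [h1, norm_mul, norm_pow, norm_neg, RCLike.norm_ofNat] at h3
  refine le_trans ?_ h3
  exact le_mul_of_one_le_left (norm_nonneg _) (one_le_pow₀ (by norm_num))

/-! ### Uniform decay for a family of damped oscillatory integrals -/

/-- Amplitudes: continuous functions supported in the ball of radius `r`, with uniform jets of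
order `m` in the direction `e`. -/
structure IsAmplitude (k : ℕ) (m r ρ K : ℝ) (e : Rd d) (ψ : Rd d → ℂ) : Prop where
  continuous : Continuous ψ
  eq_zero : ∀ t, r ≤ ‖t‖ → ψ t = 0
  hasJet : ∀ t, ‖t‖ < 2 * r → HasJet k m K (fun σ => ψ (t + (ρ * σ) • e))

/-- Phases: functions whose real part dominates `c ‖t‖ ^ 2` on a ball, with uniform Taylor
expansions of order `m` in the direction `e` whose linear coefficient is `O(‖t‖)`. -/
structure IsPhase (k : ℕ) (m r ρ c K : ℝ) (e : Rd d) (F : Rd d → ℂ) : Prop where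
  continuousOn : ContinuousOn F (ball 0 (2 * r))
  re_ge : ∀ t, ‖t‖ < 2 * r → c * ‖t‖ ^ 2 ≤ (F t).re
  taylor : ∀ t, ‖t‖ < 2 * r → ∃ p : ℕ → ℂ, p 0 = F t ∧ ‖p 1‖ ≤ K * ‖t‖ ∧
    (∀ j, j ≤ k → ‖p j‖ ≤ K) ∧ ∀ s : ℝ, |s| ≤ ρ →
      ‖F (t + s • e) - ∑ j ∈ Finset.range (k + 1), p j * (s : ℂ) ^ j‖ ≤ K * |s| ^ m

/-- The damped amplitude `ψ exp(-u F)`. -/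
def damped (ψ F : Rd d → ℂ) (u : ℝ) (t : Rd d) : ℂ := ψ t * Complex.exp (-(u : ℂ) * F t)

variable {k : ℕ} {m r ρ c K : ℝ} {e : Rd d} {ψ F : Rd d → ℂ}

theorem IsPhase.mono {K' : ℝ}
    (hF : IsPhase k m r ρ c K e F) (h : K ≤ K') : IsPhase k m r ρ c K' e F where
  continuousOn := hF.continuousOn
  re_ge := hF.re_ge
  taylor t ht := by
    obtain ⟨p, h1, h2, h3, h4⟩ := hF.taylor t ht
    exact ⟨p, h1, h2.trans (by gcongr), fun j hj => (h3 j hj).trans h,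
      fun s hs => (h4 s hs).trans (by gcongr)⟩

theorem damped_eq_zero (hψ : IsAmplitude k m r ρ K e ψ) (u : ℝ) {t : Rd d} (ht : r ≤ ‖t‖) :
    damped ψ F u t = 0 := by
  rw [damped, hψ.eq_zero t ht, zero_mul]

theorem continuous_damped_uncurry (hr : 0 < r) (hψ : IsAmplitude k m r ρ K e ψ)
    (hF : IsPhase k m r ρ c K e F) : Continuous fun p : ℝ × Rd d => damped ψ F p.1 p.2 := by
  rw [continuous_iff_continuousAt]
  rintro ⟨u, t⟩
  by_cases ht : ‖t‖ < 2 * r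
  · have hFt : ContinuousAt F t :=
      hF.continuousOn.continuousAt (isOpen_ball.mem_nhds (by simpa using ht))
    have hF2 : ContinuousAt (fun p : ℝ × Rd d => F p.2) (u, t) :=
      ContinuousAt.comp (f := Prod.snd) (x := (u, t)) hFt continuousAt_snd
    have hu : ContinuousAt (fun p : ℝ × Rd d => -(p.1 : ℂ)) (u, t) := by fun_prop
    exact (hψ.continuous.comp continuous_snd).continuousAt.mul
      (Complex.continuous_exp.continuousAt.comp (hu.mul hF2))
  · have hev : (fun p : ℝ × Rd d => damped ψ F p.1 p.2) =ᶠ[𝓝 (u, t)] fun _ => 0 := by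
      have : {x : ℝ × Rd d | r < ‖x.2‖} ∈ 𝓝 (u, t) :=
        (isOpen_lt continuous_const (by fun_prop)).mem_nhds (by
          simp only [Set.mem_ofPred_eq]; linarith [not_lt.mp ht])
      filter_upwards [this] with x hx
      exact damped_eq_zero hψ x.1 hx.le
    exact continuousAt_const.congr hev.symm

theorem continuous_damped (hr : 0 < r) (hψ : IsAmplitude k m r ρ K e ψ)
    (hF : IsPhase k m r ρ c K e F) (u : ℝ) : Continuous (damped ψ F u) :=
  (continuous_damped_uncurry hr hψ hF).comp (Continuous.prodMk_right u)

theorem integrable_damped (hr : 0 < r) (hψ : IsAmplitude k m r ρ K e ψ)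
    (hF : IsPhase k m r ρ c K e F) (u : ℝ) : Integrable (damped ψ F u) :=
  (continuous_damped hr hψ hF u).integrable_of_hasCompactSupport
    (HasCompactSupport.of_support_subset_isCompact (isCompact_closedBall (0 : Rd d) r)
      (fun t ht => by
      by_contra h
      exact ht (damped_eq_zero hψ u (by
        rw [mem_closedBall, dist_zero_right, not_le] at h; exact h.le))))

theorem hasJet_phase (hm : 2 ≤ m) (hρ : 0 < ρ) (hρ1 : ρ ≤ 1) (hK : 0 ≤ K)
    (hF : IsPhase k m r ρ c K e F) {u : ℝ} (hu : 0 ≤ u) {t : Rd d} (ht : ‖t‖ < 2 * r) :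
    HasJet k m (K * (1 + √(1 + u) * ‖t‖))
      (fun σ => -(u : ℂ) * (F (t + (ρ * ((√(1 + u))⁻¹ * σ)) • e) - F t)) := by
  obtain ⟨p, hp0, hp1, hpK, hr⟩ := hF.taylor t ht
  set v : ℝ := √(1 + u) with hv
  have hv1 : 1 ≤ v := by rw [hv, Real.one_le_sqrt]; linarith
  have hv0 : 0 < v := by linarith
  have hv2 : v ^ 2 = 1 + u := Real.sq_sqrt (by linarith)
  have hθ : v⁻¹ ≤ 1 := inv_le_one_of_one_le₀ hv1
  have hθ0 : 0 < v⁻¹ := inv_pos.mpr hv0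
  have hu2 : u * (v⁻¹) ^ 2 ≤ 1 := by
    rw [inv_pow, hv2, ← div_eq_mul_inv, div_le_one (by linarith)]; linarith
  have hbig : K ≤ K * (1 + v * ‖t‖) :=
    le_mul_of_one_le_right hK (by nlinarith [norm_nonneg t])
  -- the scaled coefficients, the constant one being removed
  refine ⟨fun j => if j = 0 then 0 else -(u : ℂ) * (p j * ((ρ * v⁻¹ : ℝ) : ℂ) ^ j),
    fun j hj => ?_, fun σ hσ => ?_⟩
  · rcases Nat.eq_zero_or_pos j with rfl | hj0
    · simp only [if_true, norm_zero]; positivity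
    · simp only [hj0.ne', if_false]
      rw [norm_mul, norm_mul, norm_pow, norm_neg, Complex.norm_real, Complex.norm_real,
        Real.norm_eq_abs, Real.norm_eq_abs, abs_of_nonneg hu, abs_of_nonneg (by positivity)]
      have hρθ : ρ * v⁻¹ ≤ v⁻¹ := mul_le_of_le_one_left hθ0.le hρ1
      rcases Nat.lt_or_ge j 2 with hj2 | hj2
      · obtain rfl : j = 1 := by omega
        have e1 : u * v⁻¹ ≤ v := by
          rw [← div_eq_mul_inv, div_le_iff₀ hv0, ← sq, hv2]; linarith
        calc u * (‖p 1‖ * (ρ * v⁻¹) ^ 1) ≤ u * ((K * ‖t‖) * v⁻¹) := by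
              rw [pow_one]; gcongr
          _ = (u * v⁻¹) * (K * ‖t‖) := by ring
          _ ≤ v * (K * ‖t‖) := by gcongr
          _ ≤ _ := by nlinarith
      · calc u * (‖p j‖ * (ρ * v⁻¹) ^ j) ≤ u * (K * (v⁻¹) ^ 2) := by
              refine mul_le_mul_of_nonneg_left (mul_le_mul (hpK j hj) ?_ (by positivity) hK) hu
              exact (pow_le_pow_left₀ (by positivity) hρθ j).trans
                (pow_le_pow_of_le_one hθ0.le hθ hj2)
          _ = K * (u * (v⁻¹) ^ 2) := by ring
          _ ≤ K * 1 := by gcongr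
          _ ≤ _ := by linarith
  · have habs : |ρ * (v⁻¹ * σ)| ≤ v⁻¹ * |σ| := by
      rw [abs_mul, abs_of_pos hρ, abs_mul, abs_of_pos hθ0]
      exact mul_le_of_le_one_left (by positivity) hρ1
    have habs' : |ρ * (v⁻¹ * σ)| ≤ ρ := by
      rw [abs_mul, abs_of_pos hρ, abs_mul, abs_of_pos hθ0]
      exact mul_le_of_le_one_right hρ.le (mul_le_one₀ hθ (abs_nonneg _) hσ)
    have h1 := hr _ habs'
    have hsum : -(u : ℂ) * (F (t + (ρ * (v⁻¹ * σ)) • e) - F t) -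
        ∑ j ∈ Finset.range (k + 1), (if j = 0 then 0 else
          -(u : ℂ) * (p j * ((ρ * v⁻¹ : ℝ) : ℂ) ^ j)) * (σ : ℂ) ^ j =
        -(u : ℂ) * (F (t + (ρ * (v⁻¹ * σ)) • e) -
          ∑ j ∈ Finset.range (k + 1), p j * ((ρ * (v⁻¹ * σ) : ℝ) : ℂ) ^ j) := by
      rw [Finset.sum_range_succ', Finset.sum_range_succ' (fun j => p j * _)]
      simp only [Nat.add_eq_zero_iff, one_ne_zero, and_false, if_false, if_true, add_zero,
        pow_zero, mul_one, hp0]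
      have : ∑ j ∈ Finset.range k, -(u : ℂ) * (p (j + 1) * ((ρ * v⁻¹ : ℝ) : ℂ) ^ (j + 1)) *
          (σ : ℂ) ^ (j + 1) = -(u : ℂ) * ∑ j ∈ Finset.range k,
            p (j + 1) * ((ρ * (v⁻¹ * σ) : ℝ) : ℂ) ^ (j + 1) := by
        rw [Finset.mul_sum]
        refine Finset.sum_congr rfl fun j _ => ?_
        push_cast
        simp only [mul_pow]
        ring
      rw [this]; ring
    rw [hsum, norm_mul, norm_neg, Complex.norm_real, Real.norm_eq_abs, abs_of_nonneg hu]
    have hpow : u * (v⁻¹) ^ m ≤ 1 := by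
      refine le_trans (mul_le_mul_of_nonneg_left ?_ hu) hu2
      rw [← Real.rpow_two]
      exact Real.rpow_le_rpow_of_exponent_ge hθ0 hθ hm
    have hm0 : 0 ≤ m := by linarith
    have hσm : 0 ≤ |σ| ^ m := Real.rpow_nonneg (abs_nonneg _) _
    calc _ ≤ u * (K * (v⁻¹ * |σ|) ^ m) := by
          refine mul_le_mul_of_nonneg_left (h1.trans ?_) hu
          exact mul_le_mul_of_nonneg_left (Real.rpow_le_rpow (abs_nonneg _) habs hm0) hK
      _ = K * (u * (v⁻¹) ^ m) * |σ| ^ m := by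
          rw [Real.mul_rpow hθ0.le (abs_nonneg _)]; ring
      _ ≤ K * 1 * |σ| ^ m := by gcongr
      _ ≤ _ := by rw [mul_one]; gcongr

/-- At the parabolic scale `(1 + u) ^ (-1/2)` the functions `ψ exp(-u F)` have jets with Gaussian
bounds, uniformly in `u`. -/
theorem exists_hasJet_damped (hm : 2 ≤ m) (hmk : m ≤ k + 1) (hρ : 0 < ρ) (hρ1 : ρ ≤ 1)
    (hc : 0 < c) (hK : 0 ≤ K) (hψ : IsAmplitude k m r ρ K e ψ) (hF : IsPhase k m r ρ c K e F) :
    ∃ C : ℝ, 0 ≤ C ∧ ∀ u : ℝ, 0 ≤ u → ∀ t : Rd d, ‖t‖ < 2 * r →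
      HasJet k m (C * Real.exp (-(c / 2 * (1 + u)) * ‖t‖ ^ 2))
        (fun σ => damped ψ F u (t + (ρ * ((√(1 + u))⁻¹ * σ)) • e)) := by
  obtain ⟨C₁, hC₁, hexp⟩ := HasJet.exp k
  have hm0 : 0 < m := by linarith
  set B : ℝ := 4 * ((k : ℝ) + 2) ^ 2 with hB
  have hB0 : 0 ≤ B := by positivity
  refine ⟨B * (B * K * C₁) * Real.exp (C₁ * K + (C₁ * K) ^ 2 / (2 * c) + 4 * c * r ^ 2),
    by positivity, fun u hu t ht => ?_⟩
  set v : ℝ := √(1 + u) with hv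
  have hv1 : 1 ≤ v := by rw [hv, Real.one_le_sqrt]; linarith
  have hv0 : 0 < v := by linarith
  have hv2 : v ^ 2 = 1 + u := Real.sq_sqrt (by linarith)
  have j1 : HasJet k m K (fun σ => ψ (t + (ρ * (v⁻¹ * σ)) • e)) :=
    (hψ.hasJet t ht).comp_mul hm0 (inv_pos.mpr hv0).le (inv_le_one_of_one_le₀ hv1)
  have j2 := hexp m _ _ (by linarith) hmk (hasJet_phase hm hρ hρ1 hK hF hu ht) (by simp)
  have j3 := (j1.mul hm0 hmk j2).mul hm0 hmk (hasJet_const (Complex.exp (-(u : ℂ) * F t)))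
  refine (j3.congr fun σ _ => ?_).mono ?_
  · rw [damped, mul_assoc, ← Complex.exp_add]
    congr 2; ring
  · have hre : ‖Complex.exp (-(u : ℂ) * F t)‖ ≤ Real.exp (-(c * u * ‖t‖ ^ 2)) := by
      rw [Complex.norm_exp]
      refine Real.exp_le_exp.mpr ?_
      have := mul_le_mul_of_nonneg_left (hF.re_ge t ht) hu
      simp only [neg_mul, Complex.neg_re, Complex.re_ofReal_mul]
      linarith
    rw [← hB]
    calc B * (B * K * (C₁ * Real.exp (C₁ * (K * (1 + v * ‖t‖))))) *
          ‖Complex.exp (-(u : ℂ) * F t)‖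
        ≤ B * (B * K * (C₁ * Real.exp (C₁ * (K * (1 + v * ‖t‖))))) *
          Real.exp (-(c * u * ‖t‖ ^ 2)) := by gcongr
      _ = B * (B * K * C₁) *
          Real.exp (C₁ * (K * (1 + v * ‖t‖)) + -(c * u * ‖t‖ ^ 2)) := by
          rw [Real.exp_add]; ring
      _ ≤ B * (B * K * C₁) * Real.exp ((C₁ * K + (C₁ * K) ^ 2 / (2 * c) + 4 * c * r ^ 2) +
          -(c / 2 * (1 + u)) * ‖t‖ ^ 2) := by
          refine mul_le_mul_of_nonneg_left (Real.exp_le_exp.mpr ?_) (by positivity)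
          have e1 : ‖t‖ ^ 2 ≤ 4 * r ^ 2 := by nlinarith [norm_nonneg t]
          -- completing the square
          have e2 : C₁ * K * (v * ‖t‖) ≤ (C₁ * K) ^ 2 / (2 * c) + c / 2 * (v * ‖t‖) ^ 2 := by
            rw [← sub_nonneg]
            have e3 : (C₁ * K) ^ 2 / (2 * c) + c / 2 * (v * ‖t‖) ^ 2 - C₁ * K * (v * ‖t‖) =
                (C₁ * K - c * (v * ‖t‖)) ^ 2 / (2 * c) := by field_simp; ring
            rw [e3]; positivity
          rw [mul_pow v, hv2] at e2
          nlinarith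
      _ = _ := by rw [Real.exp_add]; ring

theorem integrable_rexp_neg_mul_sq_norm {b : ℝ} (hb : 0 < b) :
    Integrable fun t : Rd d => Real.exp (-b * ‖t‖ ^ 2) := by
  have := (GaussianFourier.integrable_cexp_neg_mul_sq_norm_add (V := Rd d) (b := (b : ℂ))
    (by simpa using hb) 0 0).norm
  refine this.congr (Eventually.of_forall fun t => ?_)
  simp only [Complex.norm_exp]
  congr 1
  norm_cast
  simp

theorem integral_rexp_neg_mul_sq_norm {b : ℝ} (hb : 0 < b) :
    ∫ t : Rd d, Real.exp (-b * ‖t‖ ^ 2) = (Real.pi / b) ^ ((d : ℝ) / 2) := by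
  simpa using GaussianFourier.integral_rexp_neg_mul_sq_norm (V := Rd d) hb

/-- The decay estimate: `∫ ψ exp(-u F) exp(-i⟨t, w⟩) dt` has size `(1 + u) ^ (-d/2)`, with the
additional factor `(√(1 + u) / |⟨w, e⟩|) ^ m` provided by the regularity of order `m`. -/
theorem exists_norm_fourierInt_damped_le (hm : 2 ≤ m) (hmk : m ≤ k + 1) (hr : 0 < r) (hρ : 0 < ρ)
    (hρ1 : ρ ≤ 1) (hρr : ρ ≤ r) (he : ‖e‖ = 1)
    (hc : 0 < c) (hK : 0 ≤ K) (hψ : IsAmplitude k m r ρ K e ψ) (hF : IsPhase k m r ρ c K e F) :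
    ∃ C : ℝ, 0 ≤ C ∧ ∀ u : ℝ, 0 ≤ u → ∀ w : Rd d,
      ‖fourierInt (damped ψ F u) w‖ ≤ C * (1 + u) ^ (-((d : ℝ) / 2)) ∧
      (⟪w, e⟫ ≠ 0 → ‖fourierInt (damped ψ F u) w‖ ≤
        C * (1 + u) ^ (-((d : ℝ) / 2)) * (√(1 + u) / |⟪w, e⟫|) ^ m) := by
  obtain ⟨C₀, hC₀, hjet⟩ := exists_hasJet_damped hm hmk hρ hρ1 hc hK hψ hF
  have hm0 : 0 < m := by linarith
  set g : ℝ → Rd d → ℝ := fun u t => Real.exp (-(c / 2 * (1 + u)) * ‖t‖ ^ 2) with hg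
  set A : ℝ := (Real.pi / (c / 2)) ^ ((d : ℝ) / 2) with hA
  have hA0 : 0 ≤ A := by positivity
  have hgI : ∀ u, 0 ≤ u → Integrable (g u) := fun u hu =>
    integrable_rexp_neg_mul_sq_norm (by positivity)
  have hgi : ∀ u, 0 ≤ u → ∫ t, g u t = A * (1 + u) ^ (-((d : ℝ) / 2)) := fun u hu => by
    simp only [hg]
    rw [integral_rexp_neg_mul_sq_norm (by positivity), hA, Real.rpow_neg (by positivity),
      ← div_div, Real.div_rpow (by positivity) (by positivity), div_eq_mul_inv]
  have h1 : ∀ u, 0 ≤ u → ∀ w, ‖fourierInt (damped ψ F u) w‖ ≤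
      (k + 2) * C₀ * A * (1 + u) ^ (-((d : ℝ) / 2)) := by
    intro u hu w
    refine (norm_fourierInt_le _ _).trans ?_
    rw [mul_assoc _ A, ← hgi u hu, ← integral_const_mul]
    refine integral_mono (integrable_damped hr hψ hF u).norm ((hgI u hu).const_mul _) fun t => ?_
    dsimp only
    by_cases ht : ‖t‖ < 2 * r
    · have := (hjet u hu t ht).norm_le hm0 (σ := 0) (by simp)
      simp only [mul_zero, zero_smul, add_zero] at this
      rw [mul_assoc]; exact this
    · rw [damped_eq_zero hψ u (by linarith), norm_zero]; positivity
  set Q : ℝ := (((k : ℝ) + 1) * Real.pi / ρ) ^ m with hQ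
  have hQ0 : 0 ≤ Q := by positivity
  have hk2 : ((k : ℝ) + 2) ≤ 2 ^ (k + 1) := by exact_mod_cast Nat.lt_two_pow_self (n := k + 1)
  set C₁ : ℝ := 2 ^ (k + 1) * C₀ * A with hC₁
  have hC₁0 : 0 ≤ C₁ := by positivity
  have h1' : ∀ u, 0 ≤ u → ∀ w, ‖fourierInt (damped ψ F u) w‖ ≤
      C₁ * (1 + u) ^ (-((d : ℝ) / 2)) := fun u hu w => (h1 u hu w).trans (by
    rw [hC₁]
    gcongr)
  refine ⟨C₁ * (1 + Q), by positivity, fun u hu w => ⟨?_, fun hw => ?_⟩⟩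
  · refine (h1' u hu w).trans ?_
    have : 0 ≤ C₁ * (1 + u) ^ (-((d : ℝ) / 2)) := by positivity
    nlinarith
  · have hv0 : 0 < √(1 + u) := Real.sqrt_pos.mpr (by linarith)
    have hw0 : 0 < |⟪w, e⟫| := abs_pos.mpr hw
    set q : ℝ := √(1 + u) / |⟪w, e⟫| with hq
    have hq0 : 0 < q := div_pos hv0 hw0
    have hQq : Q * q ^ m = (((k : ℝ) + 1) * Real.pi / ρ * q) ^ m := by
      rw [hQ, ← Real.mul_rpow (by positivity) hq0.le]
    have hmain : ‖fourierInt (damped ψ F u) w‖ ≤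
        C₁ * (1 + u) ^ (-((d : ℝ) / 2)) * (Q * q ^ m) := by
      rcases le_or_gt (((k : ℝ) + 1) * Real.pi / ρ * q) 1 with hle | hgt
      · refine (norm_fourierInt_le_finiteDiff (integrable_damped hr hψ hF u) (k + 1) hw).trans ?_
        have hpt : ∀ t, ‖∑ i ∈ Finset.range (k + 1 + 1),
            ((-1 : ℂ) ^ (k + 1 - i) * (k + 1).choose i) *
            damped ψ F u (t + (i * (Real.pi / ⟪w, e⟫)) • e)‖ ≤
            2 ^ (k + 1) * C₀ * (Q * q ^ m) * g u t := by
          intro t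
          set h : ℝ := √(1 + u) * (Real.pi / ⟪w, e⟫) / ρ with hh
          have hhq : ((k : ℝ) + 1) * |h| = ((k : ℝ) + 1) * Real.pi / ρ * q := by
            rw [hh, hq, abs_div, abs_mul, abs_of_pos hv0, abs_of_pos hρ, abs_div,
              abs_of_pos Real.pi_pos]
            field_simp
          have hstep : ∀ i : ℕ, (i : ℝ) * (Real.pi / ⟪w, e⟫) =
              ρ * ((√(1 + u))⁻¹ * (i * h)) := fun i => by
            rw [hh]; field_simp
          by_cases ht : ‖t‖ < 2 * r
          · have := (hjet u hu t ht).norm_finiteDiff_le hm0 (s := h) (by rw [hhq]; exact hle)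
            rw [hhq, ← hQq] at this
            simp only [hstep]
            refine this.trans (le_of_eq ?_)
            simp only [hg]; ring
          · rw [Finset.sum_eq_zero, norm_zero]
            · positivity
            · intro i hi
              rw [damped_eq_zero hψ u, mul_zero]
              have hi' : (i : ℝ) ≤ k + 1 := by
                have : i ≤ k + 1 := by have := Finset.mem_range.mp hi; omega
                exact_mod_cast this
              have h2 : ‖((i : ℝ) * (Real.pi / ⟪w, e⟫)) • e‖ ≤ ρ := by
                rw [norm_smul, he, mul_one, hstep, Real.norm_eq_abs, abs_mul, abs_of_pos hρ,
                  abs_mul, abs_of_pos (inv_pos.mpr hv0), abs_mul, Nat.abs_cast]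
                refine mul_le_of_le_one_right hρ.le (mul_le_one₀ ?_ (by positivity) ?_)
                · exact inv_le_one_of_one_le₀ (by rw [Real.one_le_sqrt]; linarith)
                · refine (mul_le_mul_of_nonneg_right hi' (abs_nonneg _)).trans ?_
                  rw [hhq]; exact hle
              have h3 := norm_sub_norm_le t (-(((i : ℝ) * (Real.pi / ⟪w, e⟫)) • e))
              rw [sub_neg_eq_add, norm_neg] at h3
              linarith [not_lt.mp ht]
        refine (integral_mono_of_nonneg (Eventually.of_forall fun _ => norm_nonneg _)
          ((hgI u hu).const_mul _) (Eventually.of_forall hpt)).trans (le_of_eq ?_)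
        rw [integral_const_mul, hgi u hu, hC₁]; ring
      · refine (h1' u hu w).trans ?_
        refine le_mul_of_one_le_right (by positivity) ?_
        rw [hQq]
        exact Real.one_le_rpow hgt.le hm0.le
    refine hmain.trans ?_
    have e1 : 0 ≤ C₁ * (1 + u) ^ (-((d : ℝ) / 2)) * q ^ m := by positivity
    nlinarith

end

section

/-! ### The resolvent as a Laplace integral -/

variable {d k : ℕ} {m r ρ c K : ℝ} {e : Rd d} {ψ F : Rd d → ℂ}

/-- The denominator `F(t) - i⟨t, b⟩`, where `F` is the part without drift. -/
def drifted (F : Rd d → ℂ) (b t : Rd d) : ℂ := F t - Complex.I * ((⟪t, b⟫ : ℝ) : ℂ)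

theorem damped_mul_cexp (ψ F : Rd d → ℂ) (b w t : Rd d) (u : ℝ) :
    damped ψ F u t * Complex.exp (-Complex.I * ((⟪t, w - u • b⟫ : ℝ) : ℂ)) =
      (ψ t * Complex.exp (-Complex.I * ((⟪t, w⟫ : ℝ) : ℂ))) *
        Complex.exp (-drifted F b t * u) := by
  rw [damped, drifted, mul_assoc, mul_assoc, ← Complex.exp_add, ← Complex.exp_add, inner_sub_right,
    inner_smul_right]
  congr 2
  push_cast
  ring

theorem re_drifted (F : Rd d → ℂ) (b t : Rd d) : (drifted F b t).re = (F t).re := by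
  simp [drifted]

theorem norm_damped_le (hr : 0 < r) (hψ : IsAmplitude k m r ρ K e ψ)
    (hF : IsPhase k m r ρ c K e F) {u : ℝ} (hu : 0 ≤ u) (t : Rd d) :
    ‖damped ψ F u t‖ ≤ ‖ψ t‖ * Real.exp (-(c * u) * ‖t‖ ^ 2) := by
  by_cases ht : ‖t‖ < 2 * r
  · rw [damped, norm_mul, Complex.norm_exp]
    refine mul_le_mul_of_nonneg_left (Real.exp_le_exp.mpr ?_) (norm_nonneg _)
    have := mul_le_mul_of_nonneg_left (hF.re_ge t ht) hu
    simp only [neg_mul, Complex.neg_re, Complex.re_ofReal_mul]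
    linarith
  · rw [damped_eq_zero hψ u (by linarith), norm_zero]; positivity

theorem continuous_dampedInt_integrand (hr : 0 < r) (hψ : IsAmplitude k m r ρ K e ψ)
    (hF : IsPhase k m r ρ c K e F) (b w : Rd d) :
    Continuous fun p : ℝ × Rd d =>
      damped ψ F p.1 p.2 * Complex.exp (-Complex.I * ((⟪p.2, w - p.1 • b⟫ : ℝ) : ℂ)) :=
  (continuous_damped_uncurry hr hψ hF).mul (by fun_prop)

theorem IsAmplitude.integrable (hψ : IsAmplitude k m r ρ K e ψ) : Integrable ψ :=
  hψ.continuous.integrable_of_hasCompactSupport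
    (HasCompactSupport.of_support_subset_isCompact (isCompact_closedBall (0 : Rd d) r)
      (fun t ht => by
        by_contra h
        exact ht (hψ.eq_zero t (by
          rw [mem_closedBall, dist_zero_right, not_le] at h; exact h.le))))

/-- `1 / D = ∫₀^∞ exp(-u D) du`, inserted in a Fourier integral. The integral over `u` comes last,
as an improper integral, because the double integral need not converge absolutely. -/
theorem tendsto_intervalIntegral_fourierInt_damped [Nontrivial (Rd d)] (hc : 0 < c) (hr : 0 < r)
    (hψ : IsAmplitude k m r ρ K e ψ) (hF : IsPhase k m r ρ c K e F) (b w : Rd d)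
    (hint : Integrable fun t => ψ t / drifted F b t) :
    Tendsto (fun T : ℝ => ∫ u in (0 : ℝ)..T, fourierInt (damped ψ F u) (w - u • b)) atTop
      (𝓝 (fourierInt (fun t => ψ t / drifted F b t) w)) := by
  set E : Rd d → ℂ := fun t => Complex.exp (-Complex.I * ((⟪t, w⟫ : ℝ) : ℂ)) with hE
  have hEn : ∀ t, ‖E t‖ = 1 := fun t => norm_cexp_neg_I_mul _
  have hre : ∀ t, t ≠ 0 → ‖t‖ < 2 * r → 0 < (drifted F b t).re := fun t ht0 ht => by
    rw [re_drifted]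
    exact lt_of_lt_of_le (mul_pos hc (by positivity)) (hF.re_ge t ht)
  have hne : ∀ᵐ t : Rd d, t ≠ 0 := by
    simp [ae_iff]
  have hswap : ∀ T : ℝ, 0 ≤ T →
      ∫ u in (0 : ℝ)..T, fourierInt (damped ψ F u) (w - u • b) =
      ∫ t, ψ t / drifted F b t * (1 - Complex.exp (-drifted F b t * T)) * E t := by
    intro T hT
    simp only [fourierInt]
    rw [intervalIntegral_integral_swap]
    · refine integral_congr_ae ?_
      filter_upwards [hne] with t ht0
      by_cases ht : ‖t‖ < 2 * r
      · simp only [damped_mul_cexp]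
        have hD : drifted F b t ≠ 0 := fun h0 => by
          have := hre t ht0 ht; rw [h0] at this; simp at this
        rw [intervalIntegral.integral_const_mul, integral_exp_mul_complex (neg_ne_zero.mpr hD)]
        simp only [Complex.ofReal_zero, mul_zero, Complex.exp_zero]
        simp only [hE]
        rw [div_neg]
        ring
      · simp [damped_eq_zero hψ _ (show r ≤ ‖t‖ by linarith), hψ.eq_zero t (by linarith)]
    · have : IsFiniteMeasure ((volume : Measure ℝ).restrict (Set.uIoc 0 T)) :=
        ⟨by rw [Measure.restrict_apply_univ, Set.uIoc]; exact measure_Ioc_lt_top⟩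
      have hb : Integrable (fun p : ℝ × Rd d => (1 : ℝ) * ‖ψ p.2‖)
          ((volume.restrict (Set.uIoc 0 T)).prod volume) :=
        Integrable.mul_prod (f := fun _ : ℝ => (1 : ℝ)) (g := fun t => ‖ψ t‖)
          (integrable_const _) hψ.integrable.norm
      refine hb.mono' (continuous_dampedInt_integrand hr hψ hF b w).aestronglyMeasurable ?_
      have hres : ((volume : Measure ℝ).restrict (Set.uIoc 0 T)).prod (volume : Measure (Rd d)) =
          (volume.prod volume).restrict (Set.uIoc 0 T ×ˢ Set.univ) := by
        rw [← Measure.prod_restrict, Measure.restrict_univ]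
      rw [hres]
      refine (ae_restrict_iff' (measurableSet_uIoc.prod MeasurableSet.univ)).mpr
        (Eventually.of_forall fun p hp => ?_)
      have hp1 : 0 ≤ p.1 := by
        have := hp.1; rw [Set.uIoc_of_le hT] at this; exact this.1.le
      simp only [Function.uncurry, norm_mul, norm_cexp_neg_I_mul, mul_one, one_mul]
      refine (norm_damped_le hr hψ hF hp1 p.2).trans
        (mul_le_of_le_one_right (norm_nonneg _) (Real.exp_le_one_iff.mpr ?_))
      have : 0 ≤ c * p.1 * ‖p.2‖ ^ 2 := by positivity
      linarith
  have hcongr : (fun T : ℝ => ∫ u in (0 : ℝ)..T, fourierInt (damped ψ F u) (w - u • b)) =ᶠ[atTop]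
      fun T => ∫ t, ψ t / drifted F b t * (1 - Complex.exp (-drifted F b t * T)) * E t := by
    filter_upwards [eventually_ge_atTop 0] with T hT using hswap T hT
  refine Tendsto.congr' hcongr.symm ?_
  -- `ψ / D` dominates because `|exp(-T D)| ≤ 1`
  have hexp1 : ∀ T : ℝ, 0 ≤ T → ∀ t, ‖t‖ < 2 * r → ‖Complex.exp (-drifted F b t * T)‖ ≤ 1 := by
    intro T hT t ht
    rw [Complex.norm_exp]
    refine Real.exp_le_one_iff.mpr ?_
    have h1 : 0 ≤ (drifted F b t).re := by
      rw [re_drifted]; exact le_trans (by positivity) (hF.re_ge t ht)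
    rw [mul_comm, Complex.re_ofReal_mul, Complex.neg_re]
    nlinarith
  refine tendsto_integral_filter_of_dominated_convergence
    (fun t => 2 * ‖ψ t / drifted F b t‖) ?_ ?_ (hint.norm.const_mul 2) ?_
  · refine Eventually.of_forall fun T => ?_
    have hDc : ContinuousOn (fun t => 1 - Complex.exp (-drifted F b t * T)) (ball 0 (2 * r)) := by
      have h1 : ContinuousOn (drifted F b) (ball 0 (2 * r)) :=
        hF.continuousOn.sub (by fun_prop)
      exact continuousOn_const.sub (Complex.continuous_exp.comp_continuousOn
        (h1.neg.mul continuousOn_const))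
    have hind : (fun t => ψ t / drifted F b t * (1 - Complex.exp (-drifted F b t * T)) * E t) =
        (ball (0 : Rd d) (2 * r)).indicator
          (fun t => ψ t / drifted F b t * (1 - Complex.exp (-drifted F b t * T)) * E t) := by
      refine (Set.indicator_eq_self.mpr fun t ht => ?_).symm
      by_contra h
      rw [mem_ball, dist_zero_right, not_lt] at h
      exact ht (by simp [hψ.eq_zero t (by linarith)])
    rw [hind, aestronglyMeasurable_indicator_iff measurableSet_ball]
    exact (hint.aestronglyMeasurable.restrict.mul
      (hDc.aestronglyMeasurable measurableSet_ball)).mul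
      (continuous_cexp_inner w).aestronglyMeasurable
  · filter_upwards [eventually_ge_atTop 0] with T hT
    refine Eventually.of_forall fun t => ?_
    rw [norm_mul, norm_mul, hEn, mul_one, mul_comm]
    by_cases ht : ‖t‖ < 2 * r
    · refine mul_le_mul_of_nonneg_right ((norm_sub_le _ _).trans ?_) (norm_nonneg _)
      rw [norm_one]
      linarith [hexp1 T hT t ht]
    · rw [hψ.eq_zero t (by linarith)]; simp
  · filter_upwards [hne] with t ht0
    by_cases ht : ‖t‖ < 2 * r
    · have h1 : Tendsto (fun T : ℝ => Complex.exp (-drifted F b t * T)) atTop (𝓝 0) := by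
        rw [tendsto_zero_iff_norm_tendsto_zero]
        have h2 := hre t ht0 ht
        have : (fun T : ℝ => ‖Complex.exp (-drifted F b t * T)‖) =
            fun T => Real.exp (-((drifted F b t).re * T)) := by
          ext T
          rw [Complex.norm_exp, mul_comm, Complex.re_ofReal_mul, Complex.neg_re]
          congr 1; ring
        rw [this]
        exact Real.tendsto_exp_neg_atTop_nhds_zero.comp (tendsto_id.const_mul_atTop h2)
      simpa [hE] using ((h1.const_sub 1).const_mul (ψ t / drifted F b t)).mul_const (E t)
    · simp [hψ.eq_zero t (by linarith)]

end

section

/-! ### Asymptotics of the singular integral -/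

variable {d k : ℕ} {m r ρ c K : ℝ} {e : Rd d} {ψ F : Rd d → ℂ}

/-- The integrand of the Laplace representation at the point `w`. -/
def laplaceTerm (ψ F : Rd d → ℂ) (b w : Rd d) (u : ℝ) : ℂ :=
  fourierInt (damped ψ F u) (w - u • b)

theorem stronglyMeasurable_laplaceTerm (hr : 0 < r) (hψ : IsAmplitude k m r ρ K e ψ)
    (hF : IsPhase k m r ρ c K e F) (b w : Rd d) : StronglyMeasurable (laplaceTerm ψ F b w) :=
  (continuous_dampedInt_integrand hr hψ hF b w).stronglyMeasurable.integral_prod_right'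

theorem sub_smul_eq {τ : ℝ} (hτ : 0 < τ) (a b : Rd d) (x : ℝ) :
    a - (τ + √τ * x) • b = √τ • ((√τ)⁻¹ • (a - τ • b) - x • b) := by
  have h : √τ ≠ 0 := (Real.sqrt_pos.mpr hτ).ne'
  rw [smul_sub, smul_inv_smul₀ h, smul_smul, add_smul]
  abel

theorem IsAmplitude.norm_le (hm : 0 < m) (hr : 0 < r) (hψ : IsAmplitude k m r ρ K e ψ)
    (hK : 0 ≤ K) (t : Rd d) : ‖ψ t‖ ≤ (k + 2) * K := by
  by_cases ht : ‖t‖ < 2 * r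
  · simpa using (hψ.hasJet t ht).norm_le hm (σ := 0) (by simp)
  · rw [hψ.eq_zero t (by linarith), norm_zero]; positivity

/-- In the window `u = τ + √τ x`, a local limit theorem. -/
theorem tendsto_laplaceTerm_window (hm : 0 < m) (hr : 0 < r) (hc : 0 < c) (hK : 0 ≤ K)
    (hψ : IsAmplitude k m r ρ K e ψ) (hF : IsPhase k m r ρ c K e F) {Q : Rd d → ℝ}
    (hQ : ∀ y, Tendsto (fun τ : ℝ => (τ : ℂ) * F ((√τ)⁻¹ • y)) atTop (𝓝 ((Q y / 2 : ℝ) : ℂ)))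
    {a : ℝ → Rd d} {b A : Rd d}
    (ha : Tendsto (fun τ : ℝ => (√τ)⁻¹ • (a τ - τ • b)) atTop (𝓝 A)) (x : ℝ) :
    Tendsto (fun τ : ℝ => τ ^ ((d : ℝ) / 2) • laplaceTerm ψ F b (a τ) (τ + √τ * x)) atTop
      (𝓝 (fourierInt (fun y => ψ 0 * Complex.exp (-((Q y / 2 : ℝ) : ℂ))) (A - x • b))) := by
  have hsq : Tendsto (fun τ : ℝ => √τ) atTop atTop := Real.tendsto_sqrt_atTop
  have hev : ∀ᶠ τ : ℝ in atTop, 0 < τ ∧ τ / 2 ≤ τ + √τ * x := by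
    filter_upwards [eventually_gt_atTop 0, hsq.eventually_ge_atTop (-2 * x)] with τ hτ h2
    refine ⟨hτ, ?_⟩
    have h3 : √τ * √τ = τ := Real.mul_self_sqrt hτ.le
    nlinarith [Real.sqrt_nonneg τ]
  have hscale : ∀ᶠ τ : ℝ in atTop,
      τ ^ ((d : ℝ) / 2) • laplaceTerm ψ F b (a τ) (τ + √τ * x) =
      ∫ y, damped ψ F (τ + √τ * x) ((√τ)⁻¹ • y) *
        Complex.exp (-Complex.I * ((⟪y, (√τ)⁻¹ • (a τ - τ • b) - x • b⟫ : ℝ) : ℂ)) := by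
    filter_upwards [eventually_gt_atTop 0] with τ hτ
    have h0 : √τ ≠ 0 := (Real.sqrt_pos.mpr hτ).ne'
    have h1 := Measure.integral_comp_inv_smul (volume : Measure (Rd d))
      (fun t => damped ψ F (τ + √τ * x) t *
        Complex.exp (-Complex.I * ((⟪t, a τ - (τ + √τ * x) • b⟫ : ℝ) : ℂ))) (√τ)
    rw [finrank_euclideanSpace, Fintype.card_fin, abs_of_nonneg (by positivity)] at h1
    have h2 : τ ^ ((d : ℝ) / 2) = √τ ^ d := by
      rw [Real.sqrt_eq_rpow, ← Real.rpow_natCast, ← Real.rpow_mul hτ.le]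
      congr 1; ring
    rw [laplaceTerm, fourierInt, h2, ← h1]
    congr 1
    ext y
    rw [sub_smul_eq hτ, inner_smul_right, inner_smul_left, conj_trivial, mul_inv_cancel_left₀ h0]
  refine Tendsto.congr' (EventuallyEq.symm hscale) ?_
  refine tendsto_integral_filter_of_dominated_convergence
    (fun y => (k + 2) * K * Real.exp (-(c / 2) * ‖y‖ ^ 2)) ?_ ?_
    ((integrable_rexp_neg_mul_sq_norm (half_pos hc)).const_mul _) ?_
  · refine Eventually.of_forall fun τ => Continuous.aestronglyMeasurable ?_
    exact ((continuous_damped hr hψ hF _).comp (continuous_const_smul _)).mul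
      (continuous_cexp_inner _)
  · filter_upwards [hev] with τ hτ
    refine Eventually.of_forall fun y => ?_
    rw [norm_mul, norm_cexp_neg_I_mul, mul_one]
    refine (norm_damped_le hr hψ hF (le_trans (by linarith [hτ.1]) hτ.2) _).trans ?_
    refine mul_le_mul (hψ.norm_le hm hr hK _) (Real.exp_le_exp.mpr ?_) (Real.exp_nonneg _)
      (by positivity)
    rw [norm_smul, norm_inv, Real.norm_of_nonneg (Real.sqrt_nonneg _), mul_pow, inv_pow,
      Real.sq_sqrt hτ.1.le]
    have h1 : (1 : ℝ) / 2 ≤ (τ + √τ * x) * τ⁻¹ := by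
      rw [← div_eq_mul_inv, le_div_iff₀ hτ.1]; linarith [hτ.2]
    have h2 := mul_le_mul_of_nonneg_right h1 (by positivity : 0 ≤ c * ‖y‖ ^ 2)
    nlinarith
  · refine Eventually.of_forall fun y => ?_
    have hz : Tendsto (fun τ : ℝ => (√τ)⁻¹ • y) atTop (𝓝 0) := by
      simpa using (tendsto_inv_atTop_zero.comp hsq).smul_const y
    have h1 : Tendsto (fun τ : ℝ => ψ ((√τ)⁻¹ • y)) atTop (𝓝 (ψ 0)) :=
      (hψ.continuous.tendsto 0).comp hz
    have hratio : Tendsto (fun τ : ℝ => (1 : ℝ) + (√τ)⁻¹ * x) atTop (𝓝 1) := by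
      simpa using ((tendsto_inv_atTop_zero.comp hsq).mul_const x).const_add 1
    have h2 : Tendsto (fun τ : ℝ => ((τ + √τ * x : ℝ) : ℂ) * F ((√τ)⁻¹ • y)) atTop
        (𝓝 ((Q y / 2 : ℝ) : ℂ)) := by
      have h3 := ((Complex.continuous_ofReal.tendsto 1).comp hratio).mul (hQ y)
      rw [Complex.ofReal_one, one_mul] at h3
      refine h3.congr' ?_
      filter_upwards [eventually_gt_atTop 0] with τ hτ
      have h0 : √τ ≠ 0 := (Real.sqrt_pos.mpr hτ).ne'
      have h4 : τ + √τ * x = (1 + (√τ)⁻¹ * x) * τ := by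
        have h6 : (√τ)⁻¹ * τ = √τ := by
          rw [inv_mul_eq_iff_eq_mul₀ h0, Real.mul_self_sqrt hτ.le]
        linear_combination -x * h6
      rw [h4]
      simp only [Function.comp]
      push_cast
      ring
    have h5 : Tendsto (fun τ : ℝ => damped ψ F (τ + √τ * x) ((√τ)⁻¹ • y)) atTop
        (𝓝 (ψ 0 * Complex.exp (-((Q y / 2 : ℝ) : ℂ)))) := by
      refine h1.mul ((Complex.continuous_exp.tendsto _).comp ?_)
      simpa only [← neg_mul] using h2.neg
    refine h5.mul ?_
    refine ((continuous_const.mul (Complex.continuous_ofReal.comp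
      (continuous_const.inner continuous_id))).cexp.tendsto (A - x • b)).comp
      (ha.sub_const (x • b))

/-- The decay estimate in the form used for the window: outside the bulk `|x| = O(1)`, two orders
of regularity give an integrable factor `x ^ (-2)`. -/
theorem exists_laplaceTerm_window_le (hd : 2 ≤ d) (hm : 2 ≤ m) {b : Rd d} (hb : b ≠ 0) {C : ℝ}
    (hC : 0 ≤ C)
    (hdecay : ∀ u : ℝ, 0 ≤ u → ∀ w : Rd d,
      ‖fourierInt (damped ψ F u) w‖ ≤ C * (1 + u) ^ (-((d : ℝ) / 2)) ∧
      (⟪w, ‖b‖⁻¹ • b⟫ ≠ 0 → ‖fourierInt (damped ψ F u) w‖ ≤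
        C * (1 + u) ^ (-((d : ℝ) / 2)) * (√(1 + u) / |⟪w, ‖b‖⁻¹ • b⟫|) ^ m))
    {a : ℝ → Rd d} {A : Rd d}
    (ha : Tendsto (fun τ : ℝ => (√τ)⁻¹ • (a τ - τ • b)) atTop (𝓝 A)) :
    ∃ B : ℝ, ∀ᶠ τ : ℝ in atTop, ∀ x : ℝ, τ / 2 < τ + √τ * x →
      τ ^ ((d : ℝ) / 2) * ‖laplaceTerm ψ F b (a τ) (τ + √τ * x)‖ ≤ B * (1 + x ^ 2)⁻¹ := by
  set μ : ℝ := ‖b‖ with hμ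
  have hμ0 : 0 < μ := norm_pos_iff.mpr hb
  set α : ℝ := ‖A‖ + 1 with hα
  have hα0 : 0 < α := by positivity
  set x₀ : ℝ := max (2 * α / μ) 1 with hx₀
  set D : ℝ := (2 : ℝ) ^ ((d : ℝ) / 2) with hD
  have hD0 : 0 < D := by positivity
  have hd2 : (1 : ℝ) ≤ (d : ℝ) / 2 := by
    have : (2 : ℝ) ≤ d := by exact_mod_cast hd
    linarith
  refine ⟨C * D * (1 + x₀ ^ 2) + C * D * (8 / μ ^ 2), ?_⟩
  filter_upwards [eventually_ge_atTop 1, ha.norm.eventually_le_const (show ‖A‖ < α by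
    rw [hα]; linarith)] with τ hτ hA x hx
  have hτ0 : 0 < τ := by linarith
  have hsq0 : 0 < √τ := Real.sqrt_pos.mpr hτ0
  set u : ℝ := τ + √τ * x with hu
  have hu0 : 0 < u := by linarith
  have hv0 : 0 < 1 + u := by linarith
  set z : ℝ := τ / (1 + u) with hz
  have hz0 : 0 < z := by positivity
  have hz2 : z ≤ 2 := by rw [hz, div_le_iff₀ hv0]; linarith
  have hzpow : τ ^ ((d : ℝ) / 2) * (1 + u) ^ (-((d : ℝ) / 2)) = z ^ ((d : ℝ) / 2) := by
    rw [hz, Real.div_rpow hτ0.le hv0.le, Real.rpow_neg hv0.le]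
    exact (div_eq_mul_inv _ _).symm
  have hzD : z ^ ((d : ℝ) / 2) ≤ D := Real.rpow_le_rpow hz0.le hz2 (by linarith)
  obtain ⟨h1, h2⟩ := hdecay u hu0.le (a τ - u • b)
  have hx1 : 0 < 1 + x ^ 2 := by positivity
  rw [← div_eq_mul_inv, le_div_iff₀ hx1, add_comm (C * D * (1 + x₀ ^ 2))]
  change τ ^ ((d : ℝ) / 2) * ‖fourierInt (damped ψ F u) (a τ - u • b)‖ * (1 + x ^ 2) ≤ _
  rcases le_or_gt |x| x₀ with hxx | hxx
  · have hxsq : x ^ 2 ≤ x₀ ^ 2 := by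
      rw [← sq_abs]; exact pow_le_pow_left₀ (abs_nonneg _) hxx 2
    have h3 : τ ^ ((d : ℝ) / 2) * ‖fourierInt (damped ψ F u) (a τ - u • b)‖ ≤ C * D := by
      calc _ ≤ τ ^ ((d : ℝ) / 2) * (C * (1 + u) ^ (-((d : ℝ) / 2))) := by gcongr
        _ = C * (τ ^ ((d : ℝ) / 2) * (1 + u) ^ (-((d : ℝ) / 2))) := by ring
        _ ≤ C * D := by rw [hzpow]; gcongr
    have h4 : 0 ≤ C * D * (8 / μ ^ 2) := by positivity
    calc _ ≤ C * D * (1 + x₀ ^ 2) := by gcongr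
      _ ≤ _ := by linarith
  · have hx_one : 1 < |x| := (le_max_right _ _).trans_lt hxx
    have hxα : 2 * α < μ * |x| := by
      have := (le_max_left (2 * α / μ) 1).trans_lt hxx
      rw [div_lt_iff₀ hμ0] at this; linarith
    -- the component of `w` along the drift
    have hinner : ⟪a τ - u • b, μ⁻¹ • b⟫ =
        √τ * (⟪(√τ)⁻¹ • (a τ - τ • b), μ⁻¹ • b⟫ - x * μ) := by
      rw [hu, sub_smul_eq hτ0, inner_smul_left, inner_sub_left, inner_smul_left b _ x,
        inner_smul_right b b, real_inner_self_eq_norm_sq]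
      simp only [conj_trivial]
      rw [← hμ]; field_simp
    have hAe : |⟪(√τ)⁻¹ • (a τ - τ • b), μ⁻¹ • b⟫| ≤ α := by
      refine (abs_real_inner_le_norm _ _).trans ?_
      rw [norm_smul μ⁻¹, norm_inv, Real.norm_of_nonneg hμ0.le, ← hμ, inv_mul_cancel₀ hμ0.ne',
        mul_one]
      exact hA
    have hlow : √τ * (μ * |x| / 2) ≤ |⟪a τ - u • b, μ⁻¹ • b⟫| := by
      rw [hinner, abs_mul, abs_of_pos hsq0]
      refine mul_le_mul_of_nonneg_left ?_ hsq0.le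
      have := abs_sub_abs_le_abs_sub (x * μ) ⟪(√τ)⁻¹ • (a τ - τ • b), μ⁻¹ • b⟫
      rw [abs_mul, abs_of_pos hμ0, abs_sub_comm] at this
      linarith
    have hlow0 : 0 < √τ * (μ * |x| / 2) := by positivity
    have hw0 : 0 < |⟪a τ - u • b, μ⁻¹ • b⟫| := hlow0.trans_le hlow
    set q : ℝ := √(1 + u) / |⟪a τ - u • b, μ⁻¹ • b⟫| with hq
    have hq0 : 0 < q := div_pos (Real.sqrt_pos.mpr hv0) hw0
    have hmin : ‖fourierInt (damped ψ F u) (a τ - u • b)‖ ≤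
        C * (1 + u) ^ (-((d : ℝ) / 2)) * q ^ 2 := by
      rcases le_or_gt q 1 with hq1 | hq1
      · refine (h2 (abs_pos.mp hw0)).trans (mul_le_mul_of_nonneg_left ?_ (by positivity))
        rw [← Real.rpow_two]
        exact Real.rpow_le_rpow_of_exponent_ge hq0 hq1 hm
      · exact h1.trans (le_mul_of_one_le_right (by positivity) (one_le_pow₀ hq1.le))
    have hq2 : q ^ 2 ≤ 4 / (μ ^ 2 * x ^ 2) * z⁻¹ := by
      have : q ≤ √(1 + u) / (√τ * (μ * |x| / 2)) := by rw [hq]; gcongr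
      calc q ^ 2 ≤ (√(1 + u) / (√τ * (μ * |x| / 2))) ^ 2 := by gcongr
        _ = (1 + u) / (τ * (μ ^ 2 * x ^ 2 / 4)) := by
          rw [div_pow, mul_pow, Real.sq_sqrt hv0.le, Real.sq_sqrt hτ0.le, div_pow, mul_pow, sq_abs]
          norm_num
        _ = _ := by
          rw [hz]
          have : x ≠ 0 := by rintro rfl; simp at hx_one; linarith
          field_simp
    have hzz : z ^ ((d : ℝ) / 2) * z⁻¹ ≤ D := by
      rw [← div_eq_mul_inv, ← Real.rpow_sub_one hz0.ne']
      calc z ^ ((d : ℝ) / 2 - 1) ≤ 2 ^ ((d : ℝ) / 2 - 1) :=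
            Real.rpow_le_rpow hz0.le hz2 (by linarith)
        _ ≤ D := Real.rpow_le_rpow_of_exponent_le (by norm_num) (by linarith)
    have hxpos : 1 < x ^ 2 := by rw [← sq_abs]; nlinarith
    have h3 : τ ^ ((d : ℝ) / 2) * ‖fourierInt (damped ψ F u) (a τ - u • b)‖ ≤
        C * D * (4 / (μ ^ 2 * x ^ 2)) := by
      calc _ ≤ τ ^ ((d : ℝ) / 2) * (C * (1 + u) ^ (-((d : ℝ) / 2)) *
            (4 / (μ ^ 2 * x ^ 2) * z⁻¹)) := by
            refine mul_le_mul_of_nonneg_left (hmin.trans ?_) (by positivity)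
            gcongr
        _ = C * (τ ^ ((d : ℝ) / 2) * (1 + u) ^ (-((d : ℝ) / 2)) * z⁻¹) *
            (4 / (μ ^ 2 * x ^ 2)) := by ring
        _ ≤ _ := by rw [hzpow]; gcongr
    have h4 : C * D * (4 / (μ ^ 2 * x ^ 2)) * (1 + x ^ 2) ≤ C * D * (8 / μ ^ 2) := by
      have h5 : 4 / (μ ^ 2 * x ^ 2) * (1 + x ^ 2) ≤ 8 / μ ^ 2 := by
        rw [div_mul_eq_mul_div, div_le_div_iff₀ (by positivity) (by positivity)]
        have : 0 < μ ^ 2 := by positivity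
        nlinarith
      rw [mul_assoc]
      exact mul_le_mul_of_nonneg_left h5 (by positivity)
    have h6 : 0 ≤ C * D * (1 + x₀ ^ 2) := by positivity
    calc _ ≤ C * D * (4 / (μ ^ 2 * x ^ 2)) * (1 + x ^ 2) := by gcongr
      _ ≤ _ := by linarith

end

section

variable {d k : ℕ} {m r ρ c K : ℝ} {e : Rd d} {ψ F : Rd d → ℂ}

theorem integral_comp_window (g : ℝ → ℂ) {τ : ℝ} (hτ : 0 < τ) :
    ∫ x : ℝ, g (τ + √τ * x) = (√τ)⁻¹ • ∫ u, g u := by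
  have h := Measure.integral_comp_mul_left (fun y => g (τ + y)) (√τ)
  rw [h, integral_add_left_eq_self (fun y => g y) τ, abs_of_nonneg (by positivity)]

theorem integrable_comp_window_iff (g : ℝ → ℂ) {τ : ℝ} (hτ : 0 < τ) :
    Integrable (fun x : ℝ => g (τ + √τ * x)) ↔ Integrable g := by
  rw [integrable_comp_mul_left_iff (fun y => g (τ + y)) (Real.sqrt_pos.mpr hτ).ne']
  refine ⟨fun h => ?_, fun h => h.comp_add_left τ⟩
  simpa using h.comp_add_left (-τ)

/-- The contribution of `u > τ / 2` to the Laplace integral. -/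
theorem tendsto_integral_laplaceTerm_Ioi (hd : 2 ≤ d) (hm : 2 ≤ m) (hr : 0 < r) (hc : 0 < c)
    (hK : 0 ≤ K) (hψ : IsAmplitude k m r ρ K e ψ) (hF : IsPhase k m r ρ c K e F) {Q : Rd d → ℝ}
    (hQ : ∀ y, Tendsto (fun τ : ℝ => (τ : ℂ) * F ((√τ)⁻¹ • y)) atTop (𝓝 ((Q y / 2 : ℝ) : ℂ)))
    {a : ℝ → Rd d} {b A : Rd d} (hb : b ≠ 0) {C : ℝ} (hC : 0 ≤ C)
    (hdecay : ∀ u : ℝ, 0 ≤ u → ∀ w : Rd d,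
      ‖fourierInt (damped ψ F u) w‖ ≤ C * (1 + u) ^ (-((d : ℝ) / 2)) ∧
      (⟪w, ‖b‖⁻¹ • b⟫ ≠ 0 → ‖fourierInt (damped ψ F u) w‖ ≤
        C * (1 + u) ^ (-((d : ℝ) / 2)) * (√(1 + u) / |⟪w, ‖b‖⁻¹ • b⟫|) ^ m))
    (ha : Tendsto (fun τ : ℝ => (√τ)⁻¹ • (a τ - τ • b)) atTop (𝓝 A)) :
    (∀ᶠ τ : ℝ in atTop, IntegrableOn (laplaceTerm ψ F b (a τ)) (Set.Ioi (τ / 2))) ∧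
    Tendsto (fun τ : ℝ => τ ^ (((d : ℝ) - 1) / 2) •
      ∫ u in Set.Ioi (τ / 2), laplaceTerm ψ F b (a τ) u) atTop
      (𝓝 (∫ x : ℝ, fourierInt (fun y => ψ 0 * Complex.exp (-((Q y / 2 : ℝ) : ℂ)))
        (A - x • b))) := by
  obtain ⟨B, hB⟩ := exists_laplaceTerm_window_le hd hm hb hC hdecay ha
  set G : ℝ → ℝ → ℂ := fun τ => (Set.Ioi (τ / 2)).indicator (laplaceTerm ψ F b (a τ)) with hG
  have hGm : ∀ τ, StronglyMeasurable (G τ) := fun τ =>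
    (stronglyMeasurable_laplaceTerm hr hψ hF b (a τ)).indicator measurableSet_Ioi
  have hGm' : ∀ τ, AEStronglyMeasurable (fun x => G τ (τ + √τ * x)) volume := fun τ =>
    ((hGm τ).comp_measurable (by fun_prop)).aestronglyMeasurable
  have hbound : ∀ᶠ τ : ℝ in atTop, ∀ x,
      ‖τ ^ ((d : ℝ) / 2) • G τ (τ + √τ * x)‖ ≤ |B| * (1 + x ^ 2)⁻¹ := by
    filter_upwards [hB, eventually_gt_atTop 0] with τ hτ hτ0 x
    rw [norm_smul, Real.norm_of_nonneg (by positivity)]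
    by_cases hx : τ / 2 < τ + √τ * x
    · simp only [hG, Set.indicator_of_mem (Set.mem_Ioi.mpr hx)]
      exact (hτ x hx).trans (mul_le_mul_of_nonneg_right (le_abs_self B) (by positivity))
    · simp only [hG, Set.indicator_of_notMem (show τ + √τ * x ∉ Set.Ioi (τ / 2) from hx),
        norm_zero, mul_zero]
      positivity
  have hbI : Integrable fun x : ℝ => |B| * (1 + x ^ 2)⁻¹ := integrable_inv_one_add_sq.const_mul _
  refine ⟨?_, ?_⟩
  · filter_upwards [hbound, eventually_gt_atTop 0] with τ hτ hτ0
    rw [← integrable_indicator_iff measurableSet_Ioi]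
    change Integrable (G τ)
    rw [← integrable_comp_window_iff _ hτ0]
    have h1 : Integrable fun x => τ ^ ((d : ℝ) / 2) • G τ (τ + √τ * x) :=
      hbI.mono' ((hGm' τ).const_smul (τ ^ ((d : ℝ) / 2))) (Eventually.of_forall hτ)
    exact (integrable_smul_iff (Real.rpow_pos_of_pos hτ0 _).ne' _).mp h1
  · have heq : ∀ᶠ τ : ℝ in atTop, ∫ x, τ ^ ((d : ℝ) / 2) • G τ (τ + √τ * x) =
        τ ^ (((d : ℝ) - 1) / 2) • ∫ u in Set.Ioi (τ / 2), laplaceTerm ψ F b (a τ) u := by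
      filter_upwards [eventually_gt_atTop 0] with τ hτ0
      rw [integral_smul, integral_comp_window _ hτ0, smul_smul, hG,
        integral_indicator measurableSet_Ioi]
      congr 1
      rw [Real.sqrt_eq_rpow, ← Real.rpow_neg hτ0.le, ← Real.rpow_add hτ0]
      congr 1; ring
    refine Tendsto.congr' heq ?_
    refine tendsto_integral_filter_of_dominated_convergence _
      (Eventually.of_forall fun τ => (hGm' τ).const_smul (τ ^ ((d : ℝ) / 2)))
      (hbound.mono fun τ h => Eventually.of_forall h) hbI (Eventually.of_forall fun x => ?_)
    refine (tendsto_laplaceTerm_window (by linarith) hr hc hK hψ hF hQ ha x).congr' ?_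
    filter_upwards [eventually_gt_atTop 0,
      Real.tendsto_sqrt_atTop.eventually_gt_atTop (-2 * x)] with τ hτ h2
    have h3 : √τ * √τ = τ := Real.mul_self_sqrt hτ.le
    have h4 : τ / 2 < τ + √τ * x := by nlinarith [Real.sqrt_pos.mpr hτ]
    simp only [hG, Set.indicator_of_mem (Set.mem_Ioi.mpr h4)]

/-- The contribution of `u ≤ τ / 2` is negligible as soon as `m > (d - 1) / 2`. -/
theorem tendsto_integral_laplaceTerm_small (hm : 2 ≤ m) (hmd : ((d : ℝ) - 1) / 2 < m)
    {a : ℝ → Rd d} {b A : Rd d} (hb : b ≠ 0) {C : ℝ} (hC : 0 ≤ C)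
    (hdecay : ∀ u : ℝ, 0 ≤ u → ∀ w : Rd d,
      ‖fourierInt (damped ψ F u) w‖ ≤ C * (1 + u) ^ (-((d : ℝ) / 2)) ∧
      (⟪w, ‖b‖⁻¹ • b⟫ ≠ 0 → ‖fourierInt (damped ψ F u) w‖ ≤
        C * (1 + u) ^ (-((d : ℝ) / 2)) * (√(1 + u) / |⟪w, ‖b‖⁻¹ • b⟫|) ^ m))
    (ha : Tendsto (fun τ : ℝ => (√τ)⁻¹ • (a τ - τ • b)) atTop (𝓝 A)) :
    Tendsto (fun τ : ℝ => τ ^ (((d : ℝ) - 1) / 2) •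
      ∫ u in (0 : ℝ)..(τ / 2), laplaceTerm ψ F b (a τ) u) atTop (𝓝 0) := by
  set μ : ℝ := ‖b‖ with hμ
  have hμ0 : 0 < μ := norm_pos_iff.mpr hb
  set α : ℝ := ‖A‖ + 1 with hα
  have hα0 : 0 < α := by positivity
  -- an exponent `β > -1` slightly larger than the natural one `(m - d) / 2`
  set δ : ℝ := (m - ((d : ℝ) - 1) / 2) / 2 with hδ
  have hδ0 : 0 < δ := by rw [hδ]; linarith
  set β : ℝ := max ((m - d) / 2) (-1 + δ) with hβ
  have hβ1 : (m - d) / 2 ≤ β := le_max_left _ _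
  have hβ2 : -1 < β := lt_of_lt_of_le (by linarith) (le_max_right _ _)
  have hβ3 : ((d : ℝ) - 1) / 2 - m + (β + 1) < 0 := by
    rcases max_choice ((m - d) / 2) (-1 + δ) with h | h
    · rw [hβ, h]; linarith
    · rw [hβ, h]; linarith
  set C₁ : ℝ := C * (4 / μ) ^ m * (2 ^ (β + 1) / (β + 1)) with hC₁
  have hlim : Tendsto (fun τ : ℝ => C₁ * τ ^ (((d : ℝ) - 1) / 2 - m + (β + 1))) atTop (𝓝 0) := by
    have := (tendsto_rpow_neg_atTop (neg_pos.mpr hβ3)).const_mul C₁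
    simpa using this
  refine squeeze_zero_norm' ?_ hlim
  filter_upwards [eventually_ge_atTop 1, ha.norm.eventually_le_const (show ‖A‖ < α by
    rw [hα]; linarith), Real.tendsto_sqrt_atTop.eventually_ge_atTop (4 * α / μ)] with τ hτ hA hτα
  have hτ0 : 0 < τ := by linarith
  have hsq0 : 0 < √τ := Real.sqrt_pos.mpr hτ0
  have hsq : √τ * √τ = τ := Real.mul_self_sqrt hτ0.le
  have hpt : ∀ u ∈ Set.Ioc 0 (τ / 2), ‖laplaceTerm ψ F b (a τ) u‖ ≤
      C * (4 / μ) ^ m * τ ^ (-m) * (1 + u) ^ β := by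
    intro u hu
    have hv0 : 0 < 1 + u := by linarith [hu.1]
    have hinner : ⟪a τ - u • b, μ⁻¹ • b⟫ =
        √τ * ⟪(√τ)⁻¹ • (a τ - τ • b), μ⁻¹ • b⟫ + (τ - u) * μ := by
      have h1 : a τ - u • b = √τ • ((√τ)⁻¹ • (a τ - τ • b)) + (τ - u) • b := by
        rw [smul_inv_smul₀ hsq0.ne', sub_smul]; abel
      rw [h1, inner_add_left, inner_smul_left, inner_smul_left b _ (τ - u),
        inner_smul_right b b, real_inner_self_eq_norm_sq, ← hμ]
      simp only [conj_trivial]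
      field_simp
    have hAe : |⟪(√τ)⁻¹ • (a τ - τ • b), μ⁻¹ • b⟫| ≤ α := by
      refine (abs_real_inner_le_norm _ _).trans ?_
      rw [norm_smul μ⁻¹, norm_inv, Real.norm_of_nonneg hμ0.le, ← hμ, inv_mul_cancel₀ hμ0.ne',
        mul_one]
      exact hA
    have hlow : τ * μ / 4 ≤ |⟪a τ - u • b, μ⁻¹ • b⟫| := by
      rw [hinner]
      refine le_trans ?_ (le_abs_self _)
      have h1 := mul_le_mul_of_nonneg_left (neg_le_of_abs_le hAe) hsq0.le
      have h2 : 4 * α ≤ √τ * μ := by rwa [div_le_iff₀ hμ0] at hτα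
      have h3 := mul_le_mul_of_nonneg_left h2 hsq0.le
      have h4 := mul_le_mul_of_nonneg_right hu.2 hμ0.le
      nlinarith
    have hlow0 : 0 < τ * μ / 4 := by positivity
    have hw0 := hlow0.trans_le hlow
    refine ((hdecay u hu.1.le _).2 (abs_pos.mp hw0)).trans ?_
    have h1 : (√(1 + u) / |⟪a τ - u • b, μ⁻¹ • b⟫|) ^ m ≤
        (1 + u) ^ (m / 2) * ((4 / μ) ^ m * τ ^ (-m)) := by
      calc (√(1 + u) / |⟪a τ - u • b, μ⁻¹ • b⟫|) ^ m ≤ (√(1 + u) * (4 / μ * τ⁻¹)) ^ m := by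
            refine Real.rpow_le_rpow (by positivity) ?_ (by linarith)
            rw [div_eq_mul_inv]
            refine mul_le_mul_of_nonneg_left ?_ (Real.sqrt_nonneg _)
            rw [show 4 / μ * τ⁻¹ = (τ * μ / 4)⁻¹ by field_simp]
            exact inv_anti₀ hlow0 hlow
        _ = _ := by
            rw [Real.mul_rpow (Real.sqrt_nonneg _) (by positivity),
              Real.mul_rpow (by positivity) (by positivity), Real.inv_rpow hτ0.le,
              ← Real.rpow_neg hτ0.le, Real.sqrt_eq_rpow, ← Real.rpow_mul hv0.le]
            congr 2; ring
    calc C * (1 + u) ^ (-((d : ℝ) / 2)) * (√(1 + u) / |⟪a τ - u • b, μ⁻¹ • b⟫|) ^ m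
        ≤ C * (1 + u) ^ (-((d : ℝ) / 2)) * ((1 + u) ^ (m / 2) * ((4 / μ) ^ m * τ ^ (-m))) :=
          mul_le_mul_of_nonneg_left h1 (by positivity)
      _ = C * (4 / μ) ^ m * τ ^ (-m) * ((1 + u) ^ (-((d : ℝ) / 2)) * (1 + u) ^ (m / 2)) := by ring
      _ = C * (4 / μ) ^ m * τ ^ (-m) * (1 + u) ^ ((m - d) / 2) := by
          rw [← Real.rpow_add hv0]; congr 2; ring
      _ ≤ _ := by
          refine mul_le_mul_of_nonneg_left
            (Real.rpow_le_rpow_of_exponent_le (by linarith [hu.1]) hβ1) (by positivity)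
  have hint : IntervalIntegrable (fun u : ℝ => C * (4 / μ) ^ m * τ ^ (-m) * (1 + u) ^ β)
      volume 0 (τ / 2) := by
    refine ContinuousOn.intervalIntegrable ?_
    refine continuousOn_const.mul ((continuousOn_const.add continuousOn_id).rpow_const ?_)
    intro u hu
    rw [Set.uIcc_of_le (by positivity)] at hu
    left
    have h1 : (0 : ℝ) < 1 + u := by linarith [hu.1]
    exact h1.ne'
  have hI := intervalIntegral.norm_integral_le_of_norm_le (by positivity : (0 : ℝ) ≤ τ / 2)
    (Eventually.of_forall hpt) hint
  have hval : ∫ u in (0 : ℝ)..(τ / 2), (1 + u) ^ β ≤ 2 ^ (β + 1) / (β + 1) * τ ^ (β + 1) := by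
    rw [intervalIntegral.integral_comp_add_left (fun u => u ^ β), integral_rpow (Or.inl hβ2),
      div_mul_eq_mul_div]
    have hβ4 : 0 < β + 1 := by linarith
    refine div_le_div_of_nonneg_right ?_ hβ4.le
    rw [add_zero, Real.one_rpow, ← Real.mul_rpow (by norm_num) hτ0.le]
    have : (1 + τ / 2) ^ (β + 1) ≤ (2 * τ) ^ (β + 1) :=
      Real.rpow_le_rpow (by positivity) (by linarith) hβ4.le
    linarith
  rw [intervalIntegral.integral_const_mul] at hI
  rw [norm_smul, Real.norm_of_nonneg (by positivity)]
  calc τ ^ (((d : ℝ) - 1) / 2) * ‖∫ u in (0 : ℝ)..(τ / 2), laplaceTerm ψ F b (a τ) u‖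
      ≤ τ ^ (((d : ℝ) - 1) / 2) * (C * (4 / μ) ^ m * τ ^ (-m) *
          (2 ^ (β + 1) / (β + 1) * τ ^ (β + 1))) := by
        refine mul_le_mul_of_nonneg_left (hI.trans ?_) (by positivity)
        exact mul_le_mul_of_nonneg_left hval (by positivity)
    _ = C₁ * (τ ^ (((d : ℝ) - 1) / 2) * τ ^ (-m) * τ ^ (β + 1)) := by rw [hC₁]; ring
    _ = _ := by rw [← Real.rpow_add hτ0, ← Real.rpow_add hτ0, ← sub_eq_add_neg]

/-- Asymptotics of the Fourier integral of `ψ / D`, where `D(t) = F(t) - i⟨t, b⟩` vanishes at `0`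
only, along a path `a(τ) = τ b + √τ A + o(√τ)`. -/
theorem tendsto_fourierInt_div_drifted [Nontrivial (Rd d)] (hd : 2 ≤ d) (hm : 2 ≤ m)
    (hmk : m ≤ k + 1) (hmd : ((d : ℝ) - 1) / 2 < m) (hr : 0 < r) (hρ : 0 < ρ) (hρ1 : ρ ≤ 1)
    (hρr : ρ ≤ r) (hc : 0 < c) (hK : 0 ≤ K) {a : ℝ → Rd d} {b A : Rd d} (hb : b ≠ 0)
    (hψ : IsAmplitude k m r ρ K (‖b‖⁻¹ • b) ψ) (hF : IsPhase k m r ρ c K (‖b‖⁻¹ • b) F)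
    (hint : Integrable fun t => ψ t / drifted F b t) {Q : Rd d → ℝ}
    (hQ : ∀ y, Tendsto (fun τ : ℝ => (τ : ℂ) * F ((√τ)⁻¹ • y)) atTop (𝓝 ((Q y / 2 : ℝ) : ℂ)))
    (ha : Tendsto (fun τ : ℝ => (√τ)⁻¹ • (a τ - τ • b)) atTop (𝓝 A)) :
    Tendsto (fun τ : ℝ => τ ^ (((d : ℝ) - 1) / 2) •
      fourierInt (fun t => ψ t / drifted F b t) (a τ)) atTop
      (𝓝 (∫ x : ℝ, fourierInt (fun y => ψ 0 * Complex.exp (-((Q y / 2 : ℝ) : ℂ)))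
        (A - x • b))) := by
  have he : ‖‖b‖⁻¹ • b‖ = 1 := by
    rw [norm_smul, norm_inv, norm_norm, inv_mul_cancel₀ (norm_ne_zero_iff.mpr hb)]
  obtain ⟨C, hC, hdecay⟩ := exists_norm_fourierInt_damped_le hm hmk hr hρ hρ1 hρr he hc hK hψ hF
  obtain ⟨h1, h2⟩ := tendsto_integral_laplaceTerm_Ioi hd hm hr hc hK hψ hF hQ hb hC hdecay ha
  have h3 := tendsto_integral_laplaceTerm_small hm hmd hb hC hdecay ha
  have h4 := h3.add h2
  rw [zero_add] at h4
  refine h4.congr' ?_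
  filter_upwards [h1, eventually_gt_atTop 0] with τ hτ hτ0
  have hsmall : IntegrableOn (laplaceTerm ψ F b (a τ)) (Set.Ioc 0 (τ / 2)) := by
    refine Measure.integrableOn_of_bounded (M := C) measure_Ioc_lt_top.ne
      (stronglyMeasurable_laplaceTerm hr hψ hF b (a τ)).aestronglyMeasurable ?_
    refine (ae_restrict_iff' measurableSet_Ioc).mpr (Eventually.of_forall fun u hu => ?_)
    refine ((hdecay u hu.1.le _).1).trans (mul_le_of_le_one_right hC ?_)
    exact Real.rpow_le_one_of_one_le_of_nonpos (by linarith [hu.1]) (by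
      have : (0 : ℝ) ≤ d := Nat.cast_nonneg d
      linarith)
  have hall : IntegrableOn (laplaceTerm ψ F b (a τ)) (Set.Ioi 0) := by
    rw [← Set.Ioc_union_Ioi_eq_Ioi (by positivity : (0 : ℝ) ≤ τ / 2)]
    exact hsmall.union hτ
  have h5 := intervalIntegral_tendsto_integral_Ioi 0 hall tendsto_id
  have h6 := tendsto_nhds_unique h5
    (tendsto_intervalIntegral_fourierInt_damped hc hr hψ hF b (a τ) hint)
  rw [← h6, ← smul_add, intervalIntegral.integral_of_le (by positivity),
    ← setIntegral_union Set.Ioc_disjoint_Ioi_same measurableSet_Ioi hsmall hτ,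
    Set.Ioc_union_Ioi_eq_Ioi (by positivity)]

end

section

/-! ### The Gaussian integral -/

variable {d : ℕ} {Sig : Matrix (Fin d) (Fin d) ℝ}

theorem invSqrt_mul_mul_invSqrt (h : Sig.PosDef) : invSqrt Sig * Sig * invSqrt Sig = 1 := by
  have hdet : IsUnit Sig.det := h.det_pos.ne'.isUnit
  have h1 : invSqrt Sig * (invSqrt Sig * Sig) = 1 := by
    rw [← mul_assoc, invSqrt_mul_self h, Matrix.nonsing_inv_mul _ hdet]
  exact mul_eq_one_comm.mp h1

theorem invSqrt_det_pos (h : Sig.PosDef) : 0 < (invSqrt Sig).det := by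
  refine lt_of_le_of_ne (invSqrt_posSemidef Sig).det_nonneg fun h0 => ?_
  have := congrArg Matrix.det (invSqrt_mul_mul_invSqrt h)
  rw [Matrix.det_mul, Matrix.det_mul, ← h0] at this
  simp at this

/-- The linear map `Σ^{-1/2}`. -/
def invSqrtCLM (Sig : Matrix (Fin d) (Fin d) ℝ) : Rd d →L[ℝ] Rd d :=
  Matrix.toEuclideanCLM (𝕜 := ℝ) (invSqrt Sig)

theorem inner_invSqrtCLM (x y : Rd d) :
    ⟪invSqrtCLM Sig x, y⟫ = ⟪x, invSqrtCLM Sig y⟫ := by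
  have h : IsSelfAdjoint (invSqrtCLM Sig) :=
    ((invSqrt_posSemidef Sig).isHermitian.isSelfAdjoint).map (Matrix.toEuclideanCLM (𝕜 := ℝ))
  conv_lhs => rw [← h.adjoint_eq]
  exact ContinuousLinearMap.adjoint_inner_left _ _ _

theorem quadForm_invSqrtCLM (h : Sig.PosDef) (z : Rd d) :
    ⟪invSqrtCLM Sig z, Matrix.toEuclideanCLM (𝕜 := ℝ) Sig (invSqrtCLM Sig z)⟫ = ‖z‖ ^ 2 := by
  rw [inner_invSqrtCLM, ← real_inner_self_eq_norm_sq]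
  congr 1
  have := congrArg (Matrix.toEuclideanCLM (𝕜 := ℝ)) (invSqrt_mul_mul_invSqrt h)
  rw [map_mul, map_mul, map_one] at this
  exact congrArg (fun T : Rd d →L[ℝ] Rd d => T z) this

theorem invSqrtCLM_injective (h : Sig.PosDef) : Function.Injective (invSqrtCLM Sig) := by
  refine (injective_iff_map_eq_zero _).mpr fun z hz => ?_
  have := quadForm_invSqrtCLM h z
  rw [hz] at this
  simpa using this.symm

theorem det_invSqrtCLM : (invSqrtCLM Sig).det = (invSqrt Sig).det := by
  rw [ContinuousLinearMap.det, invSqrtCLM, Matrix.coe_toEuclideanCLM_eq_toEuclideanLin,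
    Matrix.toEuclideanLin_eq_toLin_orthonormal, LinearMap.det_toLin]

/-- The Fourier transform of a Gaussian density, by the substitution `y = Σ^{-1/2} z`. -/
theorem fourierInt_gaussian (h : Sig.PosDef) (w : Rd d) :
    fourierInt (fun y => Complex.exp
      (-((⟪y, Matrix.toEuclideanCLM (𝕜 := ℝ) Sig y⟫ / 2 : ℝ) : ℂ))) w =
      (((2 * Real.pi) ^ ((d : ℝ) / 2) * (invSqrt Sig).det *
        Real.exp (-(‖invSqrtCLM Sig w‖ ^ 2 / 2)) : ℝ) : ℂ) := by
  set T := invSqrtCLM Sig with hT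
  have hinj := invSqrtCLM_injective h
  have hsurj : Function.Surjective T := LinearMap.surjective_of_injective (f := T.toLinearMap) hinj
  have hcv := integral_image_eq_integral_abs_det_fderiv_smul (volume : Measure (Rd d))
    MeasurableSet.univ (f := T) (f' := fun _ => T)
    (fun x _ => T.hasFDerivAt.hasFDerivWithinAt) hinj.injOn
    (fun y => Complex.exp (-((⟪y, Matrix.toEuclideanCLM (𝕜 := ℝ) Sig y⟫ / 2 : ℝ) : ℂ)) *
      Complex.exp (-Complex.I * ((⟪y, w⟫ : ℝ) : ℂ)))
  rw [Set.image_univ, hsurj.range_eq, setIntegral_univ, setIntegral_univ, integral_smul,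
    det_invSqrtCLM, abs_of_pos (invSqrt_det_pos h)] at hcv
  rw [fourierInt, hcv]
  have hG := GaussianFourier.integral_cexp_neg_mul_sq_norm_add (V := Rd d) (b := 1 / 2)
    (by norm_num) (-Complex.I) (T w)
  have hcongr : ∫ z : Rd d, Complex.exp (-((⟪T z, Matrix.toEuclideanCLM (𝕜 := ℝ) Sig (T z)⟫ / 2 :
      ℝ) : ℂ)) * Complex.exp (-Complex.I * ((⟪T z, w⟫ : ℝ) : ℂ)) =
      ∫ z : Rd d, Complex.exp (-(1 / 2) * ‖z‖ ^ 2 + -Complex.I * ⟪T w, z⟫) := by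
    congr 1
    ext z
    rw [quadForm_invSqrtCLM h, ← Complex.exp_add, inner_invSqrtCLM, real_inner_comm]
    congr 2
    push_cast
    ring
  rw [hcongr, hG, finrank_euclideanSpace, Fintype.card_fin, Complex.real_smul]
  push_cast
  rw [Complex.ofReal_cpow (by positivity)]
  push_cast
  have e1 : (Real.pi : ℂ) / (1 / 2) = 2 * Real.pi := by ring
  have e2 : (-Complex.I) ^ 2 * (‖T w‖ : ℂ) ^ 2 / (4 * (1 / 2)) = -((‖T w‖ : ℂ) ^ 2 / 2) := by
    rw [neg_sq, Complex.I_sq]; ring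
  rw [e1, e2]
  ring

theorem integral_exp_neg_norm_sq_line {V : Type*} [NormedAddCommGroup V] [InnerProductSpace ℝ V]
    (p q : V) (hq : q ≠ 0) :
    ∫ x : ℝ, Real.exp (-(‖p - x • q‖ ^ 2 / 2)) =
      (2 * Real.pi) ^ ((1 : ℝ) / 2) / ‖q‖ *
        Real.exp ((⟪q, p⟫ ^ 2 - ‖q‖ ^ 2 * ‖p‖ ^ 2) / (2 * ‖q‖ ^ 2)) := by
  have hq0 : 0 < ‖q‖ := norm_pos_iff.mpr hq
  have hpt : ∀ x : ℝ, Real.exp (-(‖p - x • q‖ ^ 2 / 2)) =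
      Real.exp ((⟪q, p⟫ ^ 2 - ‖q‖ ^ 2 * ‖p‖ ^ 2) / (2 * ‖q‖ ^ 2)) *
        Real.exp (-(‖q‖ ^ 2 / 2) * (x - ⟪q, p⟫ / ‖q‖ ^ 2) ^ 2) := fun x => by
    rw [← Real.exp_add, norm_sub_sq_real, inner_smul_right, norm_smul, mul_pow, Real.norm_eq_abs,
      sq_abs, real_inner_comm]
    congr 1
    field_simp
    ring
  simp only [hpt]
  rw [integral_const_mul, integral_sub_right_eq_self
    (fun x : ℝ => Real.exp (-(‖q‖ ^ 2 / 2) * x ^ 2)), integral_gaussian, mul_comm]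
  congr 1
  rw [show Real.pi / (‖q‖ ^ 2 / 2) = 2 * Real.pi / ‖q‖ ^ 2 by field_simp,
    Real.sqrt_div (by positivity), Real.sqrt_sq hq0.le, Real.sqrt_eq_rpow]

/-- The limit constant: integrating the Gaussian over the line `A - ℝ b`. -/
theorem integral_fourierInt_gaussian (h : Sig.PosDef) {b : Rd d} (hb : b ≠ 0) (A : Rd d) (z : ℂ) :
    ∫ x : ℝ, fourierInt (fun y => z * Complex.exp
      (-((⟪y, Matrix.toEuclideanCLM (𝕜 := ℝ) Sig y⟫ / 2 : ℝ) : ℂ))) (A - x • b) =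
      z * (((2 * Real.pi) ^ (((d : ℝ) + 1) / 2) * ((invSqrt Sig).det / ‖invSqrtCLM Sig b‖ *
        Real.exp ((⟪invSqrtCLM Sig b, invSqrtCLM Sig A⟫ ^ 2 -
          ‖invSqrtCLM Sig b‖ ^ 2 * ‖invSqrtCLM Sig A‖ ^ 2) / (2 * ‖invSqrtCLM Sig b‖ ^ 2))) :
          ℝ) : ℂ) := by
  have hTb : invSqrtCLM Sig b ≠ 0 := fun h0 =>
    hb (invSqrtCLM_injective h (by rw [h0, map_zero]))
  have h1 : ∀ w : Rd d, fourierInt (fun y => z * Complex.exp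
      (-((⟪y, Matrix.toEuclideanCLM (𝕜 := ℝ) Sig y⟫ / 2 : ℝ) : ℂ))) w =
      z * (((2 * Real.pi) ^ ((d : ℝ) / 2) * (invSqrt Sig).det *
        Real.exp (-(‖invSqrtCLM Sig w‖ ^ 2 / 2)) : ℝ) : ℂ) := fun w => by
    rw [← fourierInt_gaussian h, fourierInt, fourierInt, ← integral_const_mul]
    simp only [mul_assoc]
  simp only [h1]
  rw [integral_const_mul, integral_complex_ofReal, integral_const_mul]
  simp only [map_sub, map_smul]
  rw [integral_exp_neg_norm_sq_line _ _ hTb]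
  congr 2
  rw [add_div, Real.rpow_add (by positivity)]
  ring

end

section

/-! ### Integrability of the singularity -/

variable {d : ℕ}

theorem integrable_indicator_norm_rpow {p : ℝ} (hp : p < 1) (r : ℝ) :
    Integrable ((ball (0 : ℝ) r).indicator fun x => ‖x‖ ^ (-p)) := by
  rw [integrable_indicator_iff measurableSet_ball]
  refine integrableOn_ball_of_norm_le_rpow (C := 1) (α := p) (by simp) (by simpa using hp)
    (Eventually.of_forall fun x => ?_) (measurable_norm.pow_const _).aestronglyMeasurable
  rw [Real.norm_of_nonneg (by positivity), one_mul]

theorem ae_inner_ne_zero {v : Rd d} (hv : v ≠ 0) : ∀ᵐ t : Rd d, ⟪v, t⟫ ≠ 0 := by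
  have h := Measure.addHaar_submodule (volume : Measure (Rd d))
    (LinearMap.ker (innerSL ℝ v).toLinearMap)
    (fun htop => hv (by
      have : v ∈ LinearMap.ker (innerSL ℝ v).toLinearMap := by rw [htop]; trivial
      simpa using this))
  rw [ae_iff]
  refine (le_of_eq (congrArg _ ?_)).trans h.le |>.antisymm bot_le
  ext t
  simp

/-- In dimension at least two, a function that is bounded below by `|⟨b, t⟩|` and by `‖t‖ ^ 2` has
an integrable inverse near `0`: in orthonormal coordinates `(s, y, …)` with `s` along `b` the
inverse is `O(|s| ^ (-3/4) |y| ^ (-1/2))`. -/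
theorem integrable_div_of_le (hd : 2 ≤ d) {ψ D : Rd d → ℂ} {b : Rd d} (hb : b ≠ 0)
    {r c₁ c₂ M : ℝ} (hc₁ : 0 < c₁) (hc₂ : 0 < c₂) (hM : 0 ≤ M) (hψ : ∀ t, ‖ψ t‖ ≤ M)
    (hψ0 : ∀ t, r ≤ ‖t‖ → ψ t = 0)
    (h₁ : ∀ t, ‖t‖ < r → c₁ * |⟪b, t⟫| ≤ ‖D t‖) (h₂ : ∀ t, ‖t‖ < r → c₂ * ‖t‖ ^ 2 ≤ ‖D t‖)
    (hmeas : AEStronglyMeasurable (fun t => ψ t / D t)) :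
    Integrable fun t => ψ t / D t := by
  have hb0 : 0 < ‖b‖ := norm_pos_iff.mpr hb
  set i₀ : Fin d := ⟨0, by omega⟩ with hi₀
  set i₁ : Fin d := ⟨1, by omega⟩ with hi₁
  have hne : i₀ ≠ i₁ := by simp [hi₀, hi₁]
  have horth : Orthonormal ℝ (({i₀} : Set (Fin d)).domRestrict fun _ => ‖b‖⁻¹ • b) := by
    refine ⟨fun i => ?_, fun i j hij => absurd (Subsingleton.elim i j) hij⟩
    simp [norm_smul, hb0.ne']
  obtain ⟨B, hB⟩ := horth.exists_orthonormalBasis_extension_of_card_eq (by simp)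
  have hB0 : B i₀ = ‖b‖⁻¹ • b := hB i₀ rfl
  set q : Fin d → ℝ := fun i => if i = i₀ then 3 / 4 else if i = i₁ then 1 / 2 else 0 with hq
  have hq0 : q i₀ = 3 / 4 := by simp [hq]
  have hq1 : q i₁ = 1 / 2 := by simp [hq, hne.symm]
  set φ : (Fin d → ℝ) → ℝ := fun x =>
    ∏ i, (ball (0 : ℝ) r).indicator (fun y => ‖y‖ ^ (-q i)) (x i) with hφ
  have hφI : Integrable φ := Integrable.fintype_prod_dep fun i => by
    refine integrable_indicator_norm_rpow ?_ r
    simp only [hq]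
    split_ifs <;> norm_num
  have hmp : MeasurePreserving (fun t : Rd d => WithLp.ofLp (B.repr t)) :=
    (PiLp.volume_preserving_ofLp (Fin d)).comp B.measurePreserving_repr
  have hφT : Integrable fun t : Rd d => φ (WithLp.ofLp (B.repr t)) :=
    hmp.integrable_comp_of_integrable hφI
  have hco : ∀ t i, (B.repr t) i = ⟪B i, t⟫ := fun t i => B.repr_apply_apply t i
  have hae0 := ae_inner_ne_zero (v := B i₀) (B.orthonormal.ne_zero i₀)
  have hae1 := ae_inner_ne_zero (v := B i₁) (B.orthonormal.ne_zero i₁)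
  set κ : ℝ := (c₁ * ‖b‖) ^ (3 / 4 : ℝ) * c₂ ^ (1 / 4 : ℝ) with hκ
  have hκ0 : 0 < κ := by positivity
  refine (hφT.const_mul (M * κ⁻¹)).mono' hmeas ?_
  filter_upwards [hae0, hae1] with t ht0 ht1
  have hφ0 : 0 ≤ φ (WithLp.ofLp (B.repr t)) := Finset.prod_nonneg fun i _ =>
    Set.indicator_nonneg (fun y _ => by positivity) _
  rcases le_or_gt r ‖t‖ with hr | hr
  · rw [hψ0 t hr, zero_div, norm_zero]
    positivity
  · have hci : ∀ i, |⟪B i, t⟫| ≤ ‖t‖ := fun i => by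
      simpa [B.orthonormal.1 i] using abs_real_inner_le_norm (B i) t
    have hmem : ∀ i, (B.repr t) i ∈ ball (0 : ℝ) r := fun i => by
      rw [mem_ball_zero_iff, hco, Real.norm_eq_abs]
      exact (hci i).trans_lt hr
    have hφt : φ (WithLp.ofLp (B.repr t)) =
        |⟪B i₀, t⟫| ^ (-(3 / 4) : ℝ) * |⟪B i₁, t⟫| ^ (-(1 / 2) : ℝ) := by
      simp only [hφ]
      rw [Finset.prod_congr rfl fun i _ => Set.indicator_of_mem (hmem i) _,
        Finset.prod_eq_mul i₀ i₁ hne]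
      · rw [hq0, hq1, hco, hco, Real.norm_eq_abs, Real.norm_eq_abs]
      · intro i _ hi
        simp [hq, hi.1, hi.2]
      · simp
      · simp
    set s := |⟪B i₀, t⟫| with hs
    set y := |⟪B i₁, t⟫| with hy
    have hs0 : 0 < s := abs_pos.mpr ht0
    have hy0 : 0 < y := abs_pos.mpr ht1
    have hD1 : c₁ * ‖b‖ * s ≤ ‖D t‖ := by
      refine le_trans (le_of_eq ?_) (h₁ t hr)
      rw [hs, hB0, inner_smul_left, conj_trivial, abs_mul, abs_of_pos (inv_pos.mpr hb0)]
      field_simp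
    have hD2 : c₂ * y ^ 2 ≤ ‖D t‖ := by
      refine le_trans ?_ (h₂ t hr)
      gcongr
      exact hci i₁
    have hD0 : 0 < ‖D t‖ := lt_of_lt_of_le (by positivity) hD2
    have hDlow : κ * (s ^ (3 / 4 : ℝ) * y ^ (1 / 2 : ℝ)) ≤ ‖D t‖ := by
      have e1 : ‖D t‖ = ‖D t‖ ^ (3 / 4 : ℝ) * ‖D t‖ ^ (1 / 4 : ℝ) := by
        rw [← Real.rpow_add hD0]; norm_num
      have e2 : κ * (s ^ (3 / 4 : ℝ) * y ^ (1 / 2 : ℝ)) =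
          (c₁ * ‖b‖ * s) ^ (3 / 4 : ℝ) * (c₂ * y ^ 2) ^ (1 / 4 : ℝ) := by
        rw [Real.mul_rpow (by positivity) hs0.le, Real.mul_rpow hc₂.le (by positivity),
          ← Real.rpow_natCast y 2, ← Real.rpow_mul hy0.le, hκ]
        norm_num
        ring
      rw [e1, e2]
      gcongr
    rw [hφt, norm_div, Real.rpow_neg hs0.le, Real.rpow_neg hy0.le, mul_assoc, ← mul_inv,
      ← mul_inv, ← div_eq_mul_inv]
    exact div_le_div₀ hM (hψ t) (by positivity) hDlow

end

section

/-! ### Decay of smooth contributions -/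

variable {d : ℕ}

/-- The product of a smooth compactly supported function and of a function of class `C_b^m` near
its support has uniform jets at all points, whether or not they belong to `O`. -/
theorem exists_hasJet_mul {m : ℝ} (hm : 0 < m) {O : Set (Rd d)} (hO : IsOpen O) {g H : Rd d → ℂ}
    (hg : ContDiff ℝ (⊤ : ℕ∞) g) (hgc : HasCompactSupport g) (hH : IsCbm m O H)
    (hgO : tsupport g ⊆ O) :
    ∃ ρ K : ℝ, 0 < ρ ∧ ρ ≤ 1 ∧ 0 ≤ K ∧ ∀ ρ' : ℝ, 0 ≤ ρ' → ρ' ≤ ρ → ∀ t e : Rd d, ‖e‖ = 1 →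
      HasJet ⌊m⌋₊ m K (fun σ => g (t + (ρ' * σ) • e) * H (t + (ρ' * σ) • e)) := by
  obtain ⟨K₁, hK₁⟩ := exists_hasJet_of_hasCompactSupport hm hg hgc
  obtain ⟨K₂, hK₂⟩ := hH.exists_hasJet hm hO
  obtain ⟨δ, hδ, hthick⟩ := hgc.exists_thickening_subset_open hO hgO
  have hmk : m ≤ ((⌊m⌋₊ : ℕ) : ℝ) + 1 := (Nat.lt_floor_add_one m).le
  refine ⟨min 1 (δ / 3), |4 * ((⌊m⌋₊ : ℝ) + 2) ^ 2 * K₁ * K₂|, by positivity, min_le_left _ _,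
    abs_nonneg _, fun ρ hρ0 hρ t e he => ?_⟩
  have hρ1 : ρ ≤ 1 := hρ.trans (min_le_left _ _)
  have hρδ : ρ ≤ δ / 3 := hρ.trans (min_le_right _ _)
  by_cases hz : ∀ s : ℝ, |s| ≤ ρ → g (t + s • e) = 0
  · refine ((hasJet_const (k := ⌊m⌋₊) (m := m) 0).congr (fun σ hσ => ?_)).mono
      (by rw [norm_zero]; exact abs_nonneg _)
    rw [hz _ (by rw [abs_mul, abs_of_nonneg hρ0]; exact mul_le_of_le_one_right hρ0 hσ), zero_mul]
  · push Not at hz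
    obtain ⟨s₀, hs₀, hgs⟩ := hz
    refine (HasJet.mul hm hmk (hK₁ t e he ρ hρ0 hρ1) (hK₂ t e he ρ hρ0 hρ1 fun s hs => ?_)).mono
      (le_abs_self _)
    -- the whole segment is close to a point of the support
    refine hthick (Metric.mem_thickening_iff.mpr
      ⟨t + s₀ • e, subset_tsupport _ hgs, ?_⟩)
    rw [dist_add_left, dist_eq_norm, ← sub_smul, norm_smul, he, mul_one, Real.norm_eq_abs]
    have := abs_sub s s₀
    linarith

theorem continuous_mul_of_isCbm {m : ℝ} {O : Set (Rd d)} (hO : IsOpen O) {g H : Rd d → ℂ}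
    (hg : Continuous g) (hH : IsCbm m O H) (hgO : tsupport g ⊆ O) :
    Continuous fun t => g t * H t := by
  refine continuous_iff_continuousAt.mpr fun t => ?_
  by_cases ht : t ∈ O
  · exact hg.continuousAt.mul (hH.contDiffOn.continuousOn.continuousAt (hO.mem_nhds ht))
  · have h0 : g =ᶠ[𝓝 t] 0 := notMem_tsupport_iff_eventuallyEq.mp fun h => ht (hgO h)
    refine (continuousAt_const (y := (0 : ℂ))).congr ?_
    filter_upwards [h0] with x hx
    simp [hx]

/-- The simplest phase, for amplitudes that are not damped. -/
theorem isPhase_norm_sq {k : ℕ} (hk : 2 ≤ k) {m r ρ : ℝ} (hr : 0 < r) {e : Rd d}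
    (he : ‖e‖ = 1) :
    IsPhase k m r ρ 1 (4 * r ^ 2 + 4 * r + 2) e (fun t => ((‖t‖ ^ 2 : ℝ) : ℂ)) where
  continuousOn := by fun_prop
  re_ge t _ := by rw [one_mul, Complex.ofReal_re]
  taylor t ht := by
    refine ⟨fun j => if j = 0 then ((‖t‖ ^ 2 : ℝ) : ℂ) else if j = 1 then ((2 * ⟪t, e⟫ : ℝ) : ℂ)
      else if j = 2 then 1 else 0, by simp, ?_, fun j _ => ?_, fun s _ => ?_⟩
    · have h1 : |⟪t, e⟫| ≤ ‖t‖ := by simpa [he] using abs_real_inner_le_norm t e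
      simp only [one_ne_zero, if_false, if_true]
      rw [Complex.norm_real, Real.norm_eq_abs, abs_mul, abs_two]
      have h2 : 2 ≤ 4 * r ^ 2 + 4 * r + 2 := by nlinarith
      nlinarith [norm_nonneg t]
    · have h1 : |⟪t, e⟫| ≤ ‖t‖ := by simpa [he] using abs_real_inner_le_norm t e
      dsimp only
      split_ifs
      · rw [Complex.norm_real, Real.norm_eq_abs, abs_of_nonneg (by positivity)]
        nlinarith [norm_nonneg t]
      · rw [Complex.norm_real, Real.norm_eq_abs, abs_mul, abs_two]
        nlinarith [norm_nonneg t]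
      · rw [norm_one]; nlinarith
      · rw [norm_zero]; positivity
    · have hsum : ∑ j ∈ Finset.range (k + 1), (if j = 0 then ((‖t‖ ^ 2 : ℝ) : ℂ) else
          if j = 1 then ((2 * ⟪t, e⟫ : ℝ) : ℂ) else if j = 2 then 1 else 0) * (s : ℂ) ^ j =
          ((‖t + s • e‖ ^ 2 : ℝ) : ℂ) := by
        rw [← Finset.sum_subset (Finset.range_subset_range.mpr (show 3 ≤ k + 1 by omega))]
        · rw [norm_add_sq_real, inner_smul_right, norm_smul, he, mul_one, Real.norm_eq_abs, sq_abs]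
          simp [Finset.sum_range_succ]
          ring
        · intro j _ hj
          have : 3 ≤ j := by simpa using hj
          rw [if_neg (by omega), if_neg (by omega), if_neg (by omega), zero_mul]
      rw [hsum, sub_self, norm_zero]
      positivity

theorem eventually_inner_path_ge {a : ℝ → Rd d} {b A : Rd d} (hb : b ≠ 0)
    (ha : Tendsto (fun τ : ℝ => (√τ)⁻¹ • (a τ - τ • b)) atTop (𝓝 A)) :
    ∀ᶠ τ : ℝ in atTop, τ * ‖b‖ / 2 ≤ ⟪a τ, ‖b‖⁻¹ • b⟫ := by
  have hb0 : 0 < ‖b‖ := norm_pos_iff.mpr hb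
  have he : ‖‖b‖⁻¹ • b‖ = 1 := by
    rw [norm_smul, norm_inv, norm_norm, inv_mul_cancel₀ hb0.ne']
  filter_upwards [ha.norm.eventually_le_const (show ‖A‖ < ‖A‖ + 1 by linarith),
    Real.tendsto_sqrt_atTop.eventually_ge_atTop (2 * (‖A‖ + 1) / ‖b‖), eventually_gt_atTop 0]
    with τ h1 h2 hτ
  have hsq0 : 0 < √τ := Real.sqrt_pos.mpr hτ
  have hsq : √τ * √τ = τ := Real.mul_self_sqrt hτ.le
  have h3 : a τ = √τ • ((√τ)⁻¹ • (a τ - τ • b)) + τ • b := by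
    rw [smul_inv_smul₀ hsq0.ne']; abel
  have h4 : |⟪(√τ)⁻¹ • (a τ - τ • b), ‖b‖⁻¹ • b⟫| ≤ ‖A‖ + 1 := by
    refine (abs_real_inner_le_norm _ _).trans ?_
    rw [he, mul_one]; exact h1
  have h5 : ⟪a τ, ‖b‖⁻¹ • b⟫ =
      √τ * ⟪(√τ)⁻¹ • (a τ - τ • b), ‖b‖⁻¹ • b⟫ + τ * ‖b‖ := by
    conv_lhs => rw [h3]
    rw [inner_add_left, inner_smul_left, inner_smul_left b _ τ, inner_smul_right b b,
      real_inner_self_eq_norm_sq]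
    simp only [conj_trivial]
    field_simp
  rw [h5]
  have h6 := mul_le_mul_of_nonneg_left (neg_le_of_abs_le h4) hsq0.le
  rw [div_le_iff₀ hb0] at h2
  nlinarith [mul_le_mul_of_nonneg_left h2 hsq0.le]

/-- A contribution of class `C^m` with compact support is negligible when `m > (d - 1) / 2`. -/
theorem tendsto_fourierInt_smooth {m : ℝ} (hm : 2 ≤ m) (hmd : ((d : ℝ) - 1) / 2 < m)
    {O : Set (Rd d)} (hO : IsOpen O) {g H : Rd d → ℂ}
    (hg : ContDiff ℝ (⊤ : ℕ∞) g) (hgc : HasCompactSupport g) (hH : IsCbm m O H)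
    (hgO : tsupport g ⊆ O) {a : ℝ → Rd d} {b A : Rd d} (hb : b ≠ 0)
    (ha : Tendsto (fun τ : ℝ => (√τ)⁻¹ • (a τ - τ • b)) atTop (𝓝 A)) :
    Tendsto (fun τ : ℝ => τ ^ (((d : ℝ) - 1) / 2) • fourierInt (fun t => g t * H t) (a τ)) atTop
      (𝓝 0) := by
  have hb0 : 0 < ‖b‖ := norm_pos_iff.mpr hb
  have he : ‖‖b‖⁻¹ • b‖ = 1 := by
    rw [norm_smul, norm_inv, norm_norm, inv_mul_cancel₀ hb0.ne']
  have hm0 : 0 < m := by linarith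
  obtain ⟨ρ, K, hρ, hρ1, hK, hjet⟩ := exists_hasJet_mul hm0 hO hg hgc hH hgO
  obtain ⟨r₀, hr₀⟩ := hgc.isBounded.subset_closedBall (0 : Rd d)
  set r : ℝ := |r₀| + 1 with hr
  have hr1 : 1 ≤ r := by rw [hr]; linarith [abs_nonneg r₀]
  set K' : ℝ := max K (4 * r ^ 2 + 4 * r + 2) with hK'
  have hψ : IsAmplitude ⌊m⌋₊ m r ρ K' (‖b‖⁻¹ • b) (fun t => g t * H t) :=
    { continuous := continuous_mul_of_isCbm hO hg.continuous hH hgO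
      eq_zero := fun t ht => by
        have : t ∉ tsupport g := fun h => by
          have := hr₀ h
          rw [mem_closedBall, dist_zero_right] at this
          linarith [le_abs_self r₀]
        rw [image_eq_zero_of_notMem_tsupport this, zero_mul]
      hasJet := fun t _ => (hjet ρ hρ.le le_rfl t _ he).mono (le_max_left _ _) }
  have hF0 := isPhase_norm_sq (d := d) (k := ⌊m⌋₊) (m := m) (ρ := ρ)
    (Nat.le_floor (by simpa using hm)) (by linarith : 0 < r) he
  have hF : IsPhase ⌊m⌋₊ m r ρ 1 K' (‖b‖⁻¹ • b) (fun t : Rd d => ((‖t‖ ^ 2 : ℝ) : ℂ)) :=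
    hF0.mono (le_max_right _ _)
  obtain ⟨C, hC, hdecay⟩ := exists_norm_fourierInt_damped_le hm (Nat.lt_floor_add_one m).le
    (by linarith) hρ hρ1 (hρ1.trans hr1) he one_pos (hK.trans (le_max_left _ _)) hψ hF
  have hlim : Tendsto (fun τ : ℝ => C * (2 / ‖b‖) ^ m * τ ^ (-(m - ((d : ℝ) - 1) / 2))) atTop
      (𝓝 0) := by
    simpa using (tendsto_rpow_neg_atTop (sub_pos.mpr hmd)).const_mul (C * (2 / ‖b‖) ^ m)
  refine squeeze_zero_norm' ?_ hlim
  filter_upwards [eventually_inner_path_ge hb ha, eventually_gt_atTop 0] with τ hτ hτ0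
  have hlow : 0 < τ * ‖b‖ / 2 := by positivity
  -- at `u = 0` there is no damping, and the phase plays no role
  have h1 := (hdecay 0 le_rfl (a τ)).2 (hlow.trans_le hτ).ne'
  have h2 : damped (fun t => g t * H t) (fun t : Rd d => ((‖t‖ ^ 2 : ℝ) : ℂ)) 0 =
      fun t => g t * H t := by
    ext t; simp [damped]
  rw [h2, add_zero, Real.one_rpow, mul_one, Real.sqrt_one] at h1
  rw [norm_smul, Real.norm_of_nonneg (by positivity)]
  calc _ ≤ τ ^ (((d : ℝ) - 1) / 2) * (C * (1 / |⟪a τ, ‖b‖⁻¹ • b⟫|) ^ m) := by gcongr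
    _ ≤ τ ^ (((d : ℝ) - 1) / 2) * (C * (2 / ‖b‖ * τ⁻¹) ^ m) := by
        have : 1 / |⟪a τ, ‖b‖⁻¹ • b⟫| ≤ 2 / ‖b‖ * τ⁻¹ := by
          rw [show 2 / ‖b‖ * τ⁻¹ = 1 / (τ * ‖b‖ / 2) by field_simp]
          exact one_div_le_one_div_of_le hlow (hτ.trans (le_abs_self _))
        gcongr
    _ = C * (2 / ‖b‖) ^ m * (τ ^ (((d : ℝ) - 1) / 2) * τ ^ (-m)) := by
        rw [Real.mul_rpow (by positivity) (by positivity), Real.inv_rpow hτ0.le,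
          Real.rpow_neg hτ0.le]
        ring
    _ = _ := by rw [← Real.rpow_add hτ0]; congr 2; ring

end

section

/-! ### The phase attached to the dominating eigenvalue -/

variable {d : ℕ}

theorem exists_quadForm_ge {Sig : Matrix (Fin d) (Fin d) ℝ} (h : Sig.PosDef) :
    ∃ c : ℝ, 0 < c ∧ ∀ t : Rd d, c * ‖t‖ ^ 2 ≤ ⟪t, Matrix.toEuclideanCLM (𝕜 := ℝ) Sig t⟫ := by
  refine ⟨(‖invSqrtCLM Sig‖ ^ 2 + 1)⁻¹, by positivity, fun t => ?_⟩
  obtain ⟨z, rfl⟩ := LinearMap.surjective_of_injective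
    (f := (invSqrtCLM Sig).toLinearMap) (invSqrtCLM_injective h) t
  change _ * ‖invSqrtCLM Sig z‖ ^ 2 ≤ ⟪invSqrtCLM Sig z, Matrix.toEuclideanCLM (𝕜 := ℝ) Sig
    (invSqrtCLM Sig z)⟫
  rw [quadForm_invSqrtCLM h, inv_mul_le_iff₀ (by positivity)]
  calc ‖invSqrtCLM Sig z‖ ^ 2 ≤ (‖invSqrtCLM Sig‖ * ‖z‖) ^ 2 := by
        gcongr; exact (invSqrtCLM Sig).le_opNorm z
    _ ≤ _ := by rw [mul_pow]; nlinarith [sq_nonneg ‖z‖]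

/-- `1 - λ`, freed from its first-order term. -/
def eigenPhase (lam : Rd d → ℂ) (b t : Rd d) : ℂ :=
  1 - lam t + Complex.I * ((⟪t, b⟫ : ℝ) : ℂ)

theorem drifted_eigenPhase (lam : Rd d → ℂ) (b t : Rd d) :
    drifted (eigenPhase lam b) b t = 1 - lam t := by
  rw [drifted, eigenPhase]; ring

variable {lam : Rd d → ℂ} {b : Rd d} {Sig : Matrix (Fin d) (Fin d) ℝ}

theorem sum_smul_single (t : Rd d) :
    ∑ j, t j • EuclideanSpace.single j (1 : ℝ) = t := by
  simpa using (EuclideanSpace.basisFun (Fin d) ℝ).sum_repr t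

theorem fderiv_eigenvalue
    (hmean : ∀ j : Fin d,
      ((b j : ℝ) : ℂ) = -Complex.I * fderiv ℝ lam 0 (EuclideanSpace.single j (1 : ℝ))) (t : Rd d) :
    fderiv ℝ lam 0 t = Complex.I * ((⟪t, b⟫ : ℝ) : ℂ) := by
  have h1 : ∀ j, fderiv ℝ lam 0 (EuclideanSpace.single j (1 : ℝ)) = Complex.I * (b j : ℂ) :=
    fun j => by
      rw [hmean j, ← mul_assoc, mul_neg, Complex.I_mul_I, neg_neg, one_mul]
  conv_lhs => rw [← sum_smul_single t]
  rw [map_sum]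
  simp only [map_smul, h1]
  rw [PiLp.inner_apply]
  push_cast
  rw [Finset.mul_sum]
  refine Finset.sum_congr rfl fun j _ => ?_
  simp
  ring

theorem hessian_eigenvalue
    (hsig : ∀ j l : Fin d, ((Sig j l : ℝ) : ℂ) = -iteratedFDeriv ℝ 2 lam 0
      ![EuclideanSpace.single j (1 : ℝ), EuclideanSpace.single l (1 : ℝ)]) (t : Rd d) :
    iteratedFDeriv ℝ 2 lam 0 (fun _ => t) =
      -((⟪t, Matrix.toEuclideanCLM (𝕜 := ℝ) Sig t⟫ : ℝ) : ℂ) := by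
  have h1 : ∀ j l, fderiv ℝ (fderiv ℝ lam) 0 (EuclideanSpace.single j (1 : ℝ))
      (EuclideanSpace.single l (1 : ℝ)) = -(Sig j l : ℂ) := fun j l => by
    rw [hsig j l, neg_neg, iteratedFDeriv_two_apply]
    rfl
  rw [iteratedFDeriv_two_apply, Matrix.inner_toEuclideanCLM]
  conv_lhs => rw [← sum_smul_single t]
  simp only [map_sum, map_smul, sum_apply, smul_apply, h1]
  simp only [dotProduct, Matrix.mulVec, Complex.ofReal_sum, Finset.mul_sum, Complex.ofReal_mul,
    ← Finset.sum_neg_distrib, Complex.real_smul, Finset.smul_sum]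
  rw [Finset.sum_comm]
  refine Finset.sum_congr rfl fun j _ => Finset.sum_congr rfl fun l _ => ?_
  ring

/-- Second-order expansion at `0`. -/
theorem eigenPhase_expansion {R : ℝ} (hR : 0 < R)
    (hlam : ContDiffOn ℝ 2 lam (ball 0 R)) (h0 : lam 0 = 1)
    (hmean : ∀ j : Fin d,
      ((b j : ℝ) : ℂ) = -Complex.I * fderiv ℝ lam 0 (EuclideanSpace.single j (1 : ℝ)))
    (hsig : ∀ j l : Fin d, ((Sig j l : ℝ) : ℂ) = -iteratedFDeriv ℝ 2 lam 0
      ![EuclideanSpace.single j (1 : ℝ), EuclideanSpace.single l (1 : ℝ)])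
    {ε : ℝ} (hε : 0 < ε) :
    ∃ δ : ℝ, 0 < δ ∧ ∀ t : Rd d, ‖t‖ < δ → ‖eigenPhase lam b t -
      ((⟪t, Matrix.toEuclideanCLM (𝕜 := ℝ) Sig t⟫ / 2 : ℝ) : ℂ)‖ ≤ ε * ‖t‖ ^ 2 := by
  have hcont : ContinuousAt (iteratedFDeriv ℝ 2 lam) 0 :=
    (hlam.contDiffAt (isOpen_ball.mem_nhds (mem_ball_self hR))).iteratedFDeriv_right
      (m := 0) (i := 2) (by norm_num) |>.continuousAt
  obtain ⟨δ, hδ, hδε⟩ := Metric.continuousAt_iff.mp hcont ε hε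
  refine ⟨min δ R, lt_min hδ hR, fun t ht => ?_⟩
  have htδ : ‖t‖ < δ := ht.trans_le (min_le_left _ _)
  have htR : ‖t‖ < R := ht.trans_le (min_le_right _ _)
  have hsmall : ∀ s : ℝ, |s| ≤ 1 → ‖(0 : Rd d) + s • t‖ ≤ ‖t‖ := fun s hs => by
    rw [zero_add, norm_smul, Real.norm_eq_abs]
    exact mul_le_of_le_one_left (norm_nonneg _) hs
  have key := norm_sub_lineCoeff_le (k := 2) (f := lam) isOpen_ball
    (by exact_mod_cast hlam) (α := 0) (K := ε * ‖t‖ ^ 2) (ρ := 1) le_rfl (by positivity)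
    (t := 0) (e := t)
    (fun s hs => by rw [mem_ball_zero_iff]; exact (hsmall s hs).trans_lt htR)
    (fun s hs => by
      rw [Real.rpow_zero, mul_one, ← sub_apply]
      refine (ContinuousMultilinearMap.le_opNorm _ _).trans ?_
      have h1 := hδε (x := (0 : Rd d) + s • t) (by
        rw [dist_zero_right]; exact (hsmall s hs).trans_lt htδ)
      rw [dist_eq_norm] at h1
      simpa using mul_le_mul_of_nonneg_right h1.le (sq_nonneg ‖t‖)) (s := 1) (by simp)
  rw [zero_add, one_smul] at key
  simp only [Finset.sum_range_succ, Finset.sum_range_zero, lineCoeff_zero, lineCoeff_one,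
    Complex.ofReal_one, one_pow, mul_one, zero_add, abs_one, Real.one_rpow] at key
  rw [h0, fderiv_eigenvalue hmean, lineCoeff, hessian_eigenvalue hsig] at key
  rw [← norm_neg]
  refine le_trans (le_of_eq (congrArg _ ?_)) key
  rw [eigenPhase]
  push_cast
  simp only [Nat.factorial]
  push_cast
  ring

theorem exists_isPhase_eigenPhase {m R : ℝ} (hm : 2 ≤ m) (hR : 0 < R)
    (hlam : IsCbm m (ball 0 R) lam) (h0 : lam 0 = 1)
    (hmean : ∀ j : Fin d,
      ((b j : ℝ) : ℂ) = -Complex.I * fderiv ℝ lam 0 (EuclideanSpace.single j (1 : ℝ)))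
    (hsig : ∀ j l : Fin d, ((Sig j l : ℝ) : ℂ) = -iteratedFDeriv ℝ 2 lam 0
      ![EuclideanSpace.single j (1 : ℝ), EuclideanSpace.single l (1 : ℝ)])
    (hpos : Sig.PosDef) :
    ∃ r₀ c K : ℝ, 0 < r₀ ∧ r₀ ≤ 1 ∧ 3 * r₀ ≤ R ∧ 0 < c ∧ 0 ≤ K ∧
      (∀ r ρ : ℝ, 0 < r → r ≤ r₀ → 0 < ρ → ρ ≤ r → ∀ e : Rd d, ‖e‖ = 1 →
        IsPhase ⌊m⌋₊ m r ρ c K e (eigenPhase lam b)) ∧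
      ∀ t, ‖t‖ < 2 * r₀ → ‖eigenPhase lam b t‖ ≤ K * ‖t‖ ^ 2 := by
  have hk : 2 ≤ ⌊m⌋₊ := Nat.le_floor (by simpa using hm)
  have hlam2 : ContDiffOn ℝ 2 lam (ball 0 R) := hlam.contDiffOn.of_le (by exact_mod_cast hk)
  obtain ⟨c₀, hc₀, hQ⟩ := exists_quadForm_ge hpos
  obtain ⟨δ, hδ, hexp⟩ := eigenPhase_expansion hR hlam2 h0 hmean hsig (ε := c₀ / 4) (by positivity)
  obtain ⟨K₁, hK₁, htay⟩ := hlam.exists_taylor (by linarith) isOpen_ball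
  obtain ⟨K₂, hK₂⟩ := hlam.bounded 2 hk
  -- the second derivative controls the variation of the first one
  have hlip : ∀ t : Rd d, ‖t‖ < R → ∀ e : Rd d, ‖e‖ = 1 →
      ‖lineCoeff lam t e 1 - lineCoeff lam 0 e 1‖ ≤ |K₂| * ‖t‖ := by
    intro t ht e he
    have h1 := (convex_ball (0 : Rd d) R).norm_image_sub_le_of_norm_fderiv_le (𝕜 := ℝ)
      (f := iteratedFDeriv ℝ 1 lam) (C := |K₂|) (x := 0) (y := t)
      (fun x hx => (hlam2.contDiffAt (isOpen_ball.mem_nhds hx)).differentiableAt_iteratedFDeriv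
        (m := 1) (by norm_num))
      (fun x hx => by
        rw [norm_fderiv_iteratedFDeriv]
        exact (hK₂ x hx).trans (le_abs_self _))
      (mem_ball_self hR) (mem_ball_zero_iff.mpr ht)
    rw [sub_zero] at h1
    simpa [lineCoeff] using norm_iteratedFDeriv_apply_sub_le he.le h1
  set N : ℝ := ‖Matrix.toEuclideanCLM (𝕜 := ℝ) Sig‖ with hN
  have hsq : ∀ t : Rd d, ‖t‖ < δ → ‖eigenPhase lam b t‖ ≤ (N + c₀) * ‖t‖ ^ 2 := by
    intro t ht
    have h1 := hexp t ht
    have h2 : ‖((⟪t, Matrix.toEuclideanCLM (𝕜 := ℝ) Sig t⟫ / 2 : ℝ) : ℂ)‖ ≤ N * ‖t‖ ^ 2 := by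
      rw [Complex.norm_real, norm_div, Real.norm_eq_abs, RCLike.norm_ofNat]
      have h3 := abs_real_inner_le_norm t (Matrix.toEuclideanCLM (𝕜 := ℝ) Sig t)
      have h4 := (Matrix.toEuclideanCLM (𝕜 := ℝ) Sig).le_opNorm t
      have h5 := mul_le_mul_of_nonneg_left h4 (norm_nonneg t)
      have h6 := abs_nonneg ⟪t, Matrix.toEuclideanCLM (𝕜 := ℝ) Sig t⟫
      rw [← hN] at h5
      nlinarith
    have h3 := norm_sub_norm_le (eigenPhase lam b t)
      ((⟪t, Matrix.toEuclideanCLM (𝕜 := ℝ) Sig t⟫ / 2 : ℝ) : ℂ)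
    nlinarith [sq_nonneg ‖t‖]
  have hN0 : 0 ≤ N := norm_nonneg _
  set K : ℝ := K₁ + |K₂| + ‖b‖ + N + c₀ with hK
  have hK0 : 0 ≤ K := by positivity
  set r₀ : ℝ := min (1 / 2) (min (R / 3) (δ / 2)) with hr₀
  have hr1 : r₀ ≤ 1 / 2 := min_le_left _ _
  have hr2 : r₀ ≤ R / 3 := (min_le_right _ _).trans (min_le_left _ _)
  have hr3 : r₀ ≤ δ / 2 := (min_le_right _ _).trans (min_le_right _ _)
  refine ⟨r₀, c₀ / 4, K, by positivity, by linarith, by linarith, by positivity, hK0,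
    fun r ρ hr hrr hρ hρr e he => ⟨?_, fun t ht => ?_, fun t ht => ?_⟩, fun t ht => ?_⟩
  · have h1 : ContinuousOn lam (ball 0 (2 * r)) :=
      hlam2.continuousOn.mono (ball_subset_ball (by linarith))
    unfold eigenPhase
    exact (continuousOn_const.sub h1).add (by fun_prop)
  · have h1 := hexp t (by linarith)
    have h2 := (Complex.abs_re_le_norm _).trans h1
    rw [Complex.sub_re, Complex.ofReal_re] at h2
    have h3 := hQ t
    have h4 := neg_le_of_abs_le h2
    linarith
  · obtain ⟨hp, hrem⟩ := htay t e he ρ hρ.le (fun s hs => by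
      rw [mem_ball_zero_iff]
      have h1 := norm_add_le t (s • e)
      rw [norm_smul, he, mul_one, Real.norm_eq_abs] at h1
      linarith)
    have hFt : ‖eigenPhase lam b t‖ ≤ K := by
      have h1 := hsq t (by linarith)
      have h2 : ‖t‖ ^ 2 ≤ 1 := by nlinarith [norm_nonneg t]
      have : (N + c₀) * ‖t‖ ^ 2 ≤ (N + c₀) * 1 := by gcongr
      rw [hK]
      have := abs_nonneg K₂
      have := norm_nonneg b
      linarith
    have hone : -lineCoeff lam t e 1 + Complex.I * ((⟪e, b⟫ : ℝ) : ℂ) =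
        -(lineCoeff lam t e 1 - lineCoeff lam 0 e 1) := by
      rw [lineCoeff_one lam 0 e, fderiv_eigenvalue hmean]; ring
    refine ⟨fun j => if j = 0 then eigenPhase lam b t else if j = 1 then
      -lineCoeff lam t e 1 + Complex.I * ((⟪e, b⟫ : ℝ) : ℂ) else -lineCoeff lam t e j,
      by simp, ?_, fun j hj => ?_, fun s hs => ?_⟩
    · simp only [one_ne_zero, if_false, if_true]
      rw [hone, norm_neg]
      refine (hlip t (by linarith) e he).trans ?_
      gcongr
      rw [hK]; linarith [norm_nonneg b]
    · dsimp only
      split_ifs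
      · exact hFt
      · refine (norm_add_le _ _).trans ?_
        rw [norm_neg, norm_mul, Complex.norm_I, one_mul, Complex.norm_real]
        have h1 := hp 1 (by omega)
        have h2 := norm_inner_le_norm (𝕜 := ℝ) e b
        rw [he, one_mul] at h2
        have := abs_nonneg K₂
        rw [hK]; linarith
      · rw [norm_neg]
        refine (hp j hj).trans ?_
        have := abs_nonneg K₂
        have := norm_nonneg b
        rw [hK]; linarith
    · have hsum : eigenPhase lam b (t + s • e) - ∑ j ∈ Finset.range (⌊m⌋₊ + 1),
          (if j = 0 then eigenPhase lam b t else if j = 1 then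
            -lineCoeff lam t e 1 + Complex.I * ((⟪e, b⟫ : ℝ) : ℂ) else -lineCoeff lam t e j) *
            (s : ℂ) ^ j =
          -(lam (t + s • e) -
            ∑ j ∈ Finset.range (⌊m⌋₊ + 1), lineCoeff lam t e j * (s : ℂ) ^ j) := by
        obtain ⟨n, hn⟩ : ∃ n, ⌊m⌋₊ + 1 = n + 2 := ⟨⌊m⌋₊ - 1, by omega⟩
        rw [hn, Finset.sum_range_succ', Finset.sum_range_succ',
          Finset.sum_range_succ' (fun j => lineCoeff lam t e j * (s : ℂ) ^ j),
          Finset.sum_range_succ' (fun j => lineCoeff lam t e (j + 1) * (s : ℂ) ^ (j + 1))]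
        simp only [Nat.add_eq_zero_iff, one_ne_zero, and_false, if_false, if_true,
          Nat.add_eq_right, lineCoeff_zero, neg_mul, Finset.sum_neg_distrib, zero_add, pow_zero,
          mul_one, pow_one, eigenPhase, inner_add_left, inner_smul_left]
        push_cast
        simp only [conj_trivial]
        ring
      rw [hsum, norm_neg]
      refine (hrem s hs).trans ?_
      gcongr
      have := abs_nonneg K₂
      have := norm_nonneg b
      rw [hK]; linarith
  · refine (hsq t (by linarith)).trans ?_
    gcongr
    have := abs_nonneg K₂
    have := norm_nonneg b
    rw [hK]; linarith

theorem tendsto_eigenPhase_scaled {R : ℝ} (hR : 0 < R)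
    (hlam : ContDiffOn ℝ 2 lam (ball 0 R)) (h0 : lam 0 = 1)
    (hmean : ∀ j : Fin d,
      ((b j : ℝ) : ℂ) = -Complex.I * fderiv ℝ lam 0 (EuclideanSpace.single j (1 : ℝ)))
    (hsig : ∀ j l : Fin d, ((Sig j l : ℝ) : ℂ) = -iteratedFDeriv ℝ 2 lam 0
      ![EuclideanSpace.single j (1 : ℝ), EuclideanSpace.single l (1 : ℝ)]) (y : Rd d) :
    Tendsto (fun τ : ℝ => (τ : ℂ) * eigenPhase lam b ((√τ)⁻¹ • y)) atTop
      (𝓝 ((⟪y, Matrix.toEuclideanCLM (𝕜 := ℝ) Sig y⟫ / 2 : ℝ) : ℂ)) := by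
  rw [Metric.tendsto_nhds]
  intro ε hε
  obtain ⟨δ, hδ, hexp⟩ := eigenPhase_expansion hR hlam h0 hmean hsig
    (ε := ε / (2 * (‖y‖ ^ 2 + 1))) (by positivity)
  have hz : Tendsto (fun τ : ℝ => ‖(√τ)⁻¹ • y‖) atTop (𝓝 0) := by
    simpa using ((tendsto_inv_atTop_zero.comp Real.tendsto_sqrt_atTop).smul_const y).norm
  filter_upwards [hz.eventually_lt_const hδ, eventually_gt_atTop 0] with τ h1 hτ
  have h2 := hexp _ h1
  have hsq : (√τ)⁻¹ * (√τ)⁻¹ = τ⁻¹ := by rw [← mul_inv, Real.mul_self_sqrt hτ.le]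
  rw [map_smul, inner_smul_left, inner_smul_right, conj_trivial, ← mul_assoc, hsq, norm_smul,
    norm_inv, Real.norm_of_nonneg (Real.sqrt_nonneg _), mul_pow, inv_pow, Real.sq_sqrt hτ.le] at h2
  have h3 : (τ : ℂ) * eigenPhase lam b ((√τ)⁻¹ • y) -
      ((⟪y, Matrix.toEuclideanCLM (𝕜 := ℝ) Sig y⟫ / 2 : ℝ) : ℂ) =
      (τ : ℂ) * (eigenPhase lam b ((√τ)⁻¹ • y) -
        ((τ⁻¹ * ⟪y, Matrix.toEuclideanCLM (𝕜 := ℝ) Sig y⟫ / 2 : ℝ) : ℂ)) := by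
    have : (τ : ℂ) ≠ 0 := by exact_mod_cast hτ.ne'
    push_cast
    field_simp
  rw [dist_eq_norm, h3, norm_mul, Complex.norm_real, Real.norm_of_nonneg hτ.le]
  calc τ * ‖eigenPhase lam b ((√τ)⁻¹ • y) -
        ((τ⁻¹ * ⟪y, Matrix.toEuclideanCLM (𝕜 := ℝ) Sig y⟫ / 2 : ℝ) : ℂ)‖
      ≤ τ * (ε / (2 * (‖y‖ ^ 2 + 1)) * (τ⁻¹ * ‖y‖ ^ 2)) := by gcongr
    _ = ε * (‖y‖ ^ 2 / (2 * (‖y‖ ^ 2 + 1))) := by field_simp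
    _ < ε * 1 := by
        refine mul_lt_mul_of_pos_left ?_ hε
        rw [div_lt_one (by positivity)]
        nlinarith [sq_nonneg ‖y‖]
    _ = ε := mul_one ε

end

section

/-! ### The singular contribution -/

variable {d : ℕ} {lam L : Rd d → ℂ} {b : Rd d} {Sig : Matrix (Fin d) (Fin d) ℝ}

/-- The real constant by which `L 0` is multiplied in `renewalConst`. -/
def limitFactor (b : Rd d) (Sig : Matrix (Fin d) (Fin d) ℝ) (A : Rd d) : ℝ :=
  (invSqrt Sig).det / ‖invSqrtCLM Sig b‖ *
    Real.exp ((⟪invSqrtCLM Sig b, invSqrtCLM Sig A⟫ ^ 2 -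
      ‖invSqrtCLM Sig b‖ ^ 2 * ‖invSqrtCLM Sig A‖ ^ 2) / (2 * ‖invSqrtCLM Sig b‖ ^ 2))

/-- The contribution of a neighbourhood of `0`: `1 / (1 - λ)` is integrable there, and the
oscillatory integrals with this singularity have the announced asymptotics. -/
theorem exists_singular_asymptotics {m R : ℝ} (hd : 2 ≤ d) (hm : 2 ≤ m)
    (hmd : ((d : ℝ) - 1) / 2 < m) (hR : 0 < R)
    (hlam : IsCbm m (ball 0 R) lam) (hL : IsCbm m (ball 0 R) L) (h0 : lam 0 = 1) (hb : b ≠ 0)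
    (hmean : ∀ j : Fin d,
      ((b j : ℝ) : ℂ) = -Complex.I * fderiv ℝ lam 0 (EuclideanSpace.single j (1 : ℝ)))
    (hsig : ∀ j l : Fin d, ((Sig j l : ℝ) : ℂ) = -iteratedFDeriv ℝ 2 lam 0
      ![EuclideanSpace.single j (1 : ℝ), EuclideanSpace.single l (1 : ℝ)])
    (hpos : Sig.PosDef) :
    ∃ r : ℝ, 0 < r ∧ r < R ∧ (∀ t, ‖t‖ < r → t ≠ 0 → lam t ≠ 1) ∧
      ∀ g : Rd d → ℂ, ContDiff ℝ (⊤ : ℕ∞) g → HasCompactSupport g → tsupport g ⊆ ball 0 r →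
        Integrable (fun t => g t * L t / (1 - lam t)) ∧
        ∀ (a : ℝ → Rd d) (A : Rd d),
          Tendsto (fun τ : ℝ => (√τ)⁻¹ • (a τ - τ • b)) atTop (𝓝 A) →
          Tendsto (fun τ : ℝ => τ ^ (((d : ℝ) - 1) / 2) •
            fourierInt (fun t => g t * L t / (1 - lam t)) (a τ)) atTop
            (𝓝 (g 0 * L 0 * (((2 * Real.pi) ^ (((d : ℝ) + 1) / 2) *
              limitFactor b Sig A : ℝ) : ℂ))) := by
  have hm0 : 0 < m := by linarith
  have hb0 : 0 < ‖b‖ := norm_pos_iff.mpr hb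
  have : Nontrivial (Rd d) := ⟨⟨b, 0, hb⟩⟩
  have he : ‖‖b‖⁻¹ • b‖ = 1 := by
    rw [norm_smul, norm_inv, norm_norm, inv_mul_cancel₀ hb0.ne']
  obtain ⟨r, c, K, hr, hr1, hrR, hc, hK, hphase, hsq⟩ :=
    exists_isPhase_eigenPhase hm hR hlam h0 hmean hsig hpos
  have hrR' : r < R := by linarith
  have hre : ∀ t, (eigenPhase lam b t).re = (1 - lam t).re := fun t => by
    rw [eigenPhase]
    simp
  have hD2 : ∀ t : Rd d, ‖t‖ < r → c * ‖t‖ ^ 2 ≤ ‖1 - lam t‖ := fun t ht => by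
    have h1 := (hphase r r hr le_rfl hr le_rfl _ he).re_ge t (by linarith)
    rw [hre] at h1
    exact h1.trans ((le_abs_self _).trans (Complex.abs_re_le_norm _))
  refine ⟨r, hr, hrR', fun t ht ht0 h1 => ?_, fun g hg hgc hgr => ?_⟩
  · have h2 := hD2 t ht
    rw [h1, sub_self, norm_zero] at h2
    have : 0 < ‖t‖ := norm_pos_iff.mpr ht0
    have : 0 < c * ‖t‖ ^ 2 := by positivity
    linarith
  have hgR : tsupport g ⊆ ball 0 R := hgr.trans (ball_subset_ball hrR'.le)
  have hcont : Continuous fun t => g t * L t :=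
    continuous_mul_of_isCbm isOpen_ball hg.continuous hL hgR
  have hzero : ∀ t, r ≤ ‖t‖ → g t * L t = 0 := fun t ht => by
    have : t ∉ tsupport g := fun h => by
      have := hgr h
      rw [mem_ball_zero_iff] at this
      linarith
    rw [image_eq_zero_of_notMem_tsupport this, zero_mul]
  have hint : Integrable (fun t => g t * L t / (1 - lam t)) := by
    obtain ⟨M, hM⟩ := (HasCompactSupport.mul_right (f' := L) hgc).exists_bound_of_continuous hcont
    refine integrable_div_of_le hd hb (r := r) (c₁ := (1 + K / c)⁻¹) (c₂ := c) (M := |M|)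
      (by positivity) hc (abs_nonneg _) (fun t => (hM t).trans (le_abs_self _)) hzero
      (fun t ht => ?_) hD2 ?_
    · rw [inv_mul_le_iff₀ (by positivity)]
      have h1 : |⟪b, t⟫| = ‖eigenPhase lam b t - (1 - lam t)‖ := by
        rw [eigenPhase, add_sub_cancel_left, norm_mul, Complex.norm_I, one_mul, Complex.norm_real,
          Real.norm_eq_abs, real_inner_comm]
      have h2 := norm_sub_le (eigenPhase lam b t) (1 - lam t)
      have h3 := hsq t (by linarith)
      have h4 : K * ‖t‖ ^ 2 ≤ K / c * ‖1 - lam t‖ := by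
        rw [div_mul_eq_mul_div, le_div_iff₀ hc]
        nlinarith [mul_le_mul_of_nonneg_left (hD2 t ht) hK]
      rw [h1]
      linarith
    · have hDm : AEStronglyMeasurable ((ball (0 : Rd d) R).indicator fun t => 1 - lam t) :=
        (aestronglyMeasurable_indicator_iff measurableSet_ball).mpr
          ((continuousOn_const.sub hlam.contDiffOn.continuousOn).aestronglyMeasurable
            measurableSet_ball)
      refine (hcont.aestronglyMeasurable.aemeasurable.div
        hDm.aemeasurable).aestronglyMeasurable.congr (Eventually.of_forall fun t => ?_)
      by_cases ht : t ∈ ball (0 : Rd d) R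
      · simp [Set.indicator_of_mem ht]
      · rw [mem_ball_zero_iff, not_lt] at ht
        simp [hzero t (hrR'.le.trans ht)]
  refine ⟨hint, fun a A ha => ?_⟩
  obtain ⟨ρ, K', hρ, hρ1, hK', hjet⟩ := exists_hasJet_mul hm0 isOpen_ball hg hgc hL hgR
  have hρ' : 0 < min ρ r := lt_min hρ hr
  have hψ : IsAmplitude ⌊m⌋₊ m r (min ρ r) (max K K') (‖b‖⁻¹ • b) (fun t => g t * L t) :=
    { continuous := hcont
      eq_zero := hzero
      hasJet := fun t _ => (hjet _ hρ'.le (min_le_left _ _) t _ he).mono (le_max_right _ _) }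
  have hF := (hphase r (min ρ r) hr le_rfl hρ' (min_le_right _ _) _ he).mono (le_max_left K K')
  have hk : 2 ≤ ⌊m⌋₊ := Nat.le_floor (by simpa using hm)
  have hlim := tendsto_fourierInt_div_drifted hd hm (Nat.lt_floor_add_one m).le hmd hr hρ'
    ((min_le_left _ _).trans hρ1) (min_le_right _ _) hc (hK.trans (le_max_left _ _)) hb hψ hF
    (by simpa only [drifted_eigenPhase] using hint)
    (tendsto_eigenPhase_scaled hR (hlam.contDiffOn.of_le (by exact_mod_cast hk)) h0 hmean hsig) ha
  rw [integral_fourierInt_gaussian hpos hb] at hlim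
  simpa only [drifted_eigenPhase, limitFactor] using hlim

end

section

/-! ### Summation of the series -/

variable {d : ℕ} {lam L : Rd d → ℂ} {b : Rd d} {Sig : Matrix (Fin d) (Fin d) ℝ}

theorem tendsto_zero_of_tendsto_sum_Icc {u : ℕ → ℂ} {l : ℂ}
    (h : Tendsto (fun N => ∑ n ∈ Finset.Icc 1 N, u n) atTop (𝓝 l)) : Tendsto u atTop (𝓝 0) := by
  rw [← tendsto_add_atTop_iff_nat 1]
  have h1 := ((tendsto_add_atTop_iff_nat 1).mpr h).sub h
  rw [sub_self] at h1
  refine h1.congr fun N => ?_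
  rw [Finset.sum_Icc_succ_top (by omega), add_sub_cancel_left]

theorem sum_Icc_pow {z : ℂ} (hz : z ≠ 1) (N : ℕ) :
    ∑ n ∈ Finset.Icc 1 N, z ^ n = (z - z ^ (N + 1)) / (1 - z) := by
  have h1 : 1 - z ≠ 0 := sub_ne_zero.mpr hz.symm
  rw [eq_div_iff h1]
  induction N with
  | zero => simp
  | succ N ih =>
    rw [Finset.sum_Icc_succ_top (by omega), add_mul, ih]
    ring

theorem IsCbm.exists_norm_le {m : ℝ} {O : Set (Rd d)} {g : Rd d → ℂ} (hg : IsCbm m O g) :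
    ∃ K : ℝ, 0 ≤ K ∧ ∀ x ∈ O, ‖g x‖ ≤ K := by
  obtain ⟨K, hK⟩ := hg.bounded 0 (Nat.zero_le _)
  refine ⟨|K|, abs_nonneg _, fun x hx => ?_⟩
  have h1 := hK x hx
  rw [norm_iteratedFDeriv_zero] at h1
  exact h1.trans (le_abs_self _)

theorem eventually_norm_le_of_tendstoUniformlyOn {F : ℕ → Rd d → ℂ} {G : Rd d → ℂ}
    {s : Set (Rd d)} {K : ℝ} (h : TendstoUniformlyOn F G atTop s) (hG : ∀ x ∈ s, ‖G x‖ ≤ K) :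
    ∀ᶠ N in atTop, ∀ x ∈ s, ‖F N x‖ ≤ K + 1 := by
  filter_upwards [Metric.tendstoUniformlyOn_iff.mp h 1 one_pos] with N hN x hx
  have h1 := hN x hx
  rw [dist_comm, dist_eq_norm] at h1
  have h2 := norm_le_norm_add_norm_sub' (F N x) (G x)
  linarith [hG x hx]

theorem fourierInt_add {F G : Rd d → ℂ} (hF : Integrable F) (hG : Integrable G) (x : Rd d) :
    fourierInt (fun t => F t + G t) x = fourierInt F x + fourierInt G x := by
  simp only [fourierInt, add_mul]
  exact integral_add (integrable_mul_cexp hF x) (integrable_mul_cexp hG x)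

theorem fourierInt_sub {F G : Rd d → ℂ} (hF : Integrable F) (hG : Integrable G) (x : Rd d) :
    fourierInt (fun t => F t - G t) x = fourierInt F x - fourierInt G x := by
  simp only [fourierInt, sub_mul]
  exact integral_sub (integrable_mul_cexp hF x) (integrable_mul_cexp hG x)

theorem isOpen_annulus (r b : ℝ) : IsOpen (annulus d r b) :=
  (isOpen_lt continuous_const continuous_norm).inter (isOpen_lt continuous_norm continuous_const)

/-- Convergence of the series away from `0` forces `|λ| < 1` in a pointed neighbourhood of `0`. -/
theorem exists_norm_eigenvalue_lt_one {R : ℝ} (hR : 0 < R) {e Rem : ℕ → Rd d → ℂ} {G : Rd d → ℂ}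
    (hL : ContinuousAt L 0) (hL0 : L 0 ≠ 0)
    (hdec : ∀ t ∈ ball (0 : Rd d) R, ∀ n : ℕ, 1 ≤ n → e n t = lam t ^ n * L t + Rem n t)
    (hG : ∀ t ∈ ball (0 : Rd d) R,
      Tendsto (fun N => ∑ n ∈ Finset.Icc 1 N, Rem n t) atTop (𝓝 (G t)))
    (haway : ∀ t : Rd d, t ≠ 0 →
      ∃ l, Tendsto (fun N => ∑ n ∈ Finset.Icc 1 N, e n t) atTop (𝓝 l)) :
    ∃ r : ℝ, 0 < r ∧ ∀ t : Rd d, ‖t‖ < r → t ≠ 0 → ‖lam t‖ < 1 := by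
  obtain ⟨δ, hδ, hne⟩ := Metric.eventually_nhds_iff.mp (hL.eventually_ne hL0)
  refine ⟨min δ R, lt_min hδ hR, fun t ht ht0 => ?_⟩
  have htR : t ∈ ball (0 : Rd d) R := mem_ball_zero_iff.mpr (ht.trans_le (min_le_right _ _))
  have hLt : L t ≠ 0 := hne (by rw [dist_zero_right]; exact ht.trans_le (min_le_left _ _))
  obtain ⟨l, hl⟩ := haway t ht0
  have h1 := (tendsto_zero_of_tendsto_sum_Icc hl).sub (tendsto_zero_of_tendsto_sum_Icc (hG t htR))
  rw [sub_zero] at h1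
  have h2 : Tendsto (fun n => lam t ^ n * L t) atTop (𝓝 0) := by
    refine h1.congr' ?_
    filter_upwards [eventually_ge_atTop 1] with n hn
    rw [hdec t htR n hn, add_sub_cancel_right]
  rw [← tendsto_pow_atTop_nhds_zero_iff_norm_lt_one]
  have h3 := h2.mul_const (L t)⁻¹
  rw [zero_mul] at h3
  exact h3.congr fun n => mul_inv_cancel_right₀ hLt _

/-- Against a smooth compactly supported function, the series `∑ e_n` has an integrable sum `J`,
equal to `1 / (1 - λ)` near `0` up to a function of class `C_b^m`; hence the asymptotics of its
Fourier transform. -/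
theorem exists_limit_asymptotics {m R : ℝ} (hd : 2 ≤ d) (hm : 2 ≤ m)
    (hmd : ((d : ℝ) - 1) / 2 < m) (hR : 0 < R)
    (hlam : IsCbm m (ball 0 R) lam) (hL : IsCbm m (ball 0 R) L) (h0 : lam 0 = 1)
    (hL0 : L 0 ≠ 0) (hb : b ≠ 0)
    (hmean : ∀ j : Fin d,
      ((b j : ℝ) : ℂ) = -Complex.I * fderiv ℝ lam 0 (EuclideanSpace.single j (1 : ℝ)))
    (hsig : ∀ j l : Fin d, ((Sig j l : ℝ) : ℂ) = -iteratedFDeriv ℝ 2 lam 0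
      ![EuclideanSpace.single j (1 : ℝ), EuclideanSpace.single l (1 : ℝ)])
    (hpos : Sig.PosDef) {e Rem : ℕ → Rd d → ℂ} {G : Rd d → ℂ}
    (he : ∀ n, 1 ≤ n → Continuous (e n))
    (hdec : ∀ t ∈ ball (0 : Rd d) R, ∀ n : ℕ, 1 ≤ n → e n t = lam t ^ n * L t + Rem n t)
    (hG : TendstoUniformlyOn (fun (N : ℕ) (t : Rd d) => ∑ n ∈ Finset.Icc 1 N, Rem n t) G atTop
      (ball (0 : Rd d) R)) (hGm : IsCbm m (ball 0 R) G)
    (haway : ∀ r b : ℝ, 0 < r → r < b → ∃ U : Rd d → ℂ,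
      TendstoUniformlyOn (fun (N : ℕ) (t : Rd d) => ∑ n ∈ Finset.Icc 1 N, e n t) U atTop
        (annulus d r b) ∧ IsCbm m (annulus d r b) U)
    {k : Rd d → ℂ} (hk : ContDiff ℝ (⊤ : ℕ∞) k) (hkc : HasCompactSupport k) :
    ∃ J : Rd d → ℂ,
      (∀ x, Tendsto (fun N : ℕ => fourierInt (fun t => k t * ∑ n ∈ Finset.Icc 1 N, e n t) x) atTop
        (𝓝 (fourierInt J x))) ∧
      ∀ (a : ℝ → Rd d) (A : Rd d),
        Tendsto (fun τ : ℝ => (√τ)⁻¹ • (a τ - τ • b)) atTop (𝓝 A) →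
        Tendsto (fun τ : ℝ => τ ^ (((d : ℝ) - 1) / 2) • fourierInt J (a τ)) atTop
          (𝓝 (k 0 * L 0 * (((2 * Real.pi) ^ (((d : ℝ) + 1) / 2) *
            limitFactor b Sig A : ℝ) : ℂ))) := by
  obtain ⟨r₁, hr₁, hr₁R, hne, hsing⟩ :=
    exists_singular_asymptotics hd hm hmd hR hlam hL h0 hb hmean hsig hpos
  have hpt : ∀ t : Rd d, t ≠ 0 →
      ∃ l, Tendsto (fun N => ∑ n ∈ Finset.Icc 1 N, e n t) atTop (𝓝 l) := fun t ht => by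
    have ht' : 0 < ‖t‖ := norm_pos_iff.mpr ht
    obtain ⟨U, hU, -⟩ := haway (‖t‖ / 2) (2 * ‖t‖) (by linarith) (by linarith)
    exact ⟨U t, hU.tendsto_at ⟨by linarith, by linarith⟩⟩
  obtain ⟨r₂, hr₂, hlt⟩ := exists_norm_eigenvalue_lt_one hR
    (hL.contDiffOn.continuousOn.continuousAt (ball_mem_nhds _ hR)) hL0 hdec
    (fun t ht => hG.tendsto_at ht) hpt
  set r : ℝ := min r₁ r₂ with hr
  have hr0 : 0 < r := lt_min hr₁ hr₂
  have hrr₁ : r ≤ r₁ := min_le_left _ _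
  have hrr₂ : r ≤ r₂ := min_le_right _ _
  -- `k = g₁ + g₂` with `g₁` supported near `0` and `g₂` away from `0`
  let χ : ContDiffBump (0 : Rd d) := ⟨r / 4, r / 2, by positivity, by linarith⟩
  have hχ : ContDiff ℝ (⊤ : ℕ∞) fun t => ((χ t : ℝ) : ℂ) :=
    Complex.ofRealCLM.contDiff.comp χ.contDiff
  set g₁ : Rd d → ℂ := fun t => k t * (χ t : ℂ) with hg₁
  set g₂ : Rd d → ℂ := fun t => k t * (1 - (χ t : ℂ)) with hg₂
  have hg₁s : ContDiff ℝ (⊤ : ℕ∞) g₁ := hk.mul hχ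
  have hg₂s : ContDiff ℝ (⊤ : ℕ∞) g₂ := hk.mul (contDiff_const.sub hχ)
  have hg₁c : HasCompactSupport g₁ := hkc.mul_right
  have hg₂c : HasCompactSupport g₂ := hkc.mul_right
  have hg₁z : ∀ t, r / 2 ≤ ‖t‖ → g₁ t = 0 := fun t ht => by
    simp only [hg₁]
    rw [χ.zero_of_le_dist (by rw [dist_zero_right]; exact ht), Complex.ofReal_zero, mul_zero]
  have hg₂z : ∀ t, ‖t‖ ≤ r / 4 → g₂ t = 0 := fun t ht => by
    simp only [hg₂]
    rw [χ.one_of_mem_closedBall (mem_closedBall_zero_iff.mpr ht), Complex.ofReal_one, sub_self,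
      mul_zero]
  have hg₁t : tsupport g₁ ⊆ closedBall 0 (r / 2) := closure_minimal (fun t ht => by
    by_contra h
    rw [mem_closedBall_zero_iff, not_le] at h
    exact ht (hg₁z t h.le)) isClosed_closedBall
  have hg₁r : tsupport g₁ ⊆ ball 0 r₁ := hg₁t.trans (closedBall_subset_ball (by linarith))
  have hg₁R : tsupport g₁ ⊆ ball 0 R := hg₁r.trans (ball_subset_ball hr₁R.le)
  obtain ⟨B₀, hB₀⟩ := hkc.isBounded.subset_closedBall (0 : Rd d)
  set B : ℝ := max B₀ r + 1 with hB
  have hg₂t : tsupport g₂ ⊆ annulus d (r / 8) B := fun t ht => by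
    have h1 : tsupport g₂ ⊆ {t | r / 4 ≤ ‖t‖} := closure_minimal (fun t ht => by
      by_contra h
      rw [Set.mem_ofPred_eq, not_le] at h
      exact ht (hg₂z t h.le)) (isClosed_le continuous_const continuous_norm)
    have h2 := h1 ht
    have h3 := hB₀ (closure_mono (Function.support_mul_subset_left _ _) ht)
    rw [Set.mem_ofPred_eq] at h2
    rw [mem_closedBall_zero_iff] at h3
    exact ⟨by linarith, by linarith [le_max_left B₀ r]⟩
  obtain ⟨U, hU, hUm⟩ := haway (r / 8) B (by positivity) (by linarith [le_max_right B₀ r])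
  obtain ⟨K₁, hK₁, hGb⟩ := hGm.exists_norm_le
  obtain ⟨K₂, hK₂, hUb⟩ := hUm.exists_norm_le
  have hO := isOpen_annulus (d := d) (r / 8) B
  obtain ⟨hI₁, hlim₁⟩ := hsing g₁ hg₁s hg₁c hg₁r
  have hI₂ : Integrable fun t => g₁ t * L t :=
    (continuous_mul_of_isCbm isOpen_ball hg₁s.continuous hL hg₁R).integrable_of_hasCompactSupport
      hg₁c.mul_right
  have hI₃ : Integrable fun t => g₁ t * G t :=
    (continuous_mul_of_isCbm isOpen_ball hg₁s.continuous hGm hg₁R).integrable_of_hasCompactSupport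
      hg₁c.mul_right
  have hI₄ : Integrable fun t => g₂ t * U t :=
    (continuous_mul_of_isCbm hO hg₂s.continuous hUm hg₂t).integrable_of_hasCompactSupport
      hg₂c.mul_right
  have hIg₁ : Integrable g₁ := hg₁s.continuous.integrable_of_hasCompactSupport hg₁c
  have hIg₂ : Integrable g₂ := hg₂s.continuous.integrable_of_hasCompactSupport hg₂c
  have hksplit : ∀ t, k t = g₁ t + g₂ t := fun t => by simp only [hg₁, hg₂]; ring
  have hsum : ∀ t, ‖t‖ < r → t ≠ 0 → ∀ N, ∑ n ∈ Finset.Icc 1 N, e n t =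
      L t / (1 - lam t) * (lam t - lam t ^ (N + 1)) + ∑ n ∈ Finset.Icc 1 N, Rem n t := by
    intro t ht ht0 N
    have htR : t ∈ ball (0 : Rd d) R := mem_ball_zero_iff.mpr (by linarith)
    rw [Finset.sum_congr rfl fun n hn => hdec t htR n (Finset.mem_Icc.mp hn).1,
      Finset.sum_add_distrib, ← Finset.sum_mul, sum_Icc_pow (hne t (by linarith) ht0)]
    ring
  have hae : ∀ᵐ t : Rd d, t ≠ 0 := by
    filter_upwards [ae_inner_ne_zero hb] with t ht h
    rw [h, inner_zero_right] at ht
    exact ht rfl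
  refine ⟨fun t => g₁ t * L t / (1 - lam t) - g₁ t * L t + g₁ t * G t + g₂ t * U t,
    fun x => ?_, fun a A ha => ?_⟩
  -- near `0`, `|λ| ≤ 1` bounds the geometric partial sums by `2 / |1 - λ|`
  · refine tendsto_integral_filter_of_dominated_convergence
      (fun t => 2 * ‖g₁ t * L t / (1 - lam t)‖ + (K₁ + 1) * ‖g₁ t‖ + (K₂ + 1) * ‖g₂ t‖)
      (Eventually.of_forall fun N => ?_) ?_
      (((hI₁.norm.const_mul 2).add (hIg₁.norm.const_mul _)).add (hIg₂.norm.const_mul _)) ?_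
    · exact ((hk.continuous.mul (continuous_finsetSum _ fun n hn =>
        he n (Finset.mem_Icc.mp hn).1)).mul (continuous_cexp_inner x)).aestronglyMeasurable
    · filter_upwards [eventually_norm_le_of_tendstoUniformlyOn hG hGb,
        eventually_norm_le_of_tendstoUniformlyOn hU hUb] with N hN₁ hN₂
      filter_upwards [hae] with t ht0
      rw [norm_mul, norm_cexp_neg_I_mul, mul_one, hksplit, add_mul]
      refine (norm_add_le _ _).trans (add_le_add ?_ ?_)
      · rcases le_or_gt r ‖t‖ with ht | ht
        · rw [hg₁z t (by linarith), zero_mul, norm_zero]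
          positivity
        · have htR : t ∈ ball (0 : Rd d) R := mem_ball_zero_iff.mpr (by linarith)
          have hl := (hlt t (by linarith) ht0).le
          rw [hsum t ht ht0, mul_add]
          refine (norm_add_le _ _).trans (add_le_add ?_ ?_)
          · rw [← mul_assoc, ← mul_div_assoc, norm_mul, mul_comm]
            gcongr
            refine (norm_sub_le _ _).trans ?_
            rw [norm_pow]
            linarith [pow_le_one₀ (n := N + 1) (norm_nonneg (lam t)) hl]
          · rw [norm_mul, mul_comm]
            gcongr
            exact hN₁ t htR
      · by_cases ht : t ∈ annulus d (r / 8) B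
        · rw [norm_mul, mul_comm]
          gcongr
          exact hN₂ t ht
        · rw [image_eq_zero_of_notMem_tsupport fun h => ht (hg₂t h), zero_mul, norm_zero, mul_zero]
    · filter_upwards [hae] with t ht0
      refine Tendsto.mul_const _ ?_
      have h1 : Tendsto (fun N => g₁ t * ∑ n ∈ Finset.Icc 1 N, e n t) atTop
          (𝓝 (g₁ t * L t / (1 - lam t) - g₁ t * L t + g₁ t * G t)) := by
        rcases le_or_gt r ‖t‖ with ht | ht
        · simp [hg₁z t (by linarith)]
        · have htR : t ∈ ball (0 : Rd d) R := mem_ball_zero_iff.mpr (by linarith)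
          have hl := hlt t (by linarith) ht0
          have hD : 1 - lam t ≠ 0 := sub_ne_zero.mpr (hne t (by linarith) ht0).symm
          have h2 := (tendsto_add_atTop_iff_nat 1).mpr
            (tendsto_pow_atTop_nhds_zero_of_norm_lt_one hl)
          have h3 := (((h2.const_sub (lam t)).const_mul (L t / (1 - lam t))).add
            (hG.tendsto_at htR)).const_mul (g₁ t)
          have h4 : g₁ t * (L t / (1 - lam t) * (lam t - 0) + G t) =
              g₁ t * L t / (1 - lam t) - g₁ t * L t + g₁ t * G t := by
            field_simp
            ring
          rw [h4] at h3
          exact h3.congr fun N => by rw [hsum t ht ht0]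
      have h2 : Tendsto (fun N => g₂ t * ∑ n ∈ Finset.Icc 1 N, e n t) atTop (𝓝 (g₂ t * U t)) := by
        by_cases ht : t ∈ annulus d (r / 8) B
        · exact (hU.tendsto_at ht).const_mul _
        · simp [image_eq_zero_of_notMem_tsupport fun h => ht (hg₂t h)]
      exact (h1.add h2).congr fun N => by rw [hksplit t]; ring
  · have hJ : ∀ x, fourierInt (fun t => g₁ t * L t / (1 - lam t) - g₁ t * L t + g₁ t * G t +
        g₂ t * U t) x = fourierInt (fun t => g₁ t * L t / (1 - lam t)) x -
        fourierInt (fun t => g₁ t * L t) x + fourierInt (fun t => g₁ t * G t) x +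
        fourierInt (fun t => g₂ t * U t) x := fun x => by
      rw [fourierInt_add (F := fun t => g₁ t * L t / (1 - lam t) - g₁ t * L t + g₁ t * G t)
          ((hI₁.sub hI₂).add hI₃) hI₄,
        fourierInt_add (F := fun t => g₁ t * L t / (1 - lam t) - g₁ t * L t) (hI₁.sub hI₂) hI₃,
        fourierInt_sub hI₁ hI₂]
    have l₂ := tendsto_fourierInt_smooth hm hmd isOpen_ball hg₁s hg₁c hL hg₁R hb ha
    have l₃ := tendsto_fourierInt_smooth hm hmd isOpen_ball hg₁s hg₁c hGm hg₁R hb ha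
    have l₄ := tendsto_fourierInt_smooth hm hmd hO hg₂s hg₂c hUm hg₂t hb ha
    have h1 := (((hlim₁ a A ha).sub l₂).add l₃).add l₄
    have hz : g₁ 0 = k 0 := by
      simp only [hg₁]
      rw [χ.one_of_mem_closedBall (mem_closedBall_self χ.rIn_pos.le), Complex.ofReal_one, mul_one]
    rw [hz, sub_zero, add_zero, add_zero] at h1
    refine h1.congr fun τ => ?_
    rw [hJ, smul_add, smul_add, smul_sub]

end

section

/-! ### Test functions -/

variable {d : ℕ}

open scoped FourierTransform in
theorem fourierInt_eq_fourier (G : Rd d → ℂ) (w : Rd d) :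
    fourierInt G w = 𝓕 G ((2 * Real.pi)⁻¹ • w) := by
  rw [Real.fourier_eq', fourierInt]
  congr 1
  ext t
  rw [inner_smul_right, smul_eq_mul, mul_comm]
  congr 2
  have := Real.pi_ne_zero
  rw [show -2 * Real.pi * ((2 * Real.pi)⁻¹ * ⟪t, w⟫) = -⟪t, w⟫ by field_simp]
  push_cast
  ring

theorem fourierInt_neg_of_even {φ : Rd d → ℂ} (hφ : ∀ t, φ (-t) = φ t) (w : Rd d) :
    fourierInt φ (-w) = fourierInt φ w := by
  rw [fourierInt, fourierInt, ← integral_neg_eq_self]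
  simp only [hφ, inner_neg_neg]

theorem fourierInt_im_of_even {φ : Rd d → ℝ} (hφ : ∀ t, φ (-t) = φ t) (w : Rd d) :
    (fourierInt (fun t => (φ t : ℂ)) w).im = 0 := by
  rw [← Complex.conj_eq_iff_im]
  refine Eq.trans ?_ (fourierInt_neg_of_even (fun t => by rw [hφ]) w)
  rw [fourierInt, fourierInt, ← integral_conj]
  congr 1
  ext t
  rw [map_mul, Complex.conj_ofReal, ← Complex.exp_conj, map_mul, map_neg, Complex.conj_I,
    Complex.conj_ofReal, inner_neg_right, Complex.ofReal_neg]
  simp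

theorem fourierInt_re {φ : Rd d → ℝ} (hφ : Integrable φ) (w : Rd d) :
    (fourierInt (fun t => (φ t : ℂ)) w).re = ∫ t, φ t * Real.cos ⟪t, w⟫ := by
  have hφ' : Integrable fun t => (φ t : ℂ) := hφ.ofReal
  have h1 := Complex.reCLM.integral_comp_comm (integrable_mul_cexp hφ' w)
  rw [Complex.reCLM_apply] at h1
  refine h1.symm.trans ?_
  congr 1
  ext t
  rw [Complex.reCLM_apply, Complex.re_ofReal_mul, neg_mul, mul_comm Complex.I, ← neg_mul,
    ← Complex.ofReal_neg, Complex.exp_ofReal_mul_I_re, Real.cos_neg]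

open scoped FourierTransform in
/-- Nonnegative integrable functions, bounded below on a given ball, whose Fourier transform is
smooth with compact support: the square of the Fourier transform of an even bump function supported
close to `0`. -/
theorem exists_test_kernel (d : ℕ) (M : ℝ) :
    ∃ (k : Rd d → ℂ) (h : Rd d → ℝ) (η : ℝ), ContDiff ℝ (⊤ : ℕ∞) k ∧ HasCompactSupport k ∧
      Continuous h ∧ Integrable h ∧ (∀ y, 0 ≤ h y) ∧ 0 < η ∧ (∀ y, ‖y‖ ≤ M → η ≤ h y) ∧
      (∀ y, fourierInt k (-y) = (h y : ℂ)) ∧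
      ∀ θ, ∫ x, (h x : ℂ) * Complex.exp (Complex.I * ((⟪θ, x⟫ : ℝ) : ℂ)) =
        (2 * Real.pi : ℝ) ^ d * k (-θ) := by
  have hpi := Real.pi_pos
  have hM : 0 < |M| + 1 := by positivity
  -- the support is so small that `|⟨t, y⟩| ≤ 1`, hence `cos ⟨t, y⟩ ≥ 1 / 2`, for `‖y‖ ≤ M`
  let φ : ContDiffBump (0 : Rd d) := ⟨(2 * (|M| + 1))⁻¹, (|M| + 1)⁻¹, by positivity, by
    gcongr; linarith⟩
  set Φ : Rd d → ℂ := fun t => ((φ t : ℝ) : ℂ) with hΦ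
  have hΦs : ContDiff ℝ (⊤ : ℕ∞) Φ := Complex.ofRealCLM.contDiff.comp φ.contDiff
  have hΦc : HasCompactSupport Φ := φ.hasCompactSupport.comp_left Complex.ofReal_zero
  have hΦi : Integrable Φ := hΦs.continuous.integrable_of_hasCompactSupport hΦc
  set k : Rd d → ℂ := convolution Φ Φ (ContinuousLinearMap.mul ℝ ℂ) volume with hk
  have hks : ContDiff ℝ (⊤ : ℕ∞) k :=
    hΦc.contDiff_convolution_right _ hΦi.locallyIntegrable hΦs
  have hkc : HasCompactSupport k := hΦc.convolution _ hΦc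
  have hFk : ∀ w, fourierInt k w = fourierInt Φ w ^ 2 := fun w => by
    rw [fourierInt_eq_fourier, fourierInt_eq_fourier, sq, ← Real.fourier_mul_convolution_eq hΦi hΦi]
    rfl
  have hkre : ∀ w, fourierInt k w = (((fourierInt Φ w).re ^ 2 : ℝ) : ℂ) := fun w => by
    rw [hFk, Complex.ofReal_pow]
    congr 1
    exact Complex.ext rfl (by simpa using fourierInt_im_of_even φ.neg w)
  set h : Rd d → ℝ := fun y => (fourierInt Φ y).re ^ 2 with hh
  have hkh : ∀ y, fourierInt k (-y) = (h y : ℂ) := fun y => by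
    rw [hkre, fourierInt_neg_of_even fun t => by simp only [hΦ, φ.neg]]
  set ks := hkc.toSchwartzMap hks with hkS
  have hkS' : (ks : Rd d → ℂ) = k := rfl
  have hhS : h = fun y => ((𝓕 ks : SchwartzMap (Rd d) ℂ) (-(2 * Real.pi)⁻¹ • y)).re := by
    ext y
    rw [SchwartzMap.fourier_coe, hkS', neg_smul, ← smul_neg, ← fourierInt_eq_fourier, hkh,
      Complex.ofReal_re]
  have hR : -(2 * Real.pi)⁻¹ ≠ 0 := by
    rw [neg_ne_zero]; positivity
  refine ⟨k, h, (2⁻¹ * ∫ t, φ t) ^ 2, hks, hkc, ?_, ?_, fun y => sq_nonneg _, ?_, fun y hy => ?_,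
    hkh, fun θ => ?_⟩
  · rw [hhS]
    exact Complex.continuous_re.comp
      ((𝓕 ks : SchwartzMap (Rd d) ℂ).continuous.comp (continuous_const_smul _))
  · rw [hhS]
    exact ((𝓕 ks : SchwartzMap (Rd d) ℂ).integrable.comp_smul hR).re
  · have := φ.integral_pos (μ := (volume : Measure (Rd d)))
    positivity
  · have hpos := φ.integral_pos (μ := (volume : Measure (Rd d)))
    have hφi : Integrable φ := φ.integrable
    rw [hh]
    refine pow_le_pow_left₀ (by positivity) ?_ 2
    rw [hΦ, fourierInt_re hφi, ← integral_const_mul]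
    refine integral_mono (hφi.const_mul _) (hφi.mul_bdd (c := 1)
      (Continuous.aestronglyMeasurable (by fun_prop))
      (Eventually.of_forall fun t => by simpa using Real.abs_cos_le_one _)) fun t => ?_
    by_cases ht : φ t = 0
    · simp [ht]
    · have h1 : ‖t‖ < (|M| + 1)⁻¹ := by
        by_contra hcon
        exact ht (φ.zero_of_le_dist (by rw [dist_zero_right]; exact not_lt.mp hcon))
      have h2 : |⟪t, y⟫| ≤ 1 := by
        refine (abs_real_inner_le_norm t y).trans ?_
        calc ‖t‖ * ‖y‖ ≤ (|M| + 1)⁻¹ * (|M| + 1) := by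
              gcongr; exact hy.trans ((le_abs_self M).trans (by linarith))
          _ = 1 := inv_mul_cancel₀ hM.ne'
      have h3 := Real.one_sub_sq_div_two_le_cos (x := ⟪t, y⟫)
      have h4 : ⟪t, y⟫ ^ 2 ≤ 1 := (sq_le_one_iff_abs_le_one _).mpr h2
      rw [mul_comm]
      gcongr
      · exact φ.nonneg
      · linarith
  · have hinv := congrFun (hks.continuous.fourierInv_fourier_eq
      (hks.continuous.integrable_of_hasCompactSupport hkc)
      (by simpa only [SchwartzMap.fourier_coe, hkS'] using
        (𝓕 ks : SchwartzMap (Rd d) ℂ).integrable)) (-θ)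
    rw [Real.fourierInv_eq'] at hinv
    have hsub := Measure.integral_comp_smul (volume : Measure (Rd d)) (fun w : Rd d =>
      Complex.exp (((2 * Real.pi * ⟪w, -θ⟫ : ℝ) : ℂ) * Complex.I) • 𝓕 k w) (-(2 * Real.pi)⁻¹)
    rw [hinv] at hsub
    have hc : |((-(2 * Real.pi)⁻¹) ^ Module.finrank ℝ (Rd d))⁻¹| = (2 * Real.pi) ^ d := by
      rw [finrank_euclideanSpace_fin, abs_inv, abs_pow, abs_neg, abs_inv,
        abs_of_pos (by positivity), inv_pow, inv_inv]
    rw [hc, Complex.real_smul, Complex.ofReal_pow] at hsub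
    rw [← hsub]
    congr 1
    ext x
    rw [neg_smul, ← smul_neg, ← fourierInt_eq_fourier, hkh, smul_eq_mul, mul_comm, inner_smul_left,
      inner_neg_neg, real_inner_comm, conj_trivial]
    congr 2
    rw [← mul_assoc, mul_inv_cancel₀ (by positivity), one_mul, mul_comm]

end

section

/-! ### The renewal measure tested against Fourier transforms -/

variable {Ω E : Type*} [MeasurableSpace Ω] {d : ℕ}

/-- The measure `A ↦ 𝔼[f(X_n) 1_A(S_n)]`, whose characteristic function is
`𝔼[f(X_n) exp(i⟨t, S_n⟩)]`. -/
def stepMeasure (P : Measure Ω) (X : ℕ → Ω → E) (S : ℕ → Ω → Rd d) (f : E → ℝ≥0) (n : ℕ) :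
    Measure (Rd d) :=
  (P.withDensity fun ω => (f (X n ω) : ℝ≥0∞)).map (S n)

theorem isFiniteMeasure_stepMeasure {P : Measure Ω} {X : ℕ → Ω → E} {S : ℕ → Ω → Rd d} {f : E → ℝ≥0}
    {n : ℕ} (h : Integrable (fun ω => (f (X n ω) : ℝ)) P) :
    IsFiniteMeasure (stepMeasure P X S f n) := by
  have : IsFiniteMeasure (P.withDensity fun ω => (f (X n ω) : ℝ≥0∞)) :=
    isFiniteMeasure_withDensity (by simpa [HasFiniteIntegral] using h.2.ne)
  rw [stepMeasure]
  infer_instance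

theorem fourierTerm_eq_charFun [MeasurableSpace E] {P : Measure Ω} {X : ℕ → Ω → E}
    {S : ℕ → Ω → Rd d} {f : E → ℝ≥0}
    (hX : ∀ n, Measurable (X n)) (hS : ∀ n, Measurable (S n)) (hf : Measurable f) (n : ℕ) :
    fourierTerm P X S f n = charFun (stepMeasure P X S f n) := by
  ext t
  rw [charFun_apply, stepMeasure, integral_map (hS n).aemeasurable
    (Continuous.aestronglyMeasurable (by fun_prop)),
    integral_withDensity_eq_integral_smul
      (f := fun ω => f (X n ω)) (hf.comp (hX n)), fourierTerm]
  congr 1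
  ext ω
  rw [NNReal.smul_def, Complex.real_smul, real_inner_comm, mul_comm Complex.I]

theorem renewalMeasure_eq (P : Measure Ω) (X : ℕ → Ω → E) {S : ℕ → Ω → Rd d} (f : E → ℝ≥0)
    (hS : ∀ n, Measurable (S n)) (a : ℝ → Rd d) (τ : ℝ) :
    renewalMeasure P X S f a τ = ENNReal.ofReal ((2 * Real.pi * τ) ^ (((d : ℝ) - 1) / 2)) •
      Measure.sum fun n : ℕ => (stepMeasure P X S f (n + 1)).map fun y => y - a τ := by
  rw [renewalMeasure]
  congr 2
  ext1 n
  have hsub : Measurable fun y : Rd d => y - a τ := by fun_prop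
  rw [stepMeasure, Measure.map_map hsub (hS _)]
  rfl

theorem integrable_mul_charFun {k : Rd d → ℂ} (hk : Integrable k) (μ : Measure (Rd d))
    [IsFiniteMeasure μ] : Integrable fun t => k t * charFun μ t :=
  hk.mul_bdd (c := μ.real Set.univ) stronglyMeasurable_charFun.aestronglyMeasurable
    (Eventually.of_forall norm_charFun_le)

/-- Parseval's formula. -/
theorem integral_map_sub_eq_fourierInt {k H : Rd d → ℂ} (hk : Integrable k) (hHc : Continuous H)
    (hH : ∀ y, fourierInt k (-y) = H y) (μ : Measure (Rd d)) [IsFiniteMeasure μ] (x : Rd d) :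
    ∫ y, H y ∂(μ.map fun y => y - x) = fourierInt (fun t => k t * charFun μ t) x := by
  have hsub : Measurable fun y : Rd d => y - x := by fun_prop
  rw [integral_map hsub.aemeasurable hHc.aestronglyMeasurable]
  simp only [← hH, neg_sub]
  rw [fourierInt]
  simp only [fourierInt]
  rw [integral_integral_swap]
  · congr 1
    ext t
    rw [integral_const_mul, mul_assoc, charFun_apply, ← integral_mul_const]
    congr 2
    ext y
    rw [← Complex.exp_add, inner_sub_right, real_inner_comm y t]
    congr 1
    push_cast
    ring
  · have h1 : Integrable (fun p : Rd d × Rd d => k p.2) (μ.prod volume) := hk.comp_snd μ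
    exact h1.mul_bdd (c := 1) (Continuous.aestronglyMeasurable (by fun_prop))
      (Eventually.of_forall fun _ => (norm_cexp_neg_I_mul _).le)

theorem sum_integral_map_sub {k H : Rd d → ℂ} (hk : Integrable k) (hHc : Continuous H)
    (hH : ∀ y, fourierInt k (-y) = H y) {μ : ℕ → Measure (Rd d)}
    (hμ : ∀ n, 1 ≤ n → IsFiniteMeasure (μ n)) (x : Rd d) (N : ℕ) :
    ∑ i ∈ Finset.range N, ∫ y, H y ∂((μ (i + 1)).map fun y => y - x) =
      fourierInt (fun t => k t * ∑ n ∈ Finset.Icc 1 N, charFun (μ n) t) x := by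
  induction N with
  | zero => simp [fourierInt]
  | succ N ih =>
    have := hμ (N + 1) (by omega)
    have hI : Integrable fun t => k t * ∑ n ∈ Finset.Icc 1 N, charFun (μ n) t := by
      simp only [Finset.mul_sum]
      refine integrable_finsetSum _ fun n hn => ?_
      have := hμ n (Finset.mem_Icc.mp hn).1
      exact integrable_mul_charFun hk _
    rw [Finset.sum_range_succ, ih, integral_map_sub_eq_fourierInt hk hHc hH,
      ← fourierInt_add hI (integrable_mul_charFun hk _)]
    congr 1
    ext t
    rw [Finset.sum_Icc_succ_top (by omega), mul_add]

variable {k : Rd d → ℂ} {h : Rd d → ℝ} {μ : ℕ → Measure (Rd d)} {x : Rd d}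

/-- Monotone convergence turns the convergence of the partial sums into integrability. -/
theorem integrable_sum_map_sub (hk : Integrable k) (hc : Continuous h) (h0 : ∀ y, 0 ≤ h y)
    (hh : ∀ y, fourierInt k (-y) = (h y : ℂ)) (hμ : ∀ n, 1 ≤ n → IsFiniteMeasure (μ n)) {z : ℂ}
    (hlim : Tendsto (fun N : ℕ =>
      fourierInt (fun t => k t * ∑ n ∈ Finset.Icc 1 N, charFun (μ n) t) x) atTop (𝓝 z)) :
    Integrable h (Measure.sum fun n => (μ (n + 1)).map fun y => y - x) := by
  refine integrable_sum_measure (fun n => ?_) ?_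
  · have := hμ (n + 1) (by omega)
    refine Integrable.of_bound hc.aestronglyMeasurable (∫ t, ‖k t‖)
      (Eventually.of_forall fun y => ?_)
    have h1 := norm_fourierInt_le k (-y)
    rwa [hh, Complex.norm_real] at h1
  · have h1 := (Complex.continuous_re.tendsto z).comp hlim
    refine ((hasSum_iff_tendsto_nat_of_nonneg (fun n => by positivity) z.re).mpr ?_).summable
    refine h1.congr fun N => ?_
    rw [Function.comp_apply,
      ← sum_integral_map_sub hk (Complex.continuous_ofReal.comp hc) hh hμ, Complex.re_sum]
    refine Finset.sum_congr rfl fun n _ => ?_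
    simp only [Function.comp_apply]
    rw [integral_complex_ofReal, Complex.ofReal_re]
    simp only [Real.norm_of_nonneg (h0 _)]

theorem integral_sum_map_sub {H : Rd d → ℂ} (hk : Integrable k) (hHc : Continuous H)
    (hH : ∀ y, fourierInt k (-y) = H y) (hμ : ∀ n, 1 ≤ n → IsFiniteMeasure (μ n)) {z : ℂ}
    (hlim : Tendsto (fun N : ℕ =>
      fourierInt (fun t => k t * ∑ n ∈ Finset.Icc 1 N, charFun (μ n) t) x) atTop (𝓝 z))
    (hint : Integrable H (Measure.sum fun n => (μ (n + 1)).map fun y => y - x)) :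
    ∫ y, H y ∂(Measure.sum fun n => (μ (n + 1)).map fun y => y - x) = z := by
  refine tendsto_nhds_unique (hasSum_integral_measure hint).tendsto_sum_nat ?_
  exact hlim.congr fun N => (sum_integral_map_sub hk hHc hH hμ x N).symm

end

section

/-! ### Weak convergence -/

variable {d : ℕ} {h : Rd d → ℝ} {μ : Measure (Rd d)}

/-- The probability measure proportional to `h μ`, for `h ≥ 0` with `0 < ∫ h dμ < ∞`. -/
def weighted (h : Rd d → ℝ) (μ : Measure (Rd d)) : Measure (Rd d) :=
  (ENNReal.ofReal (∫ x, h x ∂μ))⁻¹ • μ.withDensity fun x => ENNReal.ofReal (h x)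

theorem isProbabilityMeasure_weighted (h0 : ∀ x, 0 ≤ h x) (hi : Integrable h μ)
    (hpos : 0 < ∫ x, h x ∂μ) : IsProbabilityMeasure (weighted h μ) := by
  constructor
  rw [weighted, Measure.smul_apply, withDensity_apply _ MeasurableSet.univ, setLIntegral_univ,
    ← ofReal_integral_eq_lintegral_ofReal hi (Eventually.of_forall h0), smul_eq_mul]
  exact ENNReal.inv_mul_cancel (by simpa using hpos) ENNReal.ofReal_ne_top

theorem integral_weighted {F : Type*} [NormedAddCommGroup F] [NormedSpace ℝ F]
    (hc : Continuous h) (h0 : ∀ x, 0 ≤ h x) (u : Rd d → F) :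
    ∫ x, u x ∂(weighted h μ) = (∫ x, h x ∂μ)⁻¹ • ∫ x, h x • u x ∂μ := by
  rw [weighted, integral_smul_measure, integral_withDensity_eq_integral_toReal_smul
    (by fun_prop) (by simp), ENNReal.toReal_inv,
    ENNReal.toReal_ofReal (integral_nonneg h0)]
  simp only [ENNReal.toReal_ofReal (h0 _)]

/-- A form of Lévy's theorem for measures that are finite only after multiplication by `h`. -/
theorem tendsto_integral_mul_of_tendsto_fourier {V : ℝ → Measure (Rd d)} {C : ℝ} (hC : 0 < C)
    (hc : Continuous h) (h0 : ∀ x, 0 ≤ h x) (hi : Integrable h) (hpos : 0 < ∫ x, h x)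
    (hV : ∀ τ, 0 < τ → Integrable h (V τ))
    (hlim : ∀ θ : Rd d, Tendsto (fun τ => ∫ x, (h x : ℂ) *
      Complex.exp (Complex.I * ((⟪θ, x⟫ : ℝ) : ℂ)) ∂(V τ)) atTop
      (𝓝 (C * ∫ x, (h x : ℂ) * Complex.exp (Complex.I * ((⟪θ, x⟫ : ℝ) : ℂ)))))
    (u : BoundedContinuousFunction (Rd d) ℝ) :
    Tendsto (fun τ => ∫ x, h x * u x ∂(V τ)) atTop (𝓝 (C * ∫ x, h x * u x)) := by
  have hmass : Tendsto (fun τ => ∫ x, h x ∂(V τ)) atTop (𝓝 (C * ∫ x, h x)) := by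
    have h1 := (Complex.continuous_re.tendsto _).comp (hlim 0)
    simp only [inner_zero_left, Complex.ofReal_zero, mul_zero, Complex.exp_zero, mul_one,
      integral_complex_ofReal, ← Complex.ofReal_mul, Complex.ofReal_re] at h1
    exact h1.congr fun τ => by simp
  have hCpos : 0 < C * ∫ x, h x := by positivity
  refine tendsto_of_seq_tendsto fun s hs => ?_
  obtain ⟨n₀, hn₀⟩ := eventually_atTop.mp
    ((hs.eventually_gt_atTop 0).and ((hmass.comp hs).eventually_const_lt hCpos))
  rw [← tendsto_add_atTop_iff_nat n₀]
  have hs' : Tendsto (fun n => s (n + n₀)) atTop atTop := hs.comp (tendsto_add_atTop_nat n₀)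
  have hZ : ∀ n, 0 < ∫ x, h x ∂(V (s (n + n₀))) := fun n => (hn₀ _ (Nat.le_add_left _ _)).2
  have hint : ∀ n, Integrable h (V (s (n + n₀))) := fun n =>
    hV _ (hn₀ _ (Nat.le_add_left _ _)).1
  let p : ℕ → ProbabilityMeasure (Rd d) := fun n =>
    ⟨weighted h (V (s (n + n₀))), isProbabilityMeasure_weighted h0 (hint n) (hZ n)⟩
  let q : ProbabilityMeasure (Rd d) := ⟨weighted h volume, isProbabilityMeasure_weighted h0 hi hpos⟩
  have hchar : ∀ (ν : Measure (Rd d)) (θ : Rd d), charFun (weighted h ν) θ =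
      (((∫ x, h x ∂ν)⁻¹ : ℝ) : ℂ) *
        ∫ x, (h x : ℂ) * Complex.exp (Complex.I * ((⟪θ, x⟫ : ℝ) : ℂ)) ∂ν := fun ν θ => by
    rw [charFun_apply, integral_weighted hc h0, Complex.real_smul]
    congr 2
    ext x
    rw [Complex.real_smul, real_inner_comm, mul_comm Complex.I]
  have hpq : Tendsto p atTop (𝓝 q) := by
    refine ProbabilityMeasure.tendsto_of_tendsto_charFun fun θ => ?_
    change Tendsto (fun n => charFun (weighted h (V (s (n + n₀)))) θ) atTop
      (𝓝 (charFun (weighted h volume) θ))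
    simp only [hchar]
    have h1 := ((Complex.continuous_ofReal.tendsto _).comp
      ((hmass.comp hs').inv₀ hCpos.ne')).mul ((hlim θ).comp hs')
    have h2 : (((C * ∫ x, h x)⁻¹ : ℝ) : ℂ) * (C * ∫ x, (h x : ℂ) *
        Complex.exp (Complex.I * ((⟪θ, x⟫ : ℝ) : ℂ))) = (((∫ x, h x)⁻¹ : ℝ) : ℂ) *
        ∫ x, (h x : ℂ) * Complex.exp (Complex.I * ((⟪θ, x⟫ : ℝ) : ℂ)) := by
      have : (C : ℂ) ≠ 0 := by exact_mod_cast hC.ne'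
      rw [mul_inv, Complex.ofReal_mul, Complex.ofReal_inv]
      field_simp
    rw [h2] at h1
    exact h1
  have h2 := (ProbabilityMeasure.tendsto_iff_forall_integral_tendsto.mp hpq) u
  change Tendsto (fun n => ∫ x, u x ∂(weighted h (V (s (n + n₀))))) atTop
      (𝓝 (∫ x, u x ∂(weighted h volume))) at h2
  simp only [integral_weighted hc h0, smul_eq_mul] at h2
  have h3 := (hmass.comp hs').mul h2
  have h4 : C * (∫ x, h x) * ((∫ x, h x)⁻¹ * ∫ x, h x * u x) = C * ∫ x, h x * u x := by
    rw [mul_assoc, mul_inv_cancel_left₀ hpos.ne']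
  rw [h4] at h3
  refine h3.congr fun n => ?_
  exact mul_inv_cancel_left₀ (hZ n).ne' _

/-- It suffices to test weak convergence against the products of characters with nonnegative
functions that are bounded below on arbitrarily large balls. -/
theorem weaklyConverges_of_tendsto_fourier {V : ℝ → Measure (Rd d)} {C : ℝ} (hC : 0 < C)
    (H : ∀ M : ℝ, ∃ (h : Rd d → ℝ) (η : ℝ), Continuous h ∧ (∀ x, 0 ≤ h x) ∧ Integrable h ∧
      0 < η ∧ (∀ x, ‖x‖ ≤ M → η ≤ h x) ∧ (∀ τ, 0 < τ → Integrable h (V τ)) ∧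
      ∀ θ : Rd d, Tendsto (fun τ => ∫ x, (h x : ℂ) *
        Complex.exp (Complex.I * ((⟪θ, x⟫ : ℝ) : ℂ)) ∂(V τ)) atTop
        (𝓝 (C * ∫ x, (h x : ℂ) * Complex.exp (Complex.I * ((⟪θ, x⟫ : ℝ) : ℂ))))) :
    WeaklyConverges V (ENNReal.ofReal C • (volume : Measure (Rd d))) := by
  refine ⟨fun τ hτ => ⟨fun K hK => ?_⟩, fun g hg hgc => ?_⟩
  · obtain ⟨M, hM⟩ := hK.isBounded.subset_closedBall (0 : Rd d)
    obtain ⟨h, η, -, -, -, hη, hlow, hV, -⟩ := H M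
    refine (measure_mono fun x hx => ?_).trans_lt ((hV τ hτ).measure_norm_ge_lt_top hη)
    exact (hlow x (mem_closedBall_zero_iff.mp (hM hx))).trans (le_abs_self _)
  · obtain ⟨M, hM⟩ := hgc.isBounded.subset_closedBall (0 : Rd d)
    -- a positive radius, so that `h` does not vanish identically even if `g = 0`
    obtain ⟨h, η, hc, h0, hi, hη, hlow, hV, hlim⟩ := H (max M 1)
    have hpos : 0 < ∫ x, h x := by
      rw [integral_pos_iff_support_of_nonneg h0 hi]
      refine (measure_ball_pos volume (0 : Rd d) one_pos).trans_le (measure_mono fun x hx => ?_)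
      exact (hη.trans_le (hlow x ((mem_ball_zero_iff.mp hx).le.trans (le_max_right _ _)))).ne'
    obtain ⟨B, hB⟩ := hgc.exists_bound_of_continuous hg
    have hmax : ∀ x, 0 < max (h x) η := fun x => hη.trans_le (le_max_right _ _)
    -- `h u = g`, since `h ≥ η` on the support of `g`; the maximum makes `u` continuous everywhere
    let u : BoundedContinuousFunction (Rd d) ℝ := BoundedContinuousFunction.ofNormedAddCommGroup
      (fun x => g x / max (h x) η) (hg.div (hc.max continuous_const) fun x => (hmax x).ne')
      (B / η) fun x => by
        rw [norm_div, Real.norm_of_nonneg (hmax x).le]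
        exact div_le_div₀ ((norm_nonneg _).trans (hB x)) (hB x) hη (le_max_right _ _)
    have hu : ∀ x, h x * u x = g x := fun x => by
      change h x * (g x / max (h x) η) = g x
      by_cases hx : g x = 0
      · rw [hx, zero_div, mul_zero]
      · have h1 : η ≤ h x := hlow x ((mem_closedBall_zero_iff.mp
          (hM (subset_tsupport _ hx))).trans (le_max_left _ _))
        rw [max_eq_left h1, mul_div_cancel₀ _ (hη.trans_le h1).ne']
    have h1 := tendsto_integral_mul_of_tendsto_fourier hC hc h0 hi hpos hV hlim u
    simp only [hu] at h1
    rw [integral_smul_measure, ENNReal.toReal_ofReal hC.le, smul_eq_mul]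
    exact h1

end

section

/-! ### The renewal theorem -/

variable {Ω E : Type*} [MeasurableSpace Ω] [MeasurableSpace E] {d : ℕ}

theorem limitFactor_pos {Sig : Matrix (Fin d) (Fin d) ℝ} (h : Sig.PosDef) {b : Rd d} (hb : b ≠ 0)
    (A : Rd d) : 0 < limitFactor b Sig A := by
  have h1 : 0 < ‖invSqrtCLM Sig b‖ := norm_pos_iff.mpr fun h0 =>
    hb (invSqrtCLM_injective h (by rw [h0, map_zero]))
  have := invSqrt_det_pos h
  rw [limitFactor]
  positivity

/-- At `0` the remainders tend to `0`, so that `L 0` is the limit of the masses `𝔼[f(X_n)]`. -/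
theorem eigenfactor_pos {lam L : Rd d → ℂ} {Rem : ℕ → Rd d → ℂ} {μ : ℕ → Measure (Rd d)} {z : ℂ}
    (h0 : lam 0 = 1) (hL : L 0 ≠ 0)
    (hdec : ∀ n, 1 ≤ n → charFun (μ n) 0 = lam 0 ^ n * L 0 + Rem n 0)
    (hRem : Tendsto (fun N => ∑ n ∈ Finset.Icc 1 N, Rem n 0) atTop (𝓝 z)) :
    0 < (L 0).re ∧ (((L 0).re : ℝ) : ℂ) = L 0 := by
  have h1 : Tendsto (fun n => (((μ n).real Set.univ : ℝ) : ℂ)) atTop (𝓝 (L 0)) := by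
    have h2 := (tendsto_zero_of_tendsto_sum_Icc hRem).const_add (L 0)
    rw [add_zero] at h2
    refine h2.congr' ?_
    filter_upwards [eventually_ge_atTop 1] with n hn
    rw [← charFun_zero, hdec n hn, h0, one_pow, one_mul]
  have hre : 0 ≤ (L 0).re :=
    ge_of_tendsto ((Complex.continuous_re.tendsto _).comp h1)
      (Eventually.of_forall fun n => measureReal_nonneg)
  have him : (L 0).im = 0 :=
    tendsto_nhds_unique ((Complex.continuous_im.tendsto _).comp h1) tendsto_const_nhds
  have heq : (((L 0).re : ℝ) : ℂ) = L 0 := Complex.ext rfl (by simp [him])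
  refine ⟨lt_of_le_of_ne hre fun h => hL ?_, heq⟩
  rw [← heq, ← h, Complex.ofReal_zero]

theorem weaklyConverges_renewalMeasure {P : Measure Ω} (hd : 2 ≤ d)
    {X : ℕ → Ω → E} {S : ℕ → Ω → Rd d} (hX : ∀ n, Measurable (X n)) (hS : ∀ n, Measurable (S n))
    {f : E → ℝ≥0} (hf : Measurable f) {lam L : Rd d → ℂ} {b : Rd d}
    {Sig : Matrix (Fin d) (Fin d) ℝ} (hH : HypothesisH P X S f lam L b Sig)
    {a : ℝ → Rd d} {A : Rd d}
    (ha : Tendsto (fun τ : ℝ => (√τ)⁻¹ • (a τ - τ • b)) atTop (𝓝 A)) :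
    ∃ C : ℝ, 0 < C ∧ (C : ℂ) = renewalConst L b Sig A ∧
      WeaklyConverges (renewalMeasure P X S f a)
        (ENNReal.ofReal C • (volume : Measure (Rd d))) := by
  obtain ⟨m, hm, hR⟩ := hH.hypR
  obtain ⟨hmd, hm2⟩ := max_lt_iff.mp hm
  obtain ⟨R, hR0, Rem, hdec, hlam0, hlam, hL, G, hG, hGm⟩ := hR.near_zero
  have haway := hR.away_from_zero
  set μ : ℕ → Measure (Rd d) := stepMeasure P X S f with hμdef
  have hμ : ∀ n, 1 ≤ n → IsFiniteMeasure (μ n) := fun n hn =>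
    isFiniteMeasure_stepMeasure (hR.integrable n hn)
  simp only [fourierTerm_eq_charFun hX hS hf] at hdec haway
  obtain ⟨hLpos, hLre⟩ := eigenfactor_pos hlam0 hH.L_zero_ne
    (hdec 0 (mem_ball_self hR0)) (hG.tendsto_at (mem_ball_self hR0))
  have hlf := limitFactor_pos hH.sigma_posDef hH.mean_ne A
  set C : ℝ := (L 0).re * limitFactor b Sig A with hC
  have hC' : (C : ℂ) = L 0 * (limitFactor b Sig A : ℂ) := by rw [hC, Complex.ofReal_mul, hLre]
  refine ⟨C, by positivity, hC', weaklyConverges_of_tendsto_fourier (by positivity) fun M => ?_⟩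
  obtain ⟨k, h, η, hk, hkc, hc, hi, h0, hη, hlow, hkh, hinv⟩ := exists_test_kernel d M
  set α : ℝ := ((d : ℝ) - 1) / 2 with hα
  have hpi := Real.pi_pos
  -- multiplying `h` by a character translates `k`
  have hkθ : ∀ θ y : Rd d, fourierInt (fun t => k (t + -θ)) (-y) =
      (h y : ℂ) * Complex.exp (Complex.I * ((⟪θ, y⟫ : ℝ) : ℂ)) := fun θ y => by
    rw [fourierInt_translate, hkh, inner_neg_neg, mul_comm]
  have hkθs : ∀ θ, ContDiff ℝ (⊤ : ℕ∞) fun t : Rd d => k (t + -θ) := fun θ =>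
    hk.comp (contDiff_id.add contDiff_const)
  have hkθc : ∀ θ, HasCompactSupport fun t : Rd d => k (t + -θ) := fun θ =>
    hkc.comp_homeomorph (Homeomorph.addRight (-θ))
  have hkθi : ∀ θ, Integrable fun t : Rd d => k (t + -θ) := fun θ =>
    (hkθs θ).continuous.integrable_of_hasCompactSupport (hkθc θ)
  have hlimit := fun θ : Rd d => exists_limit_asymptotics hd hm2.le hmd hR0 hlam hL hlam0
    hH.L_zero_ne hH.mean_ne hH.mean_eq hH.sigma_eq hH.sigma_posDef
    (fun n hn => by have := hμ n hn; exact continuous_charFun) hdec hG hGm haway (hkθs θ) (hkθc θ)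
  choose J hJ hJlim using hlimit
  have hintW : ∀ x, Integrable h (Measure.sum fun n => (μ (n + 1)).map fun y => y - x) :=
    fun x => integrable_sum_map_sub (hkθi 0) hc h0
      (fun y => by simpa using hkθ 0 y) hμ (hJ 0 x)
  have hcθ : ∀ θ : Rd d, Continuous fun y =>
      (h y : ℂ) * Complex.exp (Complex.I * ((⟪θ, y⟫ : ℝ) : ℂ)) := fun θ => by fun_prop
  have hintθ : ∀ (θ x : Rd d), ∫ y, (h y : ℂ) * Complex.exp (Complex.I * ((⟪θ, y⟫ : ℝ) : ℂ))
      ∂(Measure.sum fun n => (μ (n + 1)).map fun y => y - x) = fourierInt (J θ) x := fun θ x =>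
    integral_sum_map_sub (hkθi θ) (hcθ θ) (hkθ θ) hμ (hJ θ x)
      ((hintW x).mono (hcθ θ).aestronglyMeasurable (Eventually.of_forall fun y => by
        rw [norm_mul, Complex.norm_real, mul_comm Complex.I, Complex.norm_exp_ofReal_mul_I,
          mul_one]))
  refine ⟨h, η, hc, h0, hi, hη, hlow, fun τ hτ => ?_, fun θ => ?_⟩
  · rw [renewalMeasure_eq P X f hS]
    exact (hintW _).smul_measure ENNReal.ofReal_ne_top
  · have h1 := (hJlim θ a A ha).const_smul ((2 * Real.pi) ^ α)
    have h2 : (2 * Real.pi) ^ α • (k (0 + -θ) * L 0 *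
        (((2 * Real.pi) ^ (((d : ℝ) + 1) / 2) * limitFactor b Sig A : ℝ) : ℂ)) =
        C * ∫ x, (h x : ℂ) * Complex.exp (Complex.I * ((⟪θ, x⟫ : ℝ) : ℂ)) := by
      have h3 : (2 * Real.pi) ^ α * (2 * Real.pi) ^ (((d : ℝ) + 1) / 2) = (2 * Real.pi) ^ d := by
        rw [← Real.rpow_add (by positivity), ← Real.rpow_natCast, hα]
        congr 1
        ring
      rw [hinv, zero_add, hC', ← Complex.ofReal_pow, ← h3, Complex.real_smul]
      simp only [Complex.ofReal_mul]
      ring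
    rw [h2] at h1
    refine h1.congr' ?_
    filter_upwards [eventually_gt_atTop 0] with τ hτ
    rw [renewalMeasure_eq P X f hS, integral_smul_measure, hintθ,
      ENNReal.toReal_ofReal (by positivity), Real.mul_rpow (by positivity) hτ.le, mul_smul]

end

end Renewal

end

theorem theorem1 {Ω E : Type*} [MeasurableSpace Ω] [MeasurableSpace E]
    (P : Measure Ω) [IsProbabilityMeasure P] (d : ℕ) (hd : 2 ≤ d)
    (X : ℕ → Ω → E) (S : ℕ → Ω → Renewal.Rd d)
    (hX : ∀ n, Measurable (X n)) (hS : ∀ n, Measurable (S n))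
    (f : E → ℝ≥0) (hf : Measurable f)
    (lam L : Renewal.Rd d → ℂ) (mvec : Renewal.Rd d) (Sig : Matrix (Fin d) (Fin d) ℝ)
    (hH : Renewal.HypothesisH P X S f lam L mvec Sig)
    (a : ℝ → Renewal.Rd d) (A : Renewal.Rd d)
    (ha : Tendsto (fun τ : ℝ => (Real.sqrt τ)⁻¹ • (a τ - τ • mvec)) atTop (𝓝 A)) :
    ∃ C : ℝ, 0 < C ∧ (C : ℂ) = Renewal.renewalConst L mvec Sig A ∧
      Renewal.WeaklyConverges (Renewal.renewalMeasure P X S f a)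
        (ENNReal.ofReal C • (volume : Measure (Renewal.Rd d))) :=
  Renewal.weaklyConverges_renewalMeasure hd hX hS hf hH ha
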